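/- Fix a linear system $x_{t+1}=Ax_t+Bu_t$ with $x_t\in\mathbb R^n$, $u_t\in\mathbb R^m$ ($m\ge1$), $x_0=0$, in canonical form: the state coordinates are split into consecutive blocks of sizes $p_1,\dots,p_m\ge 1$; with $k_i=p_1+\dots+p_i$ and $\mathcal I=\{k_1,\dots,k_m\}$, the rows $k_1,\dots,k_m$ of $B$ form $I_m$, the other rows of $B$ vanish, and each row $r\notin\mathcal I$ of $A$ has a single nonzero entry, a $1$ in column $r+1$ (the rows of $A$ in $\mathcal I$ are arbitrary). Let $p=\max_i p_i$ and let $A(\mathcal I,:)$ be the submatrix of rows $k_1,\dots,k_m$. **Linear quadratic tracking.** For a horizon $N\ge1$ and data $Q_t$, $\theta_t$ ($0\le t\le N$), $R_t$ ($0\le t<N$), put $f_t(x)=\frac12(x-\theta_t)^\top Q_t(x-\theta_t)$, $g_t(u)=\frac12u^\top R_tu$ and $J(\mathbf x,\mathbf u)=\sum_{t=0}^{N-1}(f_t(x_t)+g_t(u_t))+f_N(x_N)$. Let $J^*$ be the minimum of $J$ over all trajectories of the system from $x_0=0$. The regret of an algorithm is $J-J^*$ for the trajectory that it produces. **Riccati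 solutions.** For positive definite $Q,R$ let $P^e(Q,R)$ be the positive semidefinite solution of $P=Q+A^\top(P-PB(B^\top PB+R)^{-1}B^\top P)A$, and put $K^e=(R+B^\top P^eB)^{-1}B^\top P^eA$ and $F(Q,R)=(P^e)^{-1}(I-(A-BK^e)^\top)^{-1}Q$. For constants $\mu_f,l_f,\mu_g,l_g>0$ let (in the Loewner order) $\mathcal Q=\{Q:\mu_fI\le Q\le l_fI\}$, $\mathcal R=\{R:\mu_gI\le R\le l_gI\}$ and $\mathcal P=\{P: P^e(\mu_fI,\mu_gI)\le P\le P^e(l_fI,l_gI)\}$. **RHTM with FOSS initialization.** For $\mathbf z=(z_1,\dots,z_N)\in\mathbb R^{mN}$, and $z_s=0$ for $s\le0$, let $x_t=(z^1_{t-p_1+1},\dots,z^1_t,\dots,z^m_{t-p_m+1},\dots,z^m_t)^\top$, $u_t=z_{t+1}-A(\mathcal I,:)x_t$ and $C(\mathbf z)=\sum_{t=0}^{N}f_t(x_t)+\sum_{t=0}^{N-1}g_t(u_t)$. Let $\mu_c,l_c>0$ be such that $C$ is $\mu_c$-strongly convex and $l_c$-smooth (its gradient is $l_c$-Lipschitz),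 and put $\zeta=l_c/\mu_c$, $\phi=1-1/\sqrt\zeta$, $\gamma_c=\frac{1+\phi}{l_c}$, $\gamma_\omega=\frac{\phi^2}{2-\phi}$, $\gamma_y=\frac{\phi^2}{(1+\phi)(2-\phi)}$, $\gamma_z=\frac{\phi^2}{1-\phi^2}$. For $0\le t<N$ let $(x_t^e,u_t^e)$ minimize $f_t(x)+g_t(u)$ subject to $x=Ax+Bu$. FOSS sets $z_{t+1}(0)$ to the subvector of $x_t^e$ with indices in $\mathcal I$. For a lookahead window $W\ge1$ let $K=\lfloor (W-1)/p\rfloor$. Starting from $\omega_s(-1)=\omega_s(0)=y_s(0)=z_s(0)$, RHTM computes for $1\le s\le N$ and $1\le j\le K$ $$\omega_s(j)=(1+\gamma_\omega)\omega_s(j-1)-\gamma_\omega\omega_s(j-2)-\gamma_c\tfrac{\partial C}{\partial z_s}(\mathbf y(j-1)),$$ $$y_s(j)=(1+\gamma_y)\omega_s(j)-\gamma_y\omega_s(j-1),\qquad z_s(j)=(1+\gamma_z)\omega_s(j)-\gamma_z\omega_s(j-1)$$ (the values with indices $(s,j)$ at time $t=s-W+jp$; the partial gradient only involves $y_{s-p},\dots,y_{s+p}$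 and $f_\tau,g_\tau$ with $s-1\le\tau\le s+p-1$), and applies $u_t=z_{t+1}(K)-A(\mathcal I,:)x_t$ at the observed state $x_t$. **Claim.** For all such $A,B$, all $\mu_f,l_f,\mu_g,l_g>0$ and all $\bar\theta$ there is a constant $c>0$ that depends only on these, such that for all $N\ge1$, $Q_t\in\mathcal Q$ and $R_t\in\mathcal R$ ($0\le t<N$), $Q_N\in\mathcal P$, $\theta_t$ with $\|\theta_t\|\le\bar\theta$ ($0\le t\le N$), all $\mu_c,l_c$ as above and all $W\ge1$, $$\mathrm{Regret}(\mathrm{RHTM})\le c\,\zeta^2\Big(\frac{\sqrt\zeta-1}{\sqrt\zeta}\Big)^{2K}\Big(\sum_{t=1}^N\big(\|P_t^e-P_{t-1}^e\|+\|\beta_t^e-\beta_{t-1}^e\|\big)+\sum_{t=0}^N\|x_{t-1}^e-x_t^e\|\Big),$$ where $P_t^e=P^e(Q_t,R_t)$ and $\beta_t^e=F(Q_t,R_t)\theta_t$ for $t<N$, $P_N^e=Q_N$, $\beta_N^e=\theta_N$, $x_{-1}^e=x_0=0$, $x_N^e=\theta_N$, and the norms are the Euclidean and the spectral norm. -/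

import Mathlib

open scoped MatrixOrder Matrix.Norms.L2Operator

noncomputable section

namespace LQT

/-- The Euclidean norm of a real vector. -/
def vnorm {ι : Type*} [Fintype ι] (v : ι → ℝ) : ℝ :=
  ‖(WithLp.toLp 2 v : EuclideanSpace ℝ ι)‖

/-- The quadratic form `vᵀ M v`. -/
def quadForm {ι : Type*} [Fintype ι] (M : Matrix ι ι ℝ) (v : ι → ℝ) : ℝ :=
  v ⬝ᵥ (M.mulVec v)

/-- A linear system `x_{t+1} = A x_t + B u_t` with `m` inputs, whose `n = p_1 + ⋯ + p_m` state
coordinates are grouped into `m` consecutive blocks of sizes `p_1, …, p_m ≥ 1`. The coordinate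
`⟨i, l⟩` is the `l`-th one (counted from `0`) of block `i`. -/
structure LTISystem (m : ℕ) where
  p : Fin m → ℕ+
  A : Matrix (Σ i : Fin m, Fin (p i : ℕ)) (Σ i : Fin m, Fin (p i : ℕ)) ℝ
  B : Matrix (Σ i : Fin m, Fin (p i : ℕ)) (Fin m) ℝ

namespace LTISystem

variable {m : ℕ} (S : LTISystem m)

/-- Indices of the state coordinates. -/
abbrev Idx : Type := Σ i : Fin m, Fin (S.p i : ℕ)

/-- The last coordinate `k_i` of block `i`; these are the elements of `ℐ`. -/
def last (i : Fin m) : S.Idx := ⟨i, ⟨(S.p i : ℕ) - 1, Nat.sub_lt (S.p i).pos Nat.one_pos⟩⟩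

/-- The canonical form: a row of `A` that is not the last one of its block is a shift row (a single
`1`, at the next coordinate of the block), the last rows of the blocks of `A` are arbitrary, the
rows `k_1, …, k_m` of `B` form the identity matrix, and the other rows of `B` vanish. -/
def IsCanonical : Prop :=
  (∀ (i : Fin m) (l : Fin (S.p i : ℕ)), (l : ℕ) + 1 < (S.p i : ℕ) → ∀ k : S.Idx,
    S.A ⟨i, l⟩ k = if k.1 = i ∧ (k.2 : ℕ) = (l : ℕ) + 1 then 1 else 0) ∧
  (∀ (k : S.Idx) (j : Fin m), S.B k j = if k = S.last j then 1 else 0)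

/-- The controllability index `p = max {p_1, …, p_m}`. -/
def ctrlIndex : ℕ := Finset.univ.sup fun i => (S.p i : ℕ)

/-- The number `K = ⌊(W - 1) / p⌋` of triple momentum updates. -/
def iterations (W : ℕ) : ℕ := (W - 1) / S.ctrlIndex

/-- The state trajectory with `x_0 = 0` that is driven by the inputs `u_0, u_1, …`. -/
def traj (u : ℕ → Fin m → ℝ) : ℕ → S.Idx → ℝ
  | 0 => 0
  | t + 1 => S.A.mulVec (traj u t) + S.B.mulVec (u t)

/-- The product `A(ℐ, :) x`. -/
def AI (x : S.Idx → ℝ) : Fin m → ℝ := fun i => S.A.mulVec x (S.last i)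

/-- The state `x_t` in terms of the sequence `z`:
`x_t = (z¹_{t-p_1+1}, …, z¹_t, …, zᵐ_{t-p_m+1}, …, zᵐ_t)`. -/
def stateOf (z : ℤ → Fin m → ℝ) (t : ℤ) : S.Idx → ℝ :=
  fun k => z (t - (S.p k.1 : ℕ) + 1 + (k.2 : ℕ)) k.1

/-- The input in terms of the sequence `z`: `u_t = z_{t+1} - A(ℐ, :) x_t`. -/
def inputOf (z : ℤ → Fin m → ℝ) (t : ℤ) : Fin m → ℝ :=
  z (t + 1) - S.AI (S.stateOf z t)

/-- `P` is a positive semidefinite solution of the discrete-time algebraic Riccati equation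
`P = Q + Aᵀ (P - P B (Bᵀ P B + R)⁻¹ Bᵀ P) A`. -/
def IsDARESolution (Q : Matrix S.Idx S.Idx ℝ) (R : Matrix (Fin m) (Fin m) ℝ)
    (P : Matrix S.Idx S.Idx ℝ) : Prop :=
  P.PosSemidef ∧
    P = Q + S.A.transpose *
      (P - P * S.B * (S.B.transpose * P * S.B + R)⁻¹ * S.B.transpose * P) * S.A

/-- The solution `Pᵉ(Q, R)` of the discrete-time algebraic Riccati equation. -/
def Pe (Q : Matrix S.Idx S.Idx ℝ) (R : Matrix (Fin m) (Fin m) ℝ) : Matrix S.Idx S.Idx ℝ :=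
  Classical.epsilon (S.IsDARESolution Q R)

/-- The gain `Kᵉ = (R + Bᵀ Pᵉ B)⁻¹ Bᵀ Pᵉ A`. -/
def Ke (Q : Matrix S.Idx S.Idx ℝ) (R : Matrix (Fin m) (Fin m) ℝ) : Matrix (Fin m) S.Idx ℝ :=
  (R + S.B.transpose * S.Pe Q R * S.B)⁻¹ * S.B.transpose * S.Pe Q R * S.A

/-- The matrix `F(Q, R) = (Pᵉ)⁻¹ (I - (A - B Kᵉ)ᵀ)⁻¹ Q`. -/
def F (Q : Matrix S.Idx S.Idx ℝ) (R : Matrix (Fin m) (Fin m) ℝ) : Matrix S.Idx S.Idx ℝ :=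
  (S.Pe Q R)⁻¹ * (1 - (S.A - S.B * S.Ke Q R).transpose)⁻¹ * Q

/-- The stage cost `½ (x-θ)ᵀ Q (x-θ) + ½ uᵀ R u`. -/
def stageCost (Q : Matrix S.Idx S.Idx ℝ) (R : Matrix (Fin m) (Fin m) ℝ) (θ : S.Idx → ℝ)
    (x : S.Idx → ℝ) (u : Fin m → ℝ) : ℝ :=
  1 / 2 * quadForm Q (x - θ) + 1 / 2 * quadForm R u

/-- `(x, u)` minimises the stage cost among the steady states `x = A x + B u`. -/
def IsOptSteadyState (Q : Matrix S.Idx S.Idx ℝ) (R : Matrix (Fin m) (Fin m) ℝ) (θ : S.Idx → ℝ)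
    (xu : (S.Idx → ℝ) × (Fin m → ℝ)) : Prop :=
  xu.1 = S.A.mulVec xu.1 + S.B.mulVec xu.2 ∧
    ∀ (x' : S.Idx → ℝ) (u' : Fin m → ℝ), x' = S.A.mulVec x' + S.B.mulVec u' →
      S.stageCost Q R θ xu.1 xu.2 ≤ S.stageCost Q R θ x' u'

/-- The optimal steady state `(xᵉ, uᵉ)`. -/
def optSteadyState (Q : Matrix S.Idx S.Idx ℝ) (R : Matrix (Fin m) (Fin m) ℝ) (θ : S.Idx → ℝ) :
    (S.Idx → ℝ) × (Fin m → ℝ) :=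
  Classical.epsilon (S.IsOptSteadyState Q R θ)

/-- The set `𝒬 = {Q | μ_f I ≤ Q ≤ l_f I}`. -/
def Qset (μf lf : ℝ) : Set (Matrix S.Idx S.Idx ℝ) :=
  {Q | μf • (1 : Matrix S.Idx S.Idx ℝ) ≤ Q ∧ Q ≤ lf • (1 : Matrix S.Idx S.Idx ℝ)}

/-- The set `ℛ = {R | μ_g I ≤ R ≤ l_g I}`. -/
def Rset (_S : LTISystem m) (μg lg : ℝ) : Set (Matrix (Fin m) (Fin m) ℝ) :=
  {R | μg • (1 : Matrix (Fin m) (Fin m) ℝ) ≤ R ∧ R ≤ lg • (1 : Matrix (Fin m) (Fin m) ℝ)}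

/-- The set `𝒫 = {P | Pᵉ(μ_f I, μ_g I) ≤ P ≤ Pᵉ(l_f I, l_g I)}`. -/
def Pset (μf lf μg lg : ℝ) : Set (Matrix S.Idx S.Idx ℝ) :=
  {P | S.Pe (μf • (1 : Matrix S.Idx S.Idx ℝ)) (μg • (1 : Matrix (Fin m) (Fin m) ℝ)) ≤ P ∧
    P ≤ S.Pe (lf • (1 : Matrix S.Idx S.Idx ℝ)) (lg • (1 : Matrix (Fin m) (Fin m) ℝ))}

end LTISystem

/-- The data of a linear quadratic tracking problem: the horizon `N`, the weights `Q_0, …, Q_N` and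
`R_0, …, R_{N-1}`, and the reference trajectory `θ_0, …, θ_N`. Later entries are never used. -/
structure Tracking {m : ℕ} (S : LTISystem m) where
  N : ℕ
  Q : ℕ → Matrix S.Idx S.Idx ℝ
  R : ℕ → Matrix (Fin m) (Fin m) ℝ
  θ : ℕ → S.Idx → ℝ

/-- The variables of the triple momentum method after some iteration `j`; `ωprev` is `ω(j-1)`. -/
structure TMIterate (m : ℕ) where
  ωprev : ℤ → Fin m → ℝ
  ω : ℤ → Fin m → ℝ
  y : ℤ → Fin m → ℝ
  z : ℤ → Fin m → ℝ

/-- Step sizes of the triple momentum method. -/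
structure StepSizes where
  γc : ℝ
  γω : ℝ
  γy : ℝ
  γz : ℝ

/-- The step sizes for a strong convexity constant `μ` and a smoothness constant `l`:
with `ζ = l / μ` and `φ = 1 - 1 / √ζ`. -/
def tmSteps (μ l : ℝ) : StepSizes :=
  let φ : ℝ := 1 - 1 / Real.sqrt (l / μ)
  { γc := (1 + φ) / l
    γω := φ ^ 2 / (2 - φ)
    γy := φ ^ 2 / ((1 + φ) * (2 - φ))
    γz := φ ^ 2 / (1 - φ ^ 2) }

namespace Tracking

variable {m : ℕ} {S : LTISystem m} (T : Tracking S)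

/-- The state cost `f_t`. -/
def f (t : ℕ) (x : S.Idx → ℝ) : ℝ := 1 / 2 * quadForm (T.Q t) (x - T.θ t)

/-- The input cost `g_t`. -/
def g (t : ℕ) (u : Fin m → ℝ) : ℝ := 1 / 2 * quadForm (T.R t) u

/-- The total cost `J(x, u) = ∑_{t<N} (f_t(x_t) + g_t(u_t)) + f_N(x_N)`. -/
def J (x : ℕ → S.Idx → ℝ) (u : ℕ → Fin m → ℝ) : ℝ :=
  ∑ t ∈ Finset.range T.N, (T.f t (x t) + T.g t (u t)) + T.f T.N (x T.N)

/-- The optimal cost in hindsight `J*`. -/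
def Jstar : ℝ := sInf (Set.range fun u : ℕ → Fin m → ℝ => T.J (S.traj u) u)

/-- The sequence `(z_s)` with the entries of `z = (z_1, …, z_N)` for `1 ≤ s ≤ N`, and `0` for
`s ≤ 0` (as `x_0 = 0`); entries with `s > N` play no role. -/
def extend (z : EuclideanSpace ℝ (Fin T.N × Fin m)) : ℤ → Fin m → ℝ :=
  fun s i => if h : 1 ≤ s ∧ s ≤ T.N then z (⟨(s - 1).toNat, by omega⟩, i) else 0

/-- The objective `C(z) = ∑_{t ≤ N} f_t(x_t) + ∑_{t < N} g_t(u_t)` of the unconstrained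
reformulation. -/
def C (z : EuclideanSpace ℝ (Fin T.N × Fin m)) : ℝ :=
  ∑ t ∈ Finset.range (T.N + 1), T.f t (S.stateOf (T.extend z) t) +
    ∑ t ∈ Finset.range T.N, T.g t (S.inputOf (T.extend z) t)

/-- `C` is `μ`-strongly convex and `l`-smooth. -/
def HasModuli (μ l : ℝ) : Prop :=
  StrongConvexOn Set.univ μ T.C ∧ Differentiable ℝ T.C ∧
    ∀ z z' : EuclideanSpace ℝ (Fin T.N × Fin m),
      ‖gradient T.C z - gradient T.C z'‖ ≤ l * ‖z - z'‖

/-- The stage costs that involve `z_s`, namely `f_s, …, f_{s+p-1}` and `g_{s-1}, …, g_{s+p-1}`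
(those that exist), as a function of the sequence `z`. -/
def localCost (s : ℕ) (z : ℤ → Fin m → ℝ) : ℝ :=
  ∑ τ ∈ (Finset.Icc s (s + S.ctrlIndex - 1)).filter (· ≤ T.N), T.f τ (S.stateOf z τ) +
    ∑ τ ∈ (Finset.Icc (s - 1) (s + S.ctrlIndex - 1)).filter (· < T.N), T.g τ (S.inputOf z τ)

/-- The partial gradient `∂C/∂z_s (z_{s-p}, …, z_{s+p})`, computed from the neighbouring stage costs
and the neighbouring entries of `z` only. -/
def partialC (s : ℤ) (z : ℤ → Fin m → ℝ) : Fin m → ℝ :=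
  let w : ℤ → Fin m → ℝ := fun τ => if |τ - s| ≤ S.ctrlIndex then z τ else 0
  fun i => deriv
    (fun r : ℝ => T.localCost s.toNat (Function.update w s (Function.update (w s) i r))) (w s i)

/-- The optimal steady state `x_t^e` for `t < N`, and `x_N^e = θ_N`. -/
def xe (t : ℕ) : S.Idx → ℝ :=
  if t < T.N then (S.optSteadyState (T.Q t) (T.R t) (T.θ t)).1 else T.θ T.N

/-- `x_{t-1}^e`, where `x_{-1}^e = x_0 = 0`. -/
def xePrev (t : ℕ) : S.Idx → ℝ := if t = 0 then 0 else T.xe (t - 1)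

/-- `P_t^e = Pᵉ(Q_t, R_t)` for `t < N`, and `P_N^e = Q_N`. -/
def Pe (t : ℕ) : Matrix S.Idx S.Idx ℝ :=
  if t < T.N then S.Pe (T.Q t) (T.R t) else T.Q T.N

/-- `β_t^e = F(Q_t, R_t) θ_t` for `t < N`, and `β_N^e = θ_N`. -/
def βe (t : ℕ) : S.Idx → ℝ :=
  if t < T.N then (S.F (T.Q t) (T.R t)).mulVec (T.θ t) else T.θ T.N

/-- The FOSS initialization `z_{t+1}(0) = (x_t^e)_ℐ` for `0 ≤ t < N`. -/
def foss : ℤ → Fin m → ℝ :=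
  fun s i => if 1 ≤ s ∧ s ≤ T.N then T.xe (s - 1).toNat (S.last i) else 0

/-- The values `ω_s(j), y_s(j), z_s(j)` computed by RHTM from the initialization `z(0) = z0`. Every
value is assigned once: RHTM with window `W` assigns those with indices `(s, j)` at the time `t`
with `s = t + W - j p`. Entries with `s` outside `1, …, N` are not variables, and are kept at
`0`. -/
def rhtmIter (γ : StepSizes) (z0 : ℤ → Fin m → ℝ) : ℕ → TMIterate m
  | 0 => ⟨z0, z0, z0, z0⟩
  | j + 1 =>
    let v := rhtmIter γ z0 j
    let ω : ℤ → Fin m → ℝ := fun s =>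
      if 1 ≤ s ∧ s ≤ T.N then
        (1 + γ.γω) • v.ω s - γ.γω • v.ωprev s - γ.γc • T.partialC s v.y
      else 0
    { ωprev := v.ω
      ω := ω
      y := fun s => (1 + γ.γy) • ω s - γ.γy • v.ω s
      z := fun s => (1 + γ.γz) • ω s - γ.γz • v.ω s }

/-- The sequence `z_s(K)` of RHTM with FOSS initialization. -/
def rhtmZ (γ : StepSizes) (W : ℕ) : ℤ → Fin m → ℝ :=
  (T.rhtmIter γ T.foss (S.iterations W)).z

/-- The states visited by RHTM: `x_0 = 0`, `u_t = z_{t+1}(K) - A(ℐ, :) x_t`,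
`x_{t+1} = A x_t + B u_t`. -/
def rhtmState (γ : StepSizes) (W : ℕ) : ℕ → S.Idx → ℝ
  | 0 => 0
  | t + 1 => S.A.mulVec (rhtmState γ W t) +
      S.B.mulVec (T.rhtmZ γ W ((t : ℤ) + 1) - S.AI (rhtmState γ W t))

/-- The inputs `u_t = z_{t+1}(K) - A(ℐ, :) x_t` of RHTM. -/
def rhtmInput (γ : StepSizes) (W : ℕ) (t : ℕ) : Fin m → ℝ :=
  T.rhtmZ γ W ((t : ℤ) + 1) - S.AI (T.rhtmState γ W t)

/-- The (dynamic) regret of RHTM with FOSS initialization. -/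
def regret (γ : StepSizes) (W : ℕ) : ℝ :=
  T.J (T.rhtmState γ W) (T.rhtmInput γ W) - T.Jstar

end Tracking

end LQT

end

/-!
The regret of RHTM splits into a linear convergence factor and the cost of the initialization.

For a canonical system every input sequence corresponds to a free sequence `z`, whose entries are
the last coordinates of the blocks of the states. In these variables tracking is the unconstrained
minimisation of the quadratic function `C`, so that the regret is at most `C(z(K)) - min C`, and the
partial gradients that RHTM computes from neighbouring stage costs are those of `C`. Hence RHTM
performs `K` iterations of the triple momentum method on `C`, started at the FOSS initialization.
A Lyapunov function for that method (`TripleMomentum.lyapunov_step`) decreases by the factor `φ²` in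
each step, also in the first one (`TripleMomentum.lyapunov_init`), which gives
`C(z(K)) - min C ≤ (3 / 2) ζ² φ^(2K) (C(z(0)) - min C)` in `Tracking.exists_minimizer_regret_le`.

It remains to bound `C(z(0)) - min C` uniformly in the horizon, by comparing both terms with the sum
of the costs `λ_t` of the optimal steady states.

* Upper bound, `Tracking.exists_foss_cost_le`: each coordinate of a state of the initialization is a
  coordinate of a recent optimal steady state, because steady states are constant on blocks. The
  excess over `∑ λ_t` is therefore controlled by the variation of `xᵉ`.
* Lower bound, `Tracking.exists_steadyCost_le`: the functions `h_t(x) = ½ (x - β_t)ᵀ P_t (x - β_t)`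
  with `P_t = Pᵉ(Q_t, R_t)` and `β_t = F(Q_t, R_t) θ_t` solve the Bellman equation of the
  average-cost problem, `λ_t + h_t(x) ≤ f_t(x) + g_t(u) + h_t(A x + B u)`, by completion of
  squares; the fixed point of the minimising feedback is a steady state that attains `λ_t`
  (`LTISystem.exists_bellman`).
  Summing along an optimal trajectory `x*` leaves `∑ (h_t - h_{t-1})(x*_t)`, which is controlled by
  the variation of `P` and `β` as soon as `x*` is bounded.

The optimal trajectory is bounded uniformly in the horizon (`Tracking.exists_optimal_state_bound`):
the stationarity condition is tested with the optimal sequence times a weight that decays slowly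
away from a given time; the weight passes through the banded Hessian of `C` up to a small relative
error. The Riccati solutions exist as limits of value iteration, and all of them are bounded by the
cost of deadbeat control; that they are unique is not needed.
-/

namespace LQT

open scoped Matrix

/-! ### Euclidean norms and quadratic forms -/

section Vectors

variable {ι κ : Type*} [Fintype ι] [Fintype κ]

lemma vnorm_nonneg (v : ι → ℝ) : 0 ≤ vnorm v := norm_nonneg _

lemma vnorm_zero : vnorm (0 : ι → ℝ) = 0 := by simp [vnorm]

lemma vnorm_sq (v : ι → ℝ) : vnorm v ^ 2 = v ⬝ᵥ v := by
  simp only [vnorm, EuclideanSpace.real_norm_sq_eq, dotProduct]; simp only [sq]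

lemma vnorm_sq_eq_sum (v : ι → ℝ) : vnorm v ^ 2 = ∑ i, v i ^ 2 := by
  simp [vnorm, EuclideanSpace.real_norm_sq_eq]

lemma vnorm_add_le (v w : ι → ℝ) : vnorm (v + w) ≤ vnorm v + vnorm w := by
  simpa [vnorm] using norm_add_le (WithLp.toLp 2 v : EuclideanSpace ℝ ι) (WithLp.toLp 2 w)

lemma vnorm_sub_le (v w : ι → ℝ) : vnorm (v - w) ≤ vnorm v + vnorm w := by
  simpa [vnorm] using norm_sub_le (WithLp.toLp 2 v : EuclideanSpace ℝ ι) (WithLp.toLp 2 w)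

lemma vnorm_sub_comm (v w : ι → ℝ) : vnorm (v - w) = vnorm (w - v) := by
  simpa [vnorm] using norm_sub_rev (WithLp.toLp 2 v : EuclideanSpace ℝ ι) (WithLp.toLp 2 w)

lemma vnorm_smul (a : ℝ) (v : ι → ℝ) : vnorm (a • v) = |a| * vnorm v := by
  simp [vnorm, norm_smul]

lemma vnorm_neg (v : ι → ℝ) : vnorm (-v) = vnorm v := by
  simp [vnorm]

lemma vnorm_eq_zero {v : ι → ℝ} : vnorm v = 0 ↔ v = 0 := by
  simp [vnorm]

lemma abs_apply_le_vnorm (v : ι → ℝ) (i : ι) : |v i| ≤ vnorm v := by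
  simpa [vnorm] using PiLp.norm_apply_le (WithLp.toLp 2 v : EuclideanSpace ℝ ι) i

lemma vnorm_le_sum_abs (v : ι → ℝ) : vnorm v ≤ ∑ i, |v i| := by
  refine (abs_le_of_sq_le_sq' ?_ (Finset.sum_nonneg fun i _ => abs_nonneg _)).2
  rw [vnorm_sq_eq_sum]
  calc ∑ i, v i ^ 2 = ∑ i, |v i| ^ 2 := by simp
    _ ≤ _ := Finset.sum_sq_le_sq_sum_of_nonneg fun i _ => abs_nonneg _

lemma vnorm_le_of_abs_le {v w : ι → ℝ} {a : ℝ} (ha : 0 ≤ a) (h : ∀ i, |v i| ≤ a * |w i|) :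
    vnorm v ≤ a * vnorm w := by
  refine (abs_le_of_sq_le_sq' ?_ (mul_nonneg ha (vnorm_nonneg _))).2
  rw [mul_pow, vnorm_sq_eq_sum, vnorm_sq_eq_sum, Finset.mul_sum]
  refine Finset.sum_le_sum fun i _ => ?_
  rw [← sq_abs (v i), ← sq_abs (w i), ← mul_pow]
  exact pow_le_pow_left₀ (abs_nonneg _) (h i) 2

lemma abs_dotProduct_le (v w : ι → ℝ) : |v ⬝ᵥ w| ≤ vnorm v * vnorm w := by
  have := abs_real_inner_le_norm (WithLp.toLp 2 w : EuclideanSpace ℝ ι) (WithLp.toLp 2 v)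
  simpa [vnorm, EuclideanSpace.inner_eq_star_dotProduct, mul_comm] using this

lemma vnorm_mulVec_le [DecidableEq ι] (M : Matrix κ ι ℝ) (v : ι → ℝ) :
    vnorm (M *ᵥ v) ≤ ‖M‖ * vnorm v :=
  Matrix.l2_opNorm_mulVec M (WithLp.toLp 2 v)

lemma abs_dotProduct_mulVec_le [DecidableEq ι] (M : Matrix κ ι ℝ) (w : κ → ℝ) (v : ι → ℝ) :
    |w ⬝ᵥ M *ᵥ v| ≤ ‖M‖ * vnorm w * vnorm v := by
  calc |w ⬝ᵥ M *ᵥ v| ≤ vnorm w * vnorm (M *ᵥ v) := abs_dotProduct_le _ _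
    _ ≤ vnorm w * (‖M‖ * vnorm v) :=
      mul_le_mul_of_nonneg_left (vnorm_mulVec_le _ _) (vnorm_nonneg _)
    _ = _ := by ring

lemma opNorm_le_of_forall_vnorm_le [DecidableEq ι] {M : Matrix κ ι ℝ} {b : ℝ} (hb : 0 ≤ b)
    (h : ∀ v, vnorm (M *ᵥ v) ≤ b * vnorm v) : ‖M‖ ≤ b := by
  rw [Matrix.l2_opNorm_def]
  refine ContinuousLinearMap.opNorm_le_bound _ hb fun v => ?_
  exact h v.ofLp

lemma norm_transpose_eq [DecidableEq ι] [DecidableEq κ] (M : Matrix κ ι ℝ) : ‖Mᵀ‖ = ‖M‖ := by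
  rw [← Matrix.conjTranspose_eq_transpose_of_trivial, Matrix.l2_opNorm_conjTranspose]

/-- Moving a matrix across a dot product. -/
lemma dotProduct_mulVec_comm (M : Matrix κ ι ℝ) (w : κ → ℝ) (v : ι → ℝ) :
    w ⬝ᵥ M *ᵥ v = v ⬝ᵥ Mᵀ *ᵥ w := by
  rw [Matrix.dotProduct_mulVec, ← Matrix.mulVec_transpose, dotProduct_comm]

lemma dotProduct_mulVec_symm {M : Matrix ι ι ℝ} (hM : M.IsSymm) (v w : ι → ℝ) :
    v ⬝ᵥ M *ᵥ w = w ⬝ᵥ M *ᵥ v := by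
  rw [dotProduct_mulVec_comm, hM.eq]

lemma quadForm_zero (M : Matrix ι ι ℝ) : quadForm M 0 = 0 := by simp [quadForm]

lemma quadForm_add {M : Matrix ι ι ℝ} (hM : M.IsSymm) (v w : ι → ℝ) :
    quadForm M (v + w) = quadForm M v + 2 * (v ⬝ᵥ M *ᵥ w) + quadForm M w := by
  simp only [quadForm, Matrix.mulVec_add, add_dotProduct, dotProduct_add]
  rw [dotProduct_mulVec_symm hM w v]; ring

lemma quadForm_sub {M : Matrix ι ι ℝ} (hM : M.IsSymm) (v w : ι → ℝ) :
    quadForm M (v - w) = quadForm M v - 2 * (v ⬝ᵥ M *ᵥ w) + quadForm M w := by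
  simp only [quadForm, Matrix.mulVec_sub, sub_dotProduct, dotProduct_sub]
  rw [dotProduct_mulVec_symm hM w v]; ring

lemma quadForm_smul (M : Matrix ι ι ℝ) (a : ℝ) (v : ι → ℝ) :
    quadForm M (a • v) = a ^ 2 * quadForm M v := by
  simp only [quadForm, Matrix.mulVec_smul, smul_dotProduct, dotProduct_smul, smul_eq_mul]; ring

lemma quadForm_transpose_mul_mul (M : Matrix ι ι ℝ) (G : Matrix ι κ ℝ) (v : κ → ℝ) :
    quadForm (Gᵀ * M * G) v = quadForm M (G *ᵥ v) := by
  simp only [quadForm, ← Matrix.mulVec_mulVec]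
  rw [dotProduct_mulVec_comm, Matrix.transpose_transpose, dotProduct_comm]

lemma abs_quadForm_le [DecidableEq ι] (M : Matrix ι ι ℝ) (v : ι → ℝ) :
    |quadForm M v| ≤ ‖M‖ * vnorm v ^ 2 := by
  rw [sq, ← mul_assoc]; exact abs_dotProduct_mulVec_le M v v

lemma quadForm_smul_one [DecidableEq ι] (a : ℝ) (v : ι → ℝ) :
    quadForm (a • (1 : Matrix ι ι ℝ)) v = a * vnorm v ^ 2 := by
  simp [quadForm, vnorm_sq, Matrix.smul_mulVec]

lemma posSemidef_iff_isSymm {M : Matrix ι ι ℝ} :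
    M.PosSemidef ↔ M.IsSymm ∧ ∀ v, 0 ≤ quadForm M v := by
  constructor
  · intro h
    exact ⟨by simpa [Matrix.IsHermitian, Matrix.IsSymm,
        Matrix.conjTranspose_eq_transpose_of_trivial] using h.1,
      fun v => by simpa [quadForm] using h.dotProduct_mulVec_nonneg v⟩
  · rintro ⟨h1, h2⟩
    refine Matrix.PosSemidef.of_dotProduct_mulVec_nonneg ?_ fun v => ?_
    · rw [Matrix.IsHermitian, Matrix.conjTranspose_eq_transpose_of_trivial]; exact h1
    · simpa [quadForm] using h2 v

lemma quadForm_le_of_le {M M' : Matrix ι ι ℝ} (h : M ≤ M') (v : ι → ℝ) :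
    quadForm M v ≤ quadForm M' v := by
  have := (posSemidef_iff_isSymm.1 (Matrix.le_iff.1 h)).2 v
  simp only [quadForm, Matrix.sub_mulVec, dotProduct_sub] at this ⊢
  linarith

lemma isSymm_of_le {M M' : Matrix ι ι ℝ} (hM : M.IsSymm) (h : M ≤ M') : M'.IsSymm := by
  have := (posSemidef_iff_isSymm.1 (Matrix.le_iff.1 h)).1
  simpa using this.add hM

lemma mul_vnorm_sq_le_quadForm [DecidableEq ι] {M : Matrix ι ι ℝ} {a : ℝ}
    (h : a • (1 : Matrix ι ι ℝ) ≤ M) (v : ι → ℝ) : a * vnorm v ^ 2 ≤ quadForm M v := by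
  rw [← quadForm_smul_one]; exact quadForm_le_of_le h v

lemma quadForm_le_mul_vnorm_sq [DecidableEq ι] {M : Matrix ι ι ℝ} {a : ℝ}
    (h : M ≤ a • (1 : Matrix ι ι ℝ)) (v : ι → ℝ) : quadForm M v ≤ a * vnorm v ^ 2 := by
  rw [← quadForm_smul_one]; exact quadForm_le_of_le h v

lemma isSymm_of_smul_one_le [DecidableEq ι] {M : Matrix ι ι ℝ} {a : ℝ}
    (h : a • (1 : Matrix ι ι ℝ) ≤ M) : M.IsSymm :=
  isSymm_of_le (Matrix.isSymm_one.smul a) h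

/-- Cauchy–Schwarz inequality for the form of a positive semidefinite matrix. -/
lemma sq_dotProduct_mulVec_le {M : Matrix ι ι ℝ} (hM : M.IsSymm) (h0 : ∀ v, 0 ≤ quadForm M v)
    (v w : ι → ℝ) : (v ⬝ᵥ M *ᵥ w) ^ 2 ≤ quadForm M v * quadForm M w := by
  have h : ∀ t : ℝ, 0 ≤ quadForm M w * (t * t) + 2 * (v ⬝ᵥ M *ᵥ w) * t + quadForm M v := by
    intro t
    have := h0 (v + t • w)
    rw [quadForm_add hM, quadForm_smul, Matrix.mulVec_smul, dotProduct_smul, smul_eq_mul] at this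
    linarith
  have := discrim_le_zero h
  rw [discrim] at this
  linarith

lemma opNorm_le_of_quadForm_le [DecidableEq ι] {M : Matrix ι ι ℝ} (hM : M.IsSymm)
    (h0 : ∀ v, 0 ≤ quadForm M v) {b : ℝ} (hb : 0 ≤ b)
    (h1 : ∀ v, quadForm M v ≤ b * vnorm v ^ 2) : ‖M‖ ≤ b := by
  refine opNorm_le_of_forall_vnorm_le hb fun v => ?_
  rcases (vnorm_nonneg (M *ᵥ v)).eq_or_lt with h | h
  · rw [← h]; exact mul_nonneg hb (vnorm_nonneg _)
  have := sq_dotProduct_mulVec_le hM h0 (M *ᵥ v) v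
  rw [← vnorm_sq] at this
  have h2 : (vnorm (M *ᵥ v) ^ 2) ^ 2 ≤ (b * vnorm (M *ᵥ v) ^ 2) * (b * vnorm v ^ 2) :=
    this.trans (mul_le_mul (h1 _) (h1 _) (h0 _) (by positivity))
  have h3 : vnorm (M *ᵥ v) ^ 2 ≤ (b * vnorm v) ^ 2 := by
    have : 0 < vnorm (M *ᵥ v) ^ 2 := by positivity
    nlinarith
  exact (abs_le_of_sq_le_sq' h3 (mul_nonneg hb (vnorm_nonneg _))).2

lemma isUnit_of_quadForm_pos [DecidableEq ι] {M : Matrix ι ι ℝ} {a : ℝ} (ha : 0 < a)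
    (h : ∀ v, a * vnorm v ^ 2 ≤ quadForm M v) : IsUnit M := by
  rw [← Matrix.mulVec_injective_iff_isUnit]
  refine (injective_iff_map_eq_zero (Matrix.mulVecLin M)).2 fun v hv => ?_
  have h1 := h v
  rw [Matrix.mulVecLin_apply] at hv
  rw [quadForm, hv, dotProduct_zero] at h1
  have : vnorm v ^ 2 = 0 := le_antisymm (by nlinarith) (sq_nonneg _)
  exact vnorm_eq_zero.1 (pow_eq_zero_iff two_ne_zero |>.1 this)

end Vectors

/-! ### The Riccati map and completion of squares -/

namespace LTISystem

variable {m : ℕ} (S : LTISystem m)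

/-- The Riccati map `P ↦ Q + Aᵀ (P - P B (Bᵀ P B + R)⁻¹ Bᵀ P) A`, whose positive semidefinite fixed
points are the solutions of the algebraic Riccati equation. -/
noncomputable def ric (Q : Matrix S.Idx S.Idx ℝ) (R : Matrix (Fin m) (Fin m) ℝ)
    (P : Matrix S.Idx S.Idx ℝ) : Matrix S.Idx S.Idx ℝ :=
  Q + S.Aᵀ * (P - P * S.B * (S.Bᵀ * P * S.B + R)⁻¹ * S.Bᵀ * P) * S.A

/-- The feedback gain `(R + Bᵀ P B)⁻¹ Bᵀ P A` that minimises the one-step cost to go. -/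
noncomputable def gain (R : Matrix (Fin m) (Fin m) ℝ) (P : Matrix S.Idx S.Idx ℝ) :
    Matrix (Fin m) S.Idx ℝ :=
  (R + S.Bᵀ * P * S.B)⁻¹ * S.Bᵀ * P * S.A

variable {S} {Q P P' : Matrix S.Idx S.Idx ℝ} {R : Matrix (Fin m) (Fin m) ℝ}

lemma quadForm_inputWeight (u : Fin m → ℝ) :
    quadForm (R + S.Bᵀ * P * S.B) u = quadForm R u + quadForm P (S.B *ᵥ u) := by
  rw [← quadForm_transpose_mul_mul]
  simp [quadForm, Matrix.add_mulVec]

lemma mul_vnorm_sq_le_quadForm_inputWeight {r : ℝ} (hR : ∀ u, r * vnorm u ^ 2 ≤ quadForm R u)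
    (hP : ∀ x, 0 ≤ quadForm P x) (u : Fin m → ℝ) :
    r * vnorm u ^ 2 ≤ quadForm (R + S.Bᵀ * P * S.B) u := by
  rw [quadForm_inputWeight]
  linarith [hR u, hP (S.B *ᵥ u)]

lemma isSymm_inputWeight (hRs : R.IsSymm) (hPs : P.IsSymm) :
    (R + S.Bᵀ * P * S.B).IsSymm := by
  refine hRs.add ?_
  rw [Matrix.IsSymm, Matrix.transpose_mul, Matrix.transpose_mul, Matrix.transpose_transpose,
    hPs.eq, Matrix.mul_assoc]

lemma isUnit_inputWeight {r : ℝ} (hr : 0 < r) (hR : ∀ u, r * vnorm u ^ 2 ≤ quadForm R u)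
    (hP : ∀ x, 0 ≤ quadForm P x) : IsUnit (R + S.Bᵀ * P * S.B) :=
  isUnit_of_quadForm_pos hr (mul_vnorm_sq_le_quadForm_inputWeight hR hP)

lemma inputWeight_mul_gain (hM : IsUnit (R + S.Bᵀ * P * S.B)) :
    (R + S.Bᵀ * P * S.B) * S.gain R P = S.Bᵀ * P * S.A := by
  have := Matrix.mul_nonsing_inv_cancel_left _ (S.Bᵀ * P * S.A)
    ((Matrix.isUnit_iff_isUnit_det _).1 hM)
  rw [gain]
  simpa only [Matrix.mul_assoc] using this

lemma ric_eq : S.ric Q R P = Q + S.Aᵀ * P * S.A - S.Aᵀ * P * S.B * S.gain R P := by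
  rw [ric, gain, add_comm (S.Bᵀ * P * S.B) R]
  simp only [Matrix.mul_sub, Matrix.sub_mul, Matrix.mul_assoc, add_sub_assoc]

/-- Completion of squares in the one-step cost to go. -/
lemma stage_add_quadForm_eq (hRs : R.IsSymm) (hPs : P.IsSymm)
    (hM : IsUnit (R + S.Bᵀ * P * S.B)) (x : S.Idx → ℝ) (u : Fin m → ℝ) :
    quadForm Q x + quadForm R u + quadForm P (S.A *ᵥ x + S.B *ᵥ u) =
      quadForm (S.ric Q R P) x +
        quadForm (R + S.Bᵀ * P * S.B) (u + S.gain R P *ᵥ x) := by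
  have hMs := isSymm_inputWeight (S := S) hRs hPs
  have hMK : (R + S.Bᵀ * P * S.B) *ᵥ (S.gain R P *ᵥ x) = S.Bᵀ *ᵥ (P *ᵥ (S.A *ᵥ x)) := by
    rw [Matrix.mulVec_mulVec, inputWeight_mul_gain hM]
    simp only [Matrix.mulVec_mulVec, Matrix.mul_assoc]
  have hmove : ∀ v : Fin m → ℝ, v ⬝ᵥ S.Bᵀ *ᵥ (P *ᵥ (S.A *ᵥ x)) =
      (S.A *ᵥ x) ⬝ᵥ P *ᵥ (S.B *ᵥ v) := by
    intro v
    rw [dotProduct_mulVec_comm, Matrix.transpose_transpose, dotProduct_comm,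
      dotProduct_mulVec_symm hPs]
  have hric : quadForm (S.ric Q R P) x = quadForm Q x + quadForm P (S.A *ᵥ x) -
      (S.A *ᵥ x) ⬝ᵥ P *ᵥ (S.B *ᵥ (S.gain R P *ᵥ x)) := by
    rw [ric_eq, ← quadForm_transpose_mul_mul]
    simp only [quadForm, Matrix.add_mulVec, Matrix.sub_mulVec, dotProduct_add, dotProduct_sub]
    congr 1
    simp only [← Matrix.mulVec_mulVec]
    rw [dotProduct_mulVec_comm, Matrix.transpose_transpose, dotProduct_comm]
  rw [hric, quadForm_add hPs, quadForm_add hMs, hMK, hmove, quadForm_inputWeight u]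
  have : quadForm (R + S.Bᵀ * P * S.B) (S.gain R P *ᵥ x) =
      (S.A *ᵥ x) ⬝ᵥ P *ᵥ (S.B *ᵥ (S.gain R P *ᵥ x)) := by
    rw [quadForm, hMK, hmove]
  rw [this]; ring

lemma isSymm_ric (hQs : Q.IsSymm) (hRs : R.IsSymm) (hPs : P.IsSymm) : (S.ric Q R P).IsSymm := by
  refine hQs.add ?_
  have h1 : ((S.Bᵀ * P * S.B + R)⁻¹)ᵀ = (S.Bᵀ * P * S.B + R)⁻¹ := by
    rw [Matrix.transpose_nonsing_inv, add_comm, (isSymm_inputWeight hRs hPs).eq]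
  rw [Matrix.IsSymm]
  generalize (S.Bᵀ * P * S.B + R)⁻¹ = M at h1 ⊢
  simp only [Matrix.transpose_mul, Matrix.transpose_sub, Matrix.transpose_transpose, h1, hPs.eq,
    Matrix.mul_assoc]

lemma quadForm_ric_le {r : ℝ} (hr : 0 < r) (hRs : R.IsSymm)
    (hR : ∀ u, r * vnorm u ^ 2 ≤ quadForm R u) (hPs : P.IsSymm) (hP : ∀ x, 0 ≤ quadForm P x)
    (x : S.Idx → ℝ) (u : Fin m → ℝ) :
    quadForm (S.ric Q R P) x ≤
      quadForm Q x + quadForm R u + quadForm P (S.A *ᵥ x + S.B *ᵥ u) := by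
  rw [stage_add_quadForm_eq hRs hPs (isUnit_inputWeight hr hR hP)]
  have := mul_vnorm_sq_le_quadForm_inputWeight hR hP (u + S.gain R P *ᵥ x)
  have : 0 ≤ r * vnorm (u + S.gain R P *ᵥ x) ^ 2 := by positivity
  linarith

/-- The Riccati map attains the minimal one-step cost to go with the gain feedback. -/
lemma quadForm_ric_eq {r : ℝ} (hr : 0 < r) (hRs : R.IsSymm)
    (hR : ∀ u, r * vnorm u ^ 2 ≤ quadForm R u) (hPs : P.IsSymm) (hP : ∀ x, 0 ≤ quadForm P x)
    (x : S.Idx → ℝ) :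
    quadForm (S.ric Q R P) x = quadForm Q x + quadForm R (-(S.gain R P *ᵥ x)) +
      quadForm P (S.A *ᵥ x + S.B *ᵥ (-(S.gain R P *ᵥ x))) := by
  rw [stage_add_quadForm_eq hRs hPs (isUnit_inputWeight hr hR hP)]
  simp [quadForm_zero]

lemma quadForm_ric_mono {r : ℝ} (hr : 0 < r) (hRs : R.IsSymm)
    (hR : ∀ u, r * vnorm u ^ 2 ≤ quadForm R u) (hPs : P.IsSymm) (hP : ∀ x, 0 ≤ quadForm P x)
    (hPs' : P'.IsSymm) (hPP' : ∀ x, quadForm P x ≤ quadForm P' x) (x : S.Idx → ℝ) :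
    quadForm (S.ric Q R P) x ≤ quadForm (S.ric Q R P') x := by
  rw [quadForm_ric_eq hr hRs hR hPs' (fun x => (hP x).trans (hPP' x))]
  refine (quadForm_ric_le hr hRs hR hPs hP x (-(S.gain R P' *ᵥ x))).trans ?_
  linarith [hPP' (S.A *ᵥ x + S.B *ᵥ (-(S.gain R P' *ᵥ x)))]

lemma quadForm_le_quadForm_ric {r : ℝ} (hr : 0 < r) (hRs : R.IsSymm)
    (hR : ∀ u, r * vnorm u ^ 2 ≤ quadForm R u) (hPs : P.IsSymm) (hP : ∀ x, 0 ≤ quadForm P x)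
    (x : S.Idx → ℝ) : quadForm Q x ≤ quadForm (S.ric Q R P) x := by
  rw [quadForm_ric_eq hr hRs hR hPs hP]
  have h1 := hR (-(S.gain R P *ᵥ x))
  have h2 : 0 ≤ r * vnorm (-(S.gain R P *ᵥ x)) ^ 2 := by positivity
  linarith [hP (S.A *ᵥ x + S.B *ᵥ (-(S.gain R P *ᵥ x)))]

/-! ### Canonical form and deadbeat control -/

variable (S) in
/-- The submatrix `A(ℐ, :)` of the last rows of the blocks. -/
def AImat : Matrix (Fin m) S.Idx ℝ := fun i k => S.A (S.last i) k

lemma AI_eq_mulVec (x : S.Idx → ℝ) : S.AI x = S.AImat *ᵥ x := rfl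

variable (S) in
/-- The closed loop of the deadbeat feedback `u = -A(ℐ, :) x`. -/
def deadbeat : Matrix S.Idx S.Idx ℝ := S.A - S.B * S.AImat

/-- One step of a canonical system shifts every block and feeds `A(ℐ, :) x + u` into its last
coordinate. -/
lemma step_apply (hS : S.IsCanonical) (x : S.Idx → ℝ) (u : Fin m → ℝ) (i : Fin m)
    (l : Fin (S.p i : ℕ)) :
    (S.A *ᵥ x + S.B *ᵥ u) ⟨i, l⟩ =
      if h : (l : ℕ) + 1 < (S.p i : ℕ) then x ⟨i, ⟨l + 1, h⟩⟩ else S.AI x i + u i := by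
  have hB : (S.B *ᵥ u) ⟨i, l⟩ = if (l : ℕ) + 1 < (S.p i : ℕ) then 0 else u i := by
    simp only [Matrix.mulVec, dotProduct, hS.2]
    split_ifs with h
    · refine Finset.sum_eq_zero fun j _ => ?_
      rw [if_neg, zero_mul]
      intro hj
      obtain rfl : i = j := congrArg Sigma.fst hj
      have : l = _ := eq_of_heq (Sigma.mk.inj hj).2
      rw [this] at h
      simp at h
      have := (S.p i).pos
      omega
    · rw [Finset.sum_eq_single i]
      · rw [if_pos, one_mul]
        simp only [last]
        congr 1
        ext
        simp only
        omega
      · intro j _ hj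
        rw [if_neg, zero_mul]
        intro h'
        exact hj (congrArg Sigma.fst h').symm
      · simp
  rw [Pi.add_apply, hB]
  split_ifs with h
  · rw [add_zero]
    simp only [Matrix.mulVec, dotProduct, hS.1 i l h]
    rw [Finset.sum_eq_single (⟨i, ⟨l + 1, h⟩⟩ : S.Idx)]
    · simp
    · rintro ⟨j, l'⟩ _ hne
      rw [if_neg, zero_mul]
      rintro ⟨h1, h2⟩
      simp only at h1 h2
      subst h1
      apply hne
      congr 1
      ext
      exact h2
    · simp
  · congr 1
    have hl : (⟨i, l⟩ : S.Idx) = S.last i := by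
      simp only [last]
      congr 1
      ext
      simp only
      omega
    rw [hl]
    rfl

lemma deadbeat_mulVec (x : S.Idx → ℝ) :
    S.deadbeat *ᵥ x = S.A *ᵥ x + S.B *ᵥ (-(S.AImat *ᵥ x)) := by
  rw [deadbeat, Matrix.sub_mulVec, Matrix.mulVec_neg, ← Matrix.mulVec_mulVec, sub_eq_add_neg]

lemma p_le_ctrlIndex (i : Fin m) : (S.p i : ℕ) ≤ S.ctrlIndex :=
  Finset.le_sup (f := fun i => (S.p i : ℕ)) (Finset.mem_univ i)

lemma deadbeat_pow_mulVec_apply (hS : S.IsCanonical) (x : S.Idx → ℝ) (t : ℕ) (i : Fin m)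
    (l : Fin (S.p i : ℕ)) :
    (S.deadbeat ^ t *ᵥ x) ⟨i, l⟩ =
      if h : (l : ℕ) + t < (S.p i : ℕ) then x ⟨i, ⟨l + t, h⟩⟩ else 0 := by
  induction t generalizing l with
  | zero => simp [l.2]
  | succ t ih =>
    rw [pow_succ', ← Matrix.mulVec_mulVec, deadbeat_mulVec, step_apply hS]
    split_ifs with h1 h2 h2
    · rw [ih, dif_pos (by simp only; omega)]
      congr 3
      simp only
      omega
    · rw [ih, dif_neg (by simp only; omega)]
    · omega
    · simp [AI_eq_mulVec]

lemma deadbeat_pow_eq_zero (hS : S.IsCanonical) {t : ℕ} (ht : S.ctrlIndex ≤ t) :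
    S.deadbeat ^ t = 0 := by
  refine Matrix.ext_of_mulVec_single fun k => ?_
  ext ⟨i, l⟩
  rw [deadbeat_pow_mulVec_apply hS, dif_neg]
  · simp
  · have := p_le_ctrlIndex (S := S) i
    omega

variable (S) in
/-- A bound for the cost of steering a state of norm one to the origin by the deadbeat feedback, for
state and input weights of norm at most `q` and `r`. It bounds all solutions of the Riccati
equation. -/
noncomputable def riccatiBound (q r : ℝ) : ℝ :=
  (q + r * ‖S.AImat‖ ^ 2) * ∑ t ∈ Finset.range S.ctrlIndex, ‖S.deadbeat ^ t‖ ^ 2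

lemma riccatiBound_nonneg {q r : ℝ} (hq : 0 ≤ q) (hr : 0 ≤ r) : 0 ≤ S.riccatiBound q r :=
  mul_nonneg (by positivity) (Finset.sum_nonneg fun _ _ => sq_nonneg _)

/-- Along value iteration the deadbeat feedback is a suboptimal policy. A constant sequence `V`
makes this a bound for the solutions of the Riccati equation. -/
lemma quadForm_iterate_ric_le {r : ℝ} (hr : 0 < r) (hRs : R.IsSymm)
    (hR : ∀ u, r * vnorm u ^ 2 ≤ quadForm R u) {q' r' : ℝ} (hr' : 0 ≤ r')
    (hQ' : ∀ x, quadForm Q x ≤ q' * vnorm x ^ 2) (hR' : ∀ u, quadForm R u ≤ r' * vnorm u ^ 2)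
    (V : ℕ → Matrix S.Idx S.Idx ℝ) (hVs : ∀ k, (V k).IsSymm) (hV : ∀ k x, 0 ≤ quadForm (V k) x)
    (hstep : ∀ k, V (k + 1) = S.ric Q R (V k)) (k : ℕ) (x : S.Idx → ℝ) :
    quadForm (V k) x ≤
      ∑ t ∈ Finset.range k, (q' + r' * ‖S.AImat‖ ^ 2) * vnorm (S.deadbeat ^ t *ᵥ x) ^ 2 +
        quadForm (V 0) (S.deadbeat ^ k *ᵥ x) := by
  induction k generalizing x with
  | zero => simp
  | succ k ih =>
    rw [hstep]
    refine (quadForm_ric_le hr hRs hR (hVs k) (hV k) x (-(S.AImat *ᵥ x))).trans ?_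
    rw [← deadbeat_mulVec, Finset.sum_range_succ']
    have h1 := ih (S.deadbeat *ᵥ x)
    simp only [Matrix.mulVec_mulVec, ← pow_succ] at h1
    have h2 : quadForm R (-(S.AImat *ᵥ x)) ≤ r' * (‖S.AImat‖ ^ 2 * vnorm x ^ 2) := by
      refine (hR' _).trans (mul_le_mul_of_nonneg_left ?_ hr')
      rw [vnorm_neg, ← mul_pow]
      exact pow_le_pow_left₀ (vnorm_nonneg _) (vnorm_mulVec_le _ _) 2
    have h3 := hQ' x
    simp only [pow_zero, Matrix.one_mulVec]
    linarith

/-- The deadbeat feedback reaches the origin after `p` steps, so that its cost is bounded uniformly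
in the number of steps. -/
lemma sum_vnorm_deadbeat_le (hS : S.IsCanonical) {c : ℝ} (hc : 0 ≤ c) (k : ℕ) (x : S.Idx → ℝ) :
    ∑ t ∈ Finset.range k, c * vnorm (S.deadbeat ^ t *ᵥ x) ^ 2 ≤
      (c * ∑ t ∈ Finset.range S.ctrlIndex, ‖S.deadbeat ^ t‖ ^ 2) * vnorm x ^ 2 := by
  have h1 : ∑ t ∈ Finset.range k, c * vnorm (S.deadbeat ^ t *ᵥ x) ^ 2 ≤
      ∑ t ∈ Finset.range S.ctrlIndex, c * vnorm (S.deadbeat ^ t *ᵥ x) ^ 2 := by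
    calc _ ≤ ∑ t ∈ Finset.range (max k S.ctrlIndex), c * vnorm (S.deadbeat ^ t *ᵥ x) ^ 2 :=
          Finset.sum_le_sum_of_subset_of_nonneg
            (Finset.range_subset_range.2 (le_max_left _ _)) fun _ _ _ => by positivity
      _ = _ := by
          refine (Finset.sum_subset (Finset.range_subset_range.2 (le_max_right _ _))
            fun t _ ht => ?_).symm
          rw [deadbeat_pow_eq_zero hS (by simpa using ht), Matrix.zero_mulVec, vnorm_zero]
          simp
  refine h1.trans ?_
  rw [Finset.mul_sum, Finset.sum_mul]
  refine Finset.sum_le_sum fun t _ => ?_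
  rw [mul_assoc, ← mul_pow]
  exact mul_le_mul_of_nonneg_left (pow_le_pow_left₀ (vnorm_nonneg _) (vnorm_mulVec_le _ _) 2) hc

end LTISystem

/-! ### Existence of Riccati solutions -/

/-- Monotone convergence for symmetric matrices, by polarisation. -/
lemma exists_tendsto_of_monotone_quadForm {ι : Type*} [Fintype ι] [DecidableEq ι]
    {V : ℕ → Matrix ι ι ℝ} (hVs : ∀ k, (V k).IsSymm)
    (hmono : ∀ k x, quadForm (V k) x ≤ quadForm (V (k + 1)) x) {b : ℝ}
    (hb : ∀ k x, quadForm (V k) x ≤ b * vnorm x ^ 2) :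
    ∃ P, Filter.Tendsto V Filter.atTop (nhds P) := by
  have hconv : ∀ x, ∃ a, Filter.Tendsto (fun k => quadForm (V k) x) Filter.atTop (nhds a) :=
    fun x => ⟨_, tendsto_atTop_ciSup (monotone_nat_of_le_succ fun k => hmono k x)
      ⟨b * vnorm x ^ 2, by rintro _ ⟨k, rfl⟩; exact hb k x⟩⟩
  choose a ha using hconv
  have hentry : ∀ k i j, V k i j = (1 / 4) * (quadForm (V k) (Pi.single i 1 + Pi.single j 1) -
      quadForm (V k) (Pi.single i 1 - Pi.single j 1)) := by
    intro k i j
    rw [quadForm_add (hVs k), quadForm_sub (hVs k)]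
    have : (Pi.single i 1 : ι → ℝ) ⬝ᵥ V k *ᵥ Pi.single j 1 = V k i j := by simp
    rw [this]; ring
  refine ⟨fun i j => (1 / 4) * (a (Pi.single i 1 + Pi.single j 1) -
    a (Pi.single i 1 - Pi.single j 1)), ?_⟩
  refine tendsto_pi_nhds.2 fun i => tendsto_pi_nhds.2 fun j => ?_
  simp only [hentry]
  exact ((ha _).sub (ha _)).const_mul _

namespace LTISystem

variable {m : ℕ} {S : LTISystem m} {Q P : Matrix S.Idx S.Idx ℝ} {R : Matrix (Fin m) (Fin m) ℝ}

/-- Value iteration from `0` is monotone and, by deadbeat control, bounded; its limit solves the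
Riccati equation. -/
lemma exists_isDARESolution (hS : S.IsCanonical) {r : ℝ} (hr : 0 < r) (hRs : R.IsSymm)
    (hR : ∀ u, r * vnorm u ^ 2 ≤ quadForm R u) (hQs : Q.IsSymm) (hQ : ∀ x, 0 ≤ quadForm Q x) :
    ∃ P, S.IsDARESolution Q R P := by
  let V : ℕ → Matrix S.Idx S.Idx ℝ := fun k => (S.ric Q R)^[k] 0
  have hV0 : V 0 = 0 := rfl
  have hstep : ∀ k, V (k + 1) = S.ric Q R (V k) := fun k => Function.iterate_succ_apply' _ _ _
  have hV : ∀ k, (V k).IsSymm ∧ ∀ x, 0 ≤ quadForm (V k) x := by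
    intro k
    induction k with
    | zero => exact ⟨by simp [hV0], by simp [hV0, quadForm]⟩
    | succ k ih =>
      rw [hstep]
      exact ⟨isSymm_ric hQs hRs ih.1,
        fun x => (hQ x).trans (quadForm_le_quadForm_ric hr hRs hR ih.1 ih.2 x)⟩
  have hmono : ∀ k x, quadForm (V k) x ≤ quadForm (V (k + 1)) x := by
    intro k
    induction k with
    | zero => intro x; simpa [hV0, quadForm] using (hV 1).2 x
    | succ k ih =>
      intro x
      rw [hstep k, hstep (k + 1)]
      exact quadForm_ric_mono hr hRs hR (hV k).1 (hV k).2 (hV (k + 1)).1 ih x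
  have hbound : ∀ k x, quadForm (V k) x ≤ S.riccatiBound ‖Q‖ ‖R‖ * vnorm x ^ 2 := by
    intro k x
    have h1 := quadForm_iterate_ric_le hr hRs hR (norm_nonneg R)
      (fun x => (le_abs_self _).trans (abs_quadForm_le Q x))
      (fun u => (le_abs_self _).trans (abs_quadForm_le R u)) V (fun k => (hV k).1)
      (fun k => (hV k).2) hstep k x
    have h2 := sum_vnorm_deadbeat_le hS
      (show 0 ≤ ‖Q‖ + ‖R‖ * ‖S.AImat‖ ^ 2 by positivity) k x
    have h3 : quadForm (V 0) (S.deadbeat ^ k *ᵥ x) = 0 := by simp [hV0, quadForm]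
    rw [h3, add_zero] at h1
    exact h1.trans h2
  obtain ⟨P, hP⟩ := exists_tendsto_of_monotone_quadForm (fun k => (hV k).1) hmono hbound
  have hquad : ∀ x, Filter.Tendsto (fun k => quadForm (V k) x) Filter.atTop
      (nhds (quadForm P x)) := by
    intro x
    have hc : Continuous fun M : Matrix S.Idx S.Idx ℝ => quadForm M x := by
      unfold quadForm; fun_prop
    exact (hc.tendsto P).comp hP
  have hPs : P.IsSymm := by
    have hc : Continuous fun M : Matrix S.Idx S.Idx ℝ => Mᵀ := by fun_prop
    refine tendsto_nhds_unique ((hc.tendsto P).comp hP) ?_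
    refine hP.congr fun k => ((hV k).1.eq).symm
  have hPn : ∀ x, 0 ≤ quadForm P x := fun x => ge_of_tendsto' (hquad x) fun k => (hV k).2 x
  refine ⟨P, posSemidef_iff_isSymm.2 ⟨hPs, hPn⟩, ?_⟩
  have hcont : ContinuousAt (S.ric Q R) P := by
    have hu : IsUnit (S.Bᵀ * P * S.B + R) := by
      rw [add_comm]; exact isUnit_inputWeight hr hR hPn
    have hinv : ContinuousAt (fun M => (S.Bᵀ * M * S.B + R)⁻¹) P := by
      obtain ⟨U, hU⟩ := hu
      have h1 := NormedRing.inverse_continuousAt U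
      rw [hU] at h1
      simp only [Matrix.nonsing_inv_eq_ringInverse]
      exact ContinuousAt.comp (f := fun M => S.Bᵀ * M * S.B + R) h1
        (by fun_prop)
    unfold ric
    have hid : ContinuousAt (fun M : Matrix S.Idx S.Idx ℝ => M) P := continuousAt_id
    have hc : ∀ {a b : Type} [Fintype a] [Fintype b] (M : Matrix a b ℝ),
      ContinuousAt (fun _ : Matrix S.Idx S.Idx ℝ => M) P := fun M => continuousAt_const
    have hmul : ∀ {a b c : Type} [Fintype a] [Fintype b] [Fintype c]
        {f : Matrix S.Idx S.Idx ℝ → Matrix a b ℝ} {g : Matrix S.Idx S.Idx ℝ → Matrix b c ℝ},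
        ContinuousAt f P → ContinuousAt g P → ContinuousAt (fun M => f M * g M) P := by
      intro a b c _ _ _ f g hf hg
      exact (Continuous.matrix_mul continuous_fst continuous_snd).continuousAt.comp
        (hf.prodMk hg)
    exact continuousAt_const.add (hmul (hmul (hc _) (hid.sub
      (hmul (hmul (hmul (hmul hid (hc _)) hinv) (hc _)) hid))) (hc _))
  refine tendsto_nhds_unique (hP.comp (Filter.tendsto_add_atTop_nat 1)) ?_
  refine (Filter.Tendsto.comp hcont hP).congr fun k => ?_
  exact (hstep k).symm

variable {μf lf μg lg : ℝ}

lemma isDARESolution_Pe (hS : S.IsCanonical) (hμf : 0 < μf) (hμg : 0 < μg)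
    (hQ : Q ∈ S.Qset μf lf) (hR : R ∈ S.Rset μg lg) : S.IsDARESolution Q R (S.Pe Q R) :=
  Classical.epsilon_spec (exists_isDARESolution hS hμg (isSymm_of_smul_one_le hR.1)
    (mul_vnorm_sq_le_quadForm hR.1) (isSymm_of_smul_one_le hQ.1) fun x =>
      le_trans (by positivity) (mul_vnorm_sq_le_quadForm hQ.1 x))

lemma isSymm_Pe (hS : S.IsCanonical) (hμf : 0 < μf) (hμg : 0 < μg)
    (hQ : Q ∈ S.Qset μf lf) (hR : R ∈ S.Rset μg lg) : (S.Pe Q R).IsSymm :=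
  (posSemidef_iff_isSymm.1 (isDARESolution_Pe hS hμf hμg hQ hR).1).1

lemma quadForm_Pe_nonneg (hS : S.IsCanonical) (hμf : 0 < μf) (hμg : 0 < μg)
    (hQ : Q ∈ S.Qset μf lf) (hR : R ∈ S.Rset μg lg) (x : S.Idx → ℝ) :
    0 ≤ quadForm (S.Pe Q R) x :=
  (posSemidef_iff_isSymm.1 (isDARESolution_Pe hS hμf hμg hQ hR).1).2 x

lemma ric_Pe (hS : S.IsCanonical) (hμf : 0 < μf) (hμg : 0 < μg)
    (hQ : Q ∈ S.Qset μf lf) (hR : R ∈ S.Rset μg lg) : S.ric Q R (S.Pe Q R) = S.Pe Q R :=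
  (isDARESolution_Pe hS hμf hμg hQ hR).2.symm

lemma mul_vnorm_sq_le_quadForm_Pe (hS : S.IsCanonical) (hμf : 0 < μf) (hμg : 0 < μg)
    (hQ : Q ∈ S.Qset μf lf) (hR : R ∈ S.Rset μg lg) (x : S.Idx → ℝ) :
    μf * vnorm x ^ 2 ≤ quadForm (S.Pe Q R) x := by
  refine (mul_vnorm_sq_le_quadForm hQ.1 x).trans ?_
  have := quadForm_le_quadForm_ric (Q := Q) hμg (isSymm_of_smul_one_le hR.1)
    (mul_vnorm_sq_le_quadForm hR.1) (isSymm_Pe hS hμf hμg hQ hR)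
    (quadForm_Pe_nonneg hS hμf hμg hQ hR) x
  rwa [ric_Pe hS hμf hμg hQ hR] at this

lemma quadForm_Pe_le (hS : S.IsCanonical) (hμf : 0 < μf) (hμg : 0 < μg) (hlf : 0 < lf)
    (hlg : 0 < lg) (hQ : Q ∈ S.Qset μf lf) (hR : R ∈ S.Rset μg lg) (x : S.Idx → ℝ) :
    quadForm (S.Pe Q R) x ≤ S.riccatiBound lf lg * vnorm x ^ 2 := by
  have h1 := quadForm_iterate_ric_le (Q := Q) hμg (isSymm_of_smul_one_le hR.1)
    (mul_vnorm_sq_le_quadForm hR.1) hlg.le (quadForm_le_mul_vnorm_sq hQ.2)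
    (quadForm_le_mul_vnorm_sq hR.2) (fun _ => S.Pe Q R) (fun _ => isSymm_Pe hS hμf hμg hQ hR)
    (fun _ => quadForm_Pe_nonneg hS hμf hμg hQ hR)
    (fun _ => (ric_Pe hS hμf hμg hQ hR).symm) S.ctrlIndex x
  rw [deadbeat_pow_eq_zero hS le_rfl, Matrix.zero_mulVec, quadForm_zero, add_zero] at h1
  exact h1.trans (sum_vnorm_deadbeat_le hS (by positivity) _ _)

lemma norm_Pe_le (hS : S.IsCanonical) (hμf : 0 < μf) (hμg : 0 < μg) (hlf : 0 < lf)
    (hlg : 0 < lg) (hQ : Q ∈ S.Qset μf lf) (hR : R ∈ S.Rset μg lg) :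
    ‖S.Pe Q R‖ ≤ S.riccatiBound lf lg :=
  opNorm_le_of_quadForm_le (isSymm_Pe hS hμf hμg hQ hR) (quadForm_Pe_nonneg hS hμf hμg hQ hR)
    (riccatiBound_nonneg hlf.le hlg.le) (quadForm_Pe_le hS hμf hμg hlf hlg hQ hR)

/-! ### The closed loop and the Bellman equation of the average-cost problem -/

/-- The closed loop `A - B Kᵉ` has no eigenvalue near `1`, by the Lyapunov function `Pᵉ`. -/
lemma vnorm_le_closedLoop (hS : S.IsCanonical) (hμf : 0 < μf) (hμg : 0 < μg)
    (hQ : Q ∈ S.Qset μf lf) (hR : R ∈ S.Rset μg lg) (x : S.Idx → ℝ) :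
    vnorm x ≤ 2 * ‖S.Pe Q R‖ / μf * vnorm ((1 - (S.A - S.B * S.Ke Q R)) *ᵥ x) := by
  have hPs := isSymm_Pe hS hμf hμg hQ hR
  have hPn := quadForm_Pe_nonneg hS hμf hμg hQ hR
  have hL := quadForm_ric_eq (Q := Q) hμg (isSymm_of_smul_one_le hR.1)
    (mul_vnorm_sq_le_quadForm hR.1) hPs hPn x
  rw [ric_Pe hS hμf hμg hQ hR] at hL
  set y := (1 - (S.A - S.B * S.Ke Q R)) *ᵥ x with hy
  have hcl : S.A *ᵥ x + S.B *ᵥ (-(S.gain R (S.Pe Q R) *ᵥ x)) = x - y := by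
    rw [hy, Matrix.sub_mulVec, Matrix.sub_mulVec, Matrix.one_mulVec, Matrix.mulVec_neg,
      Matrix.mulVec_mulVec]
    simp only [Ke, gain]
    abel
  rw [hcl, quadForm_sub hPs] at hL
  have hR0 : 0 ≤ quadForm R (-(S.gain R (S.Pe Q R) *ᵥ x)) :=
    le_trans (by positivity) (mul_vnorm_sq_le_quadForm hR.1 _)
  have hQ0 := mul_vnorm_sq_le_quadForm hQ.1 x
  have hxy := (le_abs_self _).trans (abs_dotProduct_mulVec_le (S.Pe Q R) x y)
  have hkey : μf * vnorm x ^ 2 ≤ 2 * (‖S.Pe Q R‖ * vnorm x * vnorm y) := by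
    linarith [hPn y]
  rcases (vnorm_nonneg x).eq_or_lt with h | h
  · rw [← h]
    have := vnorm_nonneg y
    positivity
  · rw [div_mul_eq_mul_div, le_div_iff₀ hμf]
    nlinarith

lemma isUnit_one_sub_closedLoop (hS : S.IsCanonical) (hμf : 0 < μf) (hμg : 0 < μg)
    (hQ : Q ∈ S.Qset μf lf) (hR : R ∈ S.Rset μg lg) :
    IsUnit (1 - (S.A - S.B * S.Ke Q R)) := by
  rw [← Matrix.mulVec_injective_iff_isUnit]
  refine (injective_iff_map_eq_zero (Matrix.mulVecLin _)).2 fun v hv => ?_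
  have h := vnorm_le_closedLoop hS hμf hμg hQ hR v
  rw [Matrix.mulVecLin_apply] at hv
  rw [hv, vnorm_zero, mul_zero] at h
  exact vnorm_eq_zero.1 (le_antisymm h (vnorm_nonneg _))

lemma norm_inv_one_sub_closedLoop_le (hS : S.IsCanonical) (hμf : 0 < μf) (hμg : 0 < μg)
    (hQ : Q ∈ S.Qset μf lf) (hR : R ∈ S.Rset μg lg) :
    ‖(1 - (S.A - S.B * S.Ke Q R))⁻¹‖ ≤ 2 * ‖S.Pe Q R‖ / μf := by
  refine opNorm_le_of_forall_vnorm_le (by positivity) fun v => ?_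
  have h := vnorm_le_closedLoop hS hμf hμg hQ hR ((1 - (S.A - S.B * S.Ke Q R))⁻¹ *ᵥ v)
  rwa [Matrix.mulVec_mulVec, Matrix.mul_nonsing_inv _ ((Matrix.isUnit_iff_isUnit_det _).1
    (isUnit_one_sub_closedLoop hS hμf hμg hQ hR)), Matrix.one_mulVec] at h

lemma isUnit_Pe (hS : S.IsCanonical) (hμf : 0 < μf) (hμg : 0 < μg)
    (hQ : Q ∈ S.Qset μf lf) (hR : R ∈ S.Rset μg lg) : IsUnit (S.Pe Q R) :=
  isUnit_of_quadForm_pos hμf (mul_vnorm_sq_le_quadForm_Pe hS hμf hμg hQ hR)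

lemma norm_inv_Pe_le (hS : S.IsCanonical) (hμf : 0 < μf) (hμg : 0 < μg)
    (hQ : Q ∈ S.Qset μf lf) (hR : R ∈ S.Rset μg lg) : ‖(S.Pe Q R)⁻¹‖ ≤ 1 / μf := by
  refine opNorm_le_of_forall_vnorm_le (by positivity) fun v => ?_
  have h := mul_vnorm_sq_le_quadForm_Pe hS hμf hμg hQ hR ((S.Pe Q R)⁻¹ *ᵥ v)
  rw [quadForm, Matrix.mulVec_mulVec, Matrix.mul_nonsing_inv _ ((Matrix.isUnit_iff_isUnit_det _).1
    (isUnit_Pe hS hμf hμg hQ hR)), Matrix.one_mulVec] at h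
  have h2 := h.trans ((le_abs_self _).trans (abs_dotProduct_le _ _))
  rcases (vnorm_nonneg ((S.Pe Q R)⁻¹ *ᵥ v)).eq_or_lt with h0 | h0
  · rw [← h0]
    have := vnorm_nonneg v
    positivity
  · rw [div_mul_eq_mul_div, one_mul, le_div_iff₀ hμf]
    nlinarith

/-- With `Pᵉ` and `βᵉ = F θ`, the function `h(x) = ½ (x - βᵉ)ᵀ Pᵉ (x - βᵉ)` solves the Bellman
equation of the average-cost problem, whose optimal average cost is the cost of the optimal steady
state. -/
lemma exists_bellman (hS : S.IsCanonical) (hμf : 0 < μf) (hμg : 0 < μg)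
    (hQ : Q ∈ S.Qset μf lf) (hR : R ∈ S.Rset μg lg) (θ : S.Idx → ℝ) :
    ∃ c : ℝ, (∀ x u, c + 1 / 2 * quadForm (S.Pe Q R) (x - S.F Q R *ᵥ θ) ≤
        S.stageCost Q R θ x u +
          1 / 2 * quadForm (S.Pe Q R) (S.A *ᵥ x + S.B *ᵥ u - S.F Q R *ᵥ θ)) ∧
      ∃ x u, x = S.A *ᵥ x + S.B *ᵥ u ∧ S.stageCost Q R θ x u = c := by
  have hPs := isSymm_Pe hS hμf hμg hQ hR
  have hPn := quadForm_Pe_nonneg hS hμf hμg hQ hR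
  have hRs := isSymm_of_smul_one_le hR.1
  have hQs := isSymm_of_smul_one_le hQ.1
  have hM := isUnit_inputWeight (S := S) hμg (mul_vnorm_sq_le_quadForm hR.1) hPn
  have hMs := isSymm_inputWeight (S := S) hRs hPs
  have hMn : ∀ u, 0 ≤ quadForm (R + S.Bᵀ * S.Pe Q R * S.B) u := fun u =>
    le_trans (by positivity)
      (mul_vnorm_sq_le_quadForm_inputWeight (mul_vnorm_sq_le_quadForm hR.1) hPn u)
  have hsq := stage_add_quadForm_eq (Q := Q) hRs hPs hM
  rw [ric_Pe hS hμf hμg hQ hR] at hsq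
  have hU := isUnit_one_sub_closedLoop hS hμf hμg hQ hR
  have hUdet := (Matrix.isUnit_iff_isUnit_det _).1 hU
  have hPdet := (Matrix.isUnit_iff_isUnit_det _).1 (isUnit_Pe hS hμf hμg hQ hR)
  have hMdet := (Matrix.isUnit_iff_isUnit_det _).1 hM
  set β := S.F Q R *ᵥ θ with hβ
  have hKe : S.gain R (S.Pe Q R) = S.Ke Q R := rfl
  rw [hKe] at hsq
  set K := S.Ke Q R with hK
  set P := S.Pe Q R with hP
  set M := R + S.Bᵀ * P * S.B with hMdef
  -- the vector `v = P β`, which satisfies `v - (A - B K)ᵀ v = Q θ`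
  set v := P *ᵥ β with hv
  have hv' : (1 - (S.A - S.B * K))ᵀ *ᵥ v = Q *ᵥ θ := by
    have hUdet' : IsUnit (1 - (S.A - S.B * K)ᵀ).det := by
      rw [show 1 - (S.A - S.B * K)ᵀ = (1 - (S.A - S.B * K))ᵀ by simp, Matrix.det_transpose]
      exact hUdet
    have h1 : v = (1 - (S.A - S.B * K)ᵀ)⁻¹ *ᵥ (Q *ᵥ θ) := by
      rw [hv, hβ, F, Matrix.mulVec_mulVec, Matrix.mulVec_mulVec, Matrix.mul_assoc P⁻¹,
        Matrix.mul_nonsing_inv_cancel_left _ _ hPdet]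
    rw [h1, Matrix.transpose_sub, Matrix.transpose_one, Matrix.mulVec_mulVec,
      Matrix.mul_nonsing_inv _ hUdet', Matrix.one_mulVec]
  set k := M⁻¹ *ᵥ (S.Bᵀ *ᵥ v) with hk
  have hMk : M *ᵥ k = S.Bᵀ *ᵥ v := by
    rw [hk, Matrix.mulVec_mulVec, Matrix.mul_nonsing_inv _ hMdet, Matrix.one_mulVec]
  set c := 1 / 2 * quadForm Q θ - 1 / 2 * quadForm M k with hc
  have hid : ∀ x u, S.stageCost Q R θ x u + 1 / 2 * quadForm P (S.A *ᵥ x + S.B *ᵥ u - β) =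
      c + 1 / 2 * quadForm P (x - β) + 1 / 2 * quadForm M (u + K *ᵥ x - k) := by
    intro x u
    have h1 := hsq x u
    have hlin : x ⬝ᵥ Q *ᵥ θ + (S.A *ᵥ x + S.B *ᵥ u) ⬝ᵥ v =
        x ⬝ᵥ v + (u + K *ᵥ x) ⬝ᵥ (S.Bᵀ *ᵥ v) := by
      rw [← hv', dotProduct_mulVec_comm _ x v, dotProduct_mulVec_comm _ (u + K *ᵥ x) v,
        Matrix.transpose_transpose, Matrix.transpose_transpose]
      simp only [Matrix.sub_mulVec, Matrix.one_mulVec, Matrix.mulVec_add, sub_dotProduct,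
        add_dotProduct, ← Matrix.mulVec_mulVec, dotProduct_comm v]
      ring
    rw [stageCost, quadForm_sub hQs, quadForm_sub hPs, quadForm_sub hPs, quadForm_sub hMs, ← hv,
      hMk, hc]
    linarith
  refine ⟨c, fun x u => ?_, ?_⟩
  · rw [hid]
    linarith [hMn (u + K *ᵥ x - k)]
  · set x := (1 - (S.A - S.B * K))⁻¹ *ᵥ (S.B *ᵥ k) with hx
    have hfix : x = S.A *ᵥ x + S.B *ᵥ (k - K *ᵥ x) := by
      have h1 : (1 - (S.A - S.B * K)) *ᵥ x = S.B *ᵥ k := by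
        rw [hx, Matrix.mulVec_mulVec, Matrix.mul_nonsing_inv _ hUdet, Matrix.one_mulVec]
      rw [Matrix.mulVec_sub, ← h1]
      simp only [Matrix.sub_mulVec, Matrix.one_mulVec, ← Matrix.mulVec_mulVec]
      abel
    refine ⟨x, k - K *ᵥ x, hfix, ?_⟩
    have h1 := hid x (k - K *ᵥ x)
    rw [← hfix] at h1
    have h2 : k - K *ᵥ x + K *ᵥ x - k = 0 := by abel
    rw [h2, quadForm_zero] at h1
    linarith

lemma isOptSteadyState_optSteadyState (hS : S.IsCanonical) (hμf : 0 < μf) (hμg : 0 < μg)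
    (hQ : Q ∈ S.Qset μf lf) (hR : R ∈ S.Rset μg lg) (θ : S.Idx → ℝ) :
    S.IsOptSteadyState Q R θ (S.optSteadyState Q R θ) := by
  refine Classical.epsilon_spec (p := S.IsOptSteadyState Q R θ) ?_
  obtain ⟨c, h1, x, u, h2, h3⟩ := exists_bellman hS hμf hμg hQ hR θ
  refine ⟨(x, u), h2, fun x' u' h' => ?_⟩
  have := h1 x' u'
  rw [← h'] at this
  rw [h3]
  linarith

/-- The Bellman inequality, with the cost of the optimal steady state as the average cost. -/
lemma bellman_le (hS : S.IsCanonical) (hμf : 0 < μf) (hμg : 0 < μg)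
    (hQ : Q ∈ S.Qset μf lf) (hR : R ∈ S.Rset μg lg) (θ x : S.Idx → ℝ) (u : Fin m → ℝ) :
    S.stageCost Q R θ (S.optSteadyState Q R θ).1 (S.optSteadyState Q R θ).2 +
        1 / 2 * quadForm (S.Pe Q R) (x - S.F Q R *ᵥ θ) ≤
      S.stageCost Q R θ x u +
        1 / 2 * quadForm (S.Pe Q R) (S.A *ᵥ x + S.B *ᵥ u - S.F Q R *ᵥ θ) := by
  obtain ⟨c, h1, x', u', h2, h3⟩ := exists_bellman hS hμf hμg hQ hR θ
  have := (isOptSteadyState_optSteadyState hS hμf hμg hQ hR θ).2 x' u' h2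
  linarith [h1 x u]

lemma vnorm_F_mulVec_le (hS : S.IsCanonical) (hμf : 0 < μf) (hμg : 0 < μg) (hlf : 0 < lf)
    (hlg : 0 < lg) (hQ : Q ∈ S.Qset μf lf) (hR : R ∈ S.Rset μg lg) (θ : S.Idx → ℝ) :
    vnorm (S.F Q R *ᵥ θ) ≤
      1 / μf * (2 * S.riccatiBound lf lg / μf) * lf * vnorm θ := by
  have hQn : ‖Q‖ ≤ lf := opNorm_le_of_quadForm_le (isSymm_of_smul_one_le hQ.1)
    (fun x => le_trans (by positivity) (mul_vnorm_sq_le_quadForm hQ.1 x)) hlf.le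
    (quadForm_le_mul_vnorm_sq hQ.2)
  have hT : ‖(1 - (S.A - S.B * S.Ke Q R)ᵀ)⁻¹‖ ≤ 2 * S.riccatiBound lf lg / μf := by
    rw [show 1 - (S.A - S.B * S.Ke Q R)ᵀ = (1 - (S.A - S.B * S.Ke Q R))ᵀ by simp,
      ← Matrix.transpose_nonsing_inv, norm_transpose_eq]
    refine (norm_inv_one_sub_closedLoop_le hS hμf hμg hQ hR).trans ?_
    have := norm_Pe_le hS hμf hμg hlf hlg hQ hR
    gcongr
  refine (vnorm_mulVec_le _ _).trans (mul_le_mul_of_nonneg_right ?_ (vnorm_nonneg _))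
  have hb := riccatiBound_nonneg (S := S) hlf.le hlg.le
  exact (Matrix.l2_opNorm_mul _ _).trans (mul_le_mul ((Matrix.l2_opNorm_mul _ _).trans
    (mul_le_mul (norm_inv_Pe_le hS hμf hμg hQ hR) hT (norm_nonneg _) (by positivity))) hQn
    (norm_nonneg _) (by positivity))

end LTISystem

/-! ### The triple momentum method on a quadratic function -/

namespace TripleMomentum

open scoped RealInnerProductSpace

variable {E : Type*} [NormedAddCommGroup E] [InnerProductSpace ℝ E]

/-- The form `⟪(L - H) y, (H - μ) y⟫`; up to the factor `2 (L - μ)` it is the slack of the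
interpolation inequality, between `y` and the minimiser `0`, for `½ ⟪H y, y⟫` as a `μ`-strongly
convex and `L`-smooth function. -/
noncomputable def slack (μ L : ℝ) (H : E →ₗ[ℝ] E) (y : E) : ℝ :=
  ⟪L • y - H y, H y - μ • y⟫

variable {μ L : ℝ} {H : E →ₗ[ℝ] E}

lemma slack_nonneg (hH : H.IsSymmetric) (h1 : ∀ x, μ * ‖x‖ ^ 2 ≤ ⟪H x, x⟫)
    (h2 : ∀ x, ⟪H x, x⟫ ≤ L * ‖x‖ ^ 2) (y : E) : 0 ≤ slack μ L H y := by
  set w := H y - μ • y with hw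
  -- the form `b(x, x') = ⟪(H - μ) x, x'⟫` is positive semidefinite and bounded by `L - μ`
  set b : E → E → ℝ := fun x x' => ⟪H x - μ • x, x'⟫ with hb
  have hbn : ∀ x, 0 ≤ b x x := by
    intro x
    have := h1 x
    simp only [hb, inner_sub_left, real_inner_smul_left, real_inner_self_eq_norm_sq]
    linarith
  have hbs : ∀ x x', b x x' = b x' x := by
    intro x x'
    simp only [hb, inner_sub_left, real_inner_smul_left]
    rw [hH x x', real_inner_comm x x', real_inner_comm x (H x')]
  have hcs : b y w ^ 2 ≤ b y y * b w w := by
    have h : ∀ t : ℝ, 0 ≤ b w w * (t * t) + 2 * b y w * t + b y y := by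
      intro t
      have h := hbn (y + t • w)
      have he : b (y + t • w) (y + t • w) = b y y + t * b y w + t * b w y + t * t * b w w := by
        simp only [hb, map_add, map_smul, inner_sub_left, inner_add_left, inner_add_right,
          real_inner_smul_left, real_inner_smul_right]
        ring
      rw [he, hbs w y] at h
      linarith
    have := discrim_le_zero h
    rw [discrim] at this
    linarith
  have hyw : b y w = ‖w‖ ^ 2 := by simp only [hb, ← hw, real_inner_self_eq_norm_sq]
  have hww : b w w ≤ (L - μ) * ‖w‖ ^ 2 := by
    have := h2 w
    simp only [hb, inner_sub_left, real_inner_smul_left, real_inner_self_eq_norm_sq]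
    linarith
  have hval : slack μ L H y = (L - μ) * b y y - ‖w‖ ^ 2 := by
    have hx : L • y - H y = (L - μ) • y - w := by rw [hw]; module
    rw [slack, hx, ← hw, inner_sub_left, real_inner_smul_left, real_inner_self_eq_norm_sq,
      real_inner_comm w y]
  rw [hval]
  rcases (sq_nonneg ‖w‖).eq_or_lt with h | h
  · rw [← h, sub_zero]
    rcases (sq_nonneg ‖y‖).eq_or_lt with h' | h'
    · have hy : y = 0 := by simpa using h'.symm
      simp [hb, hy]
    · have := (h1 y).trans (h2 y)
      exact mul_nonneg (by nlinarith) (hbn y)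
  · rw [hyw] at hcs
    have h3 := mul_le_mul_of_nonneg_left hww (hbn y)
    by_contra hneg
    nlinarith

lemma slack_sub (hH : H.IsSymmetric) (x y : E) :
    slack μ L H (x - y) =
      slack μ L H x - 2 * ⟪L • x - H x, H y - μ • y⟫ + slack μ L H y := by
  have hs := hH x y
  simp only [slack, map_sub, smul_sub, inner_sub_left, inner_sub_right, real_inner_smul_left,
    real_inner_smul_right]
  rw [real_inner_comm (H x) (H y), real_inner_comm x y, real_inner_comm (H x) y,
    real_inner_comm x (H y), ← hs, real_inner_comm y (H x)]
  ring

variable {r : ℝ}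

/-- One step of the Lyapunov function: with `μ = r² L`, the quantity
`slack (y_{k-1}) + 2 μ L ‖z_k‖²` contracts by the factor `(1 - r)²`. -/
lemma lyapunov_step (hH : H.IsSymmetric) (h1 : ∀ x, μ * ‖x‖ ^ 2 ≤ ⟪H x, x⟫)
    (h2 : ∀ x, ⟪H x, x⟫ ≤ L * ‖x‖ ^ 2) (hL : 0 < L) (hr : 0 < r) (hr1 : r ≤ 1)
    (hμ : μ = r ^ 2 * L) {y₀ y z z' : E}
    (hy : L • ((1 + r) • y - (2 * r) • z) = (1 - r) • (L • y₀ - H y₀))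
    (hz' : z' = (1 - r) • z - (1 / (r * L)) • (H y - μ • y)) :
    slack μ L H y + 2 * μ * L * ‖z'‖ ^ 2 ≤
      (1 - r) ^ 2 * (slack μ L H y₀ + 2 * μ * L * ‖z‖ ^ 2) := by
  set w := H y - μ • y with hw
  have hcross : (1 - r) * ⟪L • y₀ - H y₀, w⟫ = L * ((1 + r) * ⟪y, w⟫ - 2 * r * ⟪z, w⟫) := by
    rw [← real_inner_smul_left, ← hy]
    simp only [real_inner_smul_left, inner_sub_left]
  have hnorm : ‖z'‖ ^ 2 = (1 - r) ^ 2 * ‖z‖ ^ 2 - 2 * ((1 - r) * (1 / (r * L))) * ⟪z, w⟫ +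
      (1 / (r * L)) ^ 2 * ‖w‖ ^ 2 := by
    rw [hz', norm_sub_sq_real, norm_smul, norm_smul, real_inner_smul_left, real_inner_smul_right,
      mul_pow, mul_pow, Real.norm_eq_abs, Real.norm_eq_abs, sq_abs, sq_abs]
    ring
  have hψ : slack μ L H y = (L - μ) * ⟪y, w⟫ - ‖w‖ ^ 2 := by
    have hx : L • y - H y = (L - μ) • y - w := by rw [hw]; module
    rw [slack, hx, ← hw, inner_sub_left, real_inner_smul_left, real_inner_self_eq_norm_sq]
  have hn1 := slack_nonneg hH h1 h2 y
  have hn2 := slack_nonneg hH h1 h2 (y₀ - y)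
  have hsub := slack_sub (μ := μ) (L := L) hH y₀ y
  rw [← hw] at hsub
  -- the weights `(1 - r)²` and `1 - (1 - r)²` cancel all inner products that involve `z`
  have hident : (1 - r) ^ 2 * (slack μ L H y₀ + 2 * μ * L * ‖z‖ ^ 2) -
      (slack μ L H y + 2 * μ * L * ‖z'‖ ^ 2) =
      (1 - r) ^ 2 * slack μ L H (y₀ - y) + (1 - (1 - r) ^ 2) * slack μ L H y := by
    have e1 : 2 * μ * L * ((1 - r) * (1 / (r * L))) = 2 * r * L * (1 - r) := by
      rw [hμ]; field_simp
    have e2 : 2 * μ * L * (1 / (r * L)) ^ 2 = 2 := by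
      rw [hμ]; field_simp
    have e3 : 2 * μ * L * ‖z'‖ ^ 2 = 2 * μ * L * (1 - r) ^ 2 * ‖z‖ ^ 2 -
        2 * (2 * r * L * (1 - r)) * ⟪z, w⟫ + 2 * ‖w‖ ^ 2 := by
      linear_combination (2 * μ * L) * hnorm - 2 * ⟪z, w⟫ * e1 + ‖w‖ ^ 2 * e2
    rw [e3, hsub]
    have e4 : (1 - r) ^ 2 * ⟪L • y₀ - H y₀, w⟫ =
        (1 - r) * (L * ((1 + r) * ⟪y, w⟫ - 2 * r * ⟪z, w⟫)) := by
      rw [← hcross]; ring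
    have e5 : (L - μ) * ⟪y, w⟫ = slack μ L H y + ‖w‖ ^ 2 := by rw [hψ]; ring
    have e6 : (L - μ) * ⟪y, w⟫ = (1 - r) * (L * ((1 + r) * ⟪y, w⟫)) := by rw [hμ]; ring
    linear_combination 2 * e4 + 2 * e5 - 2 * e6
  have : 0 ≤ (1 - (1 - r) ^ 2) * slack μ L H y := mul_nonneg (by nlinarith) hn1
  have : 0 ≤ (1 - r) ^ 2 * slack μ L H (y₀ - y) := mul_nonneg (sq_nonneg _) hn2
  linarith

/-- The Lyapunov function after the first step, when the method starts at rest: it carries the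
factor `(1 - r)²` already. -/
lemma lyapunov_init (hH : H.IsSymmetric) (h1 : ∀ x, μ * ‖x‖ ^ 2 ≤ ⟪H x, x⟫)
    (h2 : ∀ x, ⟪H x, x⟫ ≤ L * ‖x‖ ^ 2) (hL : 0 < L) (hr : 0 < r) (hr1 : r ≤ 1)
    (hμ : μ = r ^ 2 * L) {y z' : E}
    (hz' : z' = (1 - r) • y - (1 / (r * L)) • (H y - μ • y)) :
    slack μ L H y + 2 * μ * L * ‖z'‖ ^ 2 ≤ (1 - r) ^ 2 * (3 * L ^ 2 * ‖y‖ ^ 2) := by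
  have hn := slack_nonneg hH h1 h2 y
  -- `(L - H)` and `(H - μ)` add up to `L - μ`, so that the slack is a difference of squares
  set e := H y - ((L + μ) / 2) • y with he
  have hslack : slack μ L H y = ((L - μ) / 2) ^ 2 * ‖y‖ ^ 2 - ‖e‖ ^ 2 := by
    have e1 : L • y - H y = ((L - μ) / 2) • y - e := by rw [he]; module
    have e2 : H y - μ • y = ((L - μ) / 2) • y + e := by rw [he]; module
    rw [slack, e1, e2, inner_sub_left, inner_add_right, inner_add_right, real_inner_smul_left,
      real_inner_smul_left, real_inner_smul_right, real_inner_smul_right,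
      real_inner_self_eq_norm_sq, real_inner_self_eq_norm_sq, real_inner_comm y e]
    ring
  have hLμ : L - μ = L * ((1 - r) * (1 + r)) := by rw [hμ]; ring
  have hφ : 0 ≤ 1 - r := by linarith
  have hen : ‖e‖ ≤ L * (1 - r) * ((1 + r) / 2) * ‖y‖ := by
    refine (abs_le_of_sq_le_sq' ?_ (by positivity)).2
    have : (L * (1 - r) * ((1 + r) / 2) * ‖y‖) ^ 2 = ((L - μ) / 2) ^ 2 * ‖y‖ ^ 2 := by
      rw [hLμ]; ring
    rw [this]
    linarith
  have hz : (r * L) • z' = ((-L) * ((1 - r) ^ 2 / 2)) • y - e := by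
    rw [hz', he, smul_sub, smul_smul, smul_smul, hμ]
    have : r * L * (1 / (r * L)) = 1 := by field_simp
    rw [this]
    module
  have hzn : r * L * ‖z'‖ ≤ L * (1 - r) * ‖y‖ := by
    have h3 : ‖(r * L) • z'‖ = r * L * ‖z'‖ := by
      rw [norm_smul, Real.norm_of_nonneg (by positivity)]
    rw [← h3, hz]
    refine (norm_sub_le _ _).trans ?_
    rw [norm_smul, Real.norm_eq_abs, neg_mul, abs_neg, abs_of_nonneg (by positivity)]
    calc L * ((1 - r) ^ 2 / 2) * ‖y‖ + ‖e‖ ≤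
        L * ((1 - r) ^ 2 / 2) * ‖y‖ + L * (1 - r) * ((1 + r) / 2) * ‖y‖ := by linarith
      _ = _ := by ring
  have hz2 : (r * L * ‖z'‖) ^ 2 ≤ (L * (1 - r) * ‖y‖) ^ 2 :=
    pow_le_pow_left₀ (by positivity) hzn 2
  have hs2 : slack μ L H y ≤ (1 - r) ^ 2 * (L ^ 2 * ‖y‖ ^ 2) := by
    have h3 : ((L - μ) / 2) ^ 2 * ‖y‖ ^ 2 =
        (1 - r) ^ 2 * (L ^ 2 * ‖y‖ ^ 2) * ((1 + r) / 2) ^ 2 := by rw [hLμ]; ring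
    have h4 : ((1 + r) / 2) ^ 2 ≤ 1 := by nlinarith
    have h5 : (1 - r) ^ 2 * (L ^ 2 * ‖y‖ ^ 2) * ((1 + r) / 2) ^ 2 ≤
        (1 - r) ^ 2 * (L ^ 2 * ‖y‖ ^ 2) * 1 := mul_le_mul_of_nonneg_left h4 (by positivity)
    linarith [sq_nonneg ‖e‖]
  have hzz : 2 * μ * L * ‖z'‖ ^ 2 = 2 * (r * L * ‖z'‖) ^ 2 := by rw [hμ]; ring
  rw [hzz]
  nlinarith

/-- The rate parameter `1 / √(L / μ)` of the triple momentum method. -/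
lemma rate_spec (hμ : 0 < μ) (hμL : μ ≤ L) :
    0 < 1 / Real.sqrt (L / μ) ∧ 1 / Real.sqrt (L / μ) ≤ 1 ∧
      μ = (1 / Real.sqrt (L / μ)) ^ 2 * L := by
  have hL : 0 < L := hμ.trans_le hμL
  have h1 : 1 ≤ Real.sqrt (L / μ) := by
    rw [Real.one_le_sqrt, one_le_div hμ]; exact hμL
  refine ⟨by positivity, ?_, ?_⟩
  · rw [div_le_one (by linarith)]; exact h1
  · rw [div_pow, Real.sq_sqrt (by positivity)]
    field_simp

/-- Convergence of the triple momentum method on a quadratic function with minimiser `0`; here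
`w j` is the iterate `ω(j - 1)`. -/
lemma norm_sq_output_le (hH : H.IsSymmetric) (h1 : ∀ x, μ * ‖x‖ ^ 2 ≤ ⟪H x, x⟫)
    (h2 : ∀ x, ⟪H x, x⟫ ≤ L * ‖x‖ ^ 2) (hμ : 0 < μ) (hμL : μ ≤ L) (w : ℕ → E)
    (h0 : w 1 = w 0)
    (hrec : ∀ j, w (j + 2) = (1 + (tmSteps μ L).γω) • w (j + 1) - (tmSteps μ L).γω • w j -
      (tmSteps μ L).γc • H ((1 + (tmSteps μ L).γy) • w (j + 1) - (tmSteps μ L).γy • w j))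
    (K : ℕ) :
    ‖(1 + (tmSteps μ L).γz) • w (K + 1) - (tmSteps μ L).γz • w K‖ ^ 2 ≤
      3 / 2 * (L / μ) * (1 - 1 / Real.sqrt (L / μ)) ^ (2 * K) * ‖w 0‖ ^ 2 := by
  have hL : 0 < L := hμ.trans_le hμL
  obtain ⟨hr, hr1, hμr⟩ := rate_spec hμ hμL
  simp only [tmSteps] at hrec ⊢
  set r := 1 / Real.sqrt (L / μ) with hrdef
  have hr2 : 0 < 2 - r := by linarith
  have ha : 2 - (1 - r) ≠ 0 := by linarith
  have hb : 1 + (1 - r) ≠ 0 := by linarith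
  have hc : 1 - (1 - r) ^ 2 ≠ 0 := by nlinarith
  have hc' : 1 - (1 - r) ^ 2 = r * (2 - r) := by ring
  set γω := (1 - r) ^ 2 / (2 - (1 - r)) with hγω
  set γc := (1 + (1 - r)) / L with hγc
  set γy := (1 - r) ^ 2 / ((1 + (1 - r)) * (2 - (1 - r))) with hγy
  set γz := (1 - r) ^ 2 / (1 - (1 - r) ^ 2) with hγz
  let y : ℕ → E := fun j => (1 + γy) • w (j + 1) - γy • w j
  let z : ℕ → E := fun j => (1 + γz) • w (j + 1) - γz • w j
  -- in the variables `y`, `z` the iteration has the form that the Lyapunov function requires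
  have hz : ∀ j, z (j + 1) = (1 - r) • z j - (1 / (r * L)) • (H (y j) - μ • y j) := by
    intro j
    simp only [z, hrec j]
    rw [show H ((1 + γy) • w (j + 1) - γy • w j) = H (y j) from rfl]
    generalize H (y j) = g
    simp only [y]
    rw [hγω, hγc, hγy, hγz, hc', hμr]
    match_scalars <;> field_simp <;> ring
  have hy : ∀ j, L • ((1 + r) • y (j + 1) - (2 * r) • z (j + 1)) =
      (1 - r) • (L • y j - H (y j)) := by
    intro j
    rw [show y (j + 1) = (1 + γy) • w (j + 2) - γy • w (j + 1) from rfl,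
      show z (j + 1) = (1 + γz) • w (j + 2) - γz • w (j + 1) from rfl, hrec j,
      show H ((1 + γy) • w (j + 1) - γy • w j) = H (y j) from rfl]
    generalize H (y j) = g
    simp only [y]
    rw [hγω, hγc, hγy, hγz, hc']
    match_scalars <;> field_simp <;> ring
  have hy0 : y 0 = w 0 := by simp only [y, zero_add, h0]; module
  have hz0 : z 0 = w 0 := by simp only [z, zero_add, h0]; module
  have hV : ∀ j, slack μ L H (y j) + 2 * μ * L * ‖z (j + 1)‖ ^ 2 ≤
      (1 - r) ^ (2 * (j + 1)) * (3 * L ^ 2 * ‖w 0‖ ^ 2) := by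
    intro j
    induction j with
    | zero =>
      have h := lyapunov_init (y := y 0) (z' := z 1) hH h1 h2 hL hr hr1 hμr (by
        rw [hz 0, hz0, hy0])
      rw [hy0] at h
      simpa [hy0] using h
    | succ j ih =>
      have h := lyapunov_step hH h1 h2 hL hr hr1 hμr (hy j) (hz (j + 1))
      refine h.trans ?_
      have := mul_le_mul_of_nonneg_left ih (sq_nonneg (1 - r))
      refine this.trans (le_of_eq ?_)
      ring
  change ‖z K‖ ^ 2 ≤ _
  rcases K with _ | K
  · rw [hz0, mul_zero, pow_zero, mul_one]
    have : 1 ≤ L / μ := (one_le_div hμ).2 hμL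
    nlinarith [sq_nonneg ‖w 0‖]
  · have h := hV K
    have hn := slack_nonneg hH h1 h2 (y K)
    have h3 : 2 * μ * L * ‖z (K + 1)‖ ^ 2 ≤
        (1 - r) ^ (2 * (K + 1)) * (3 * L ^ 2 * ‖w 0‖ ^ 2) := by linarith
    have h4 : 3 / 2 * (L / μ) * (1 - r) ^ (2 * (K + 1)) * ‖w 0‖ ^ 2 =
        (1 - r) ^ (2 * (K + 1)) * (3 * L ^ 2 * ‖w 0‖ ^ 2) / (2 * μ * L) := by
      field_simp
    rw [h4, le_div_iff₀ (by positivity)]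
    linarith

end TripleMomentum

/-! ### Trajectories of canonical systems as sequences -/

namespace LTISystem

variable {m : ℕ} {S : LTISystem m}

lemma stateOf_add (z v : ℤ → Fin m → ℝ) (t : ℤ) :
    S.stateOf (z + v) t = S.stateOf z t + S.stateOf v t := rfl

lemma stateOf_smul (a : ℝ) (z : ℤ → Fin m → ℝ) (t : ℤ) :
    S.stateOf (a • z) t = a • S.stateOf z t := rfl

lemma inputOf_add (z v : ℤ → Fin m → ℝ) (t : ℤ) :
    S.inputOf (z + v) t = S.inputOf z t + S.inputOf v t := by
  simp only [inputOf, stateOf_add, AI_eq_mulVec, Matrix.mulVec_add, Pi.add_apply]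
  abel

lemma inputOf_smul (a : ℝ) (z : ℤ → Fin m → ℝ) (t : ℤ) :
    S.inputOf (a • z) t = a • S.inputOf z t := by
  simp only [inputOf, stateOf_smul, AI_eq_mulVec, Matrix.mulVec_smul, Pi.smul_apply, smul_sub]

/-- The state at time `t` depends on the entries of the sequence at `t - p + 1, …, t` only. -/
lemma stateOf_congr {z z' : ℤ → Fin m → ℝ} {t : ℤ}
    (h : ∀ s, t - S.ctrlIndex < s → s ≤ t → z s = z' s) : S.stateOf z t = S.stateOf z' t := by
  ext ⟨i, l⟩
  have h1 := p_le_ctrlIndex (S := S) i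
  have h2 := l.2
  exact congrFun (h _ (by simp only; omega) (by simp only; omega)) i

lemma inputOf_congr {z z' : ℤ → Fin m → ℝ} {t : ℤ}
    (h : ∀ s, t - S.ctrlIndex < s → s ≤ t + 1 → z s = z' s) :
    S.inputOf z t = S.inputOf z' t := by
  rw [inputOf, inputOf, stateOf_congr fun s h1 h2 => h s h1 (by omega), h (t + 1) (by omega) le_rfl]

/-- The states that belong to a sequence follow the dynamics. -/
lemma stateOf_succ (hS : S.IsCanonical) (z : ℤ → Fin m → ℝ) (t : ℤ) :
    S.stateOf z (t + 1) = S.A *ᵥ S.stateOf z t + S.B *ᵥ S.inputOf z t := by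
  ext ⟨i, l⟩
  rw [step_apply hS]
  have h2 := l.2
  split_ifs with h
  · simp only [stateOf]
    congr 1
    push_cast
    ring
  · simp only [inputOf, Pi.sub_apply, add_sub_cancel]
    simp only [stateOf]
    congr 1
    omega

lemma stateOf_zero {z : ℤ → Fin m → ℝ} (hz : ∀ s ≤ 0, z s = 0) : S.stateOf z 0 = 0 := by
  ext ⟨i, l⟩
  have h2 := l.2
  simp only [stateOf]
  rw [hz _ (by omega)]
  simp

variable (S) in
/-- The sequence `z_{t+1} = u_t + A(ℐ, :) x_t` of the trajectory driven by `u`. -/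
noncomputable def seqOf (u : ℕ → Fin m → ℝ) : ℤ → Fin m → ℝ :=
  fun s => if 1 ≤ s then u (s - 1).toNat + S.AI (S.traj u (s - 1).toNat) else 0

lemma seqOf_succ (u : ℕ → Fin m → ℝ) (t : ℕ) :
    S.seqOf u ((t : ℤ) + 1) = u t + S.AI (S.traj u t) := by
  simp [seqOf]

lemma stateOf_seqOf (hS : S.IsCanonical) (u : ℕ → Fin m → ℝ) (t : ℕ) :
    S.stateOf (S.seqOf u) t = S.traj u t := by
  induction t with
  | zero => exact stateOf_zero fun s hs => by rw [seqOf, if_neg (by omega)]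
  | succ t ih =>
    rw [Nat.cast_succ, stateOf_succ hS, traj, inputOf, ih, seqOf_succ, add_sub_cancel_right]

lemma inputOf_seqOf (hS : S.IsCanonical) (u : ℕ → Fin m → ℝ) (t : ℕ) :
    S.inputOf (S.seqOf u) t = u t := by
  rw [inputOf, stateOf_seqOf hS, seqOf_succ, add_sub_cancel_right]

end LTISystem

namespace Tracking

open LTISystem

variable {m : ℕ} {S : LTISystem m} (T : Tracking S)

/-- The total cost as a function of the sequence `z`. -/
noncomputable def seqCost (z : ℤ → Fin m → ℝ) : ℝ :=
  ∑ t ∈ Finset.range (T.N + 1), T.f t (S.stateOf z t) +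
    ∑ t ∈ Finset.range T.N, T.g t (S.inputOf z t)

lemma C_eq_seqCost (z : EuclideanSpace ℝ (Fin T.N × Fin m)) :
    T.C z = T.seqCost (T.extend z) := rfl

/-- The vector of the entries `z_1, …, z_N` of a sequence. -/
noncomputable def toVec (z : ℤ → Fin m → ℝ) : EuclideanSpace ℝ (Fin T.N × Fin m) :=
  WithLp.toLp 2 fun k => z ((k.1 : ℕ) + 1) k.2

lemma toVec_apply (z : ℤ → Fin m → ℝ) (k : Fin T.N × Fin m) :
    T.toVec z k = z ((k.1 : ℕ) + 1) k.2 := rfl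

lemma extend_toVec (z : ℤ → Fin m → ℝ) (s : ℤ) :
    T.extend (T.toVec z) s = if 1 ≤ s ∧ s ≤ T.N then z s else 0 := by
  ext i
  simp only [extend]
  split_ifs with h
  · rw [toVec_apply]
    congr 1
    simp only
    omega
  · rfl

lemma extend_toVec_of_support {z : ℤ → Fin m → ℝ} (hz : ∀ s, ¬(1 ≤ s ∧ s ≤ (T.N : ℤ)) → z s = 0) :
    T.extend (T.toVec z) = z := by
  funext s
  rw [extend_toVec]
  split_ifs with h
  · rfl
  · exact (hz s h).symm

lemma extend_eq_zero (z : EuclideanSpace ℝ (Fin T.N × Fin m)) {s : ℤ}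
    (hs : ¬(1 ≤ s ∧ s ≤ (T.N : ℤ))) : T.extend z s = 0 := by
  ext i
  simp [extend, hs]

lemma extend_add (z v : EuclideanSpace ℝ (Fin T.N × Fin m)) :
    T.extend (z + v) = T.extend z + T.extend v := by
  ext s i
  simp only [extend, Pi.add_apply]
  split_ifs <;> simp

lemma extend_smul (a : ℝ) (z : EuclideanSpace ℝ (Fin T.N × Fin m)) :
    T.extend (a • z) = a • T.extend z := by
  ext s i
  simp only [extend, Pi.smul_apply]
  split_ifs <;> simp

lemma seqCost_congr {z z' : ℤ → Fin m → ℝ} (h : ∀ s ≤ (T.N : ℤ), z s = z' s) :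
    T.seqCost z = T.seqCost z' := by
  unfold seqCost
  congr 1
  · refine Finset.sum_congr rfl fun t ht => ?_
    have := Finset.mem_range.1 ht
    rw [stateOf_congr fun s _ h2 => h s (by omega)]
  · refine Finset.sum_congr rfl fun t ht => ?_
    have := Finset.mem_range.1 ht
    rw [inputOf_congr fun s _ h2 => h s (by omega)]

lemma C_toVec {z : ℤ → Fin m → ℝ} (hz : ∀ s ≤ 0, z s = 0) : T.C (T.toVec z) = T.seqCost z := by
  rw [C_eq_seqCost]
  refine T.seqCost_congr fun s hs => ?_
  rw [extend_toVec]
  split_ifs with h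
  · rfl
  · exact (hz s (by omega)).symm

lemma J_eq_seqCost {x : ℕ → S.Idx → ℝ} {u : ℕ → Fin m → ℝ} {z : ℤ → Fin m → ℝ}
    (hx : ∀ t : ℕ, x t = S.stateOf z t) (hu : ∀ t : ℕ, u t = S.inputOf z t) :
    T.J x u = T.seqCost z := by
  rw [J, seqCost, Finset.sum_range_succ, Finset.sum_add_distrib]
  simp only [hx, hu]
  ring

lemma le_Jstar (hS : S.IsCanonical) {a : ℝ} (ha : ∀ z, a ≤ T.C z) : a ≤ T.Jstar := by
  refine le_csInf (Set.range_nonempty _) ?_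
  rintro _ ⟨u, rfl⟩
  simp only
  rw [T.J_eq_seqCost (fun t => (stateOf_seqOf hS u t).symm) (fun t => (inputOf_seqOf hS u t).symm),
    ← T.C_toVec fun s hs => by rw [seqOf, if_neg (by omega)]]
  exact ha _

lemma rhtmIter_support (γ : StepSizes) {z0 : ℤ → Fin m → ℝ}
    (h0 : ∀ s, ¬(1 ≤ s ∧ s ≤ (T.N : ℤ)) → z0 s = 0) (j : ℕ) {s : ℤ}
    (hs : ¬(1 ≤ s ∧ s ≤ (T.N : ℤ))) :
    (T.rhtmIter γ z0 j).ωprev s = 0 ∧ (T.rhtmIter γ z0 j).ω s = 0 ∧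
      (T.rhtmIter γ z0 j).y s = 0 ∧ (T.rhtmIter γ z0 j).z s = 0 := by
  induction j with
  | zero => simp [rhtmIter, h0 s hs]
  | succ j ih => simp [rhtmIter, hs, ih.2.1]

lemma foss_support {s : ℤ} (hs : ¬(1 ≤ s ∧ s ≤ (T.N : ℤ))) : T.foss s = 0 := by
  ext i
  simp [foss, hs]

lemma rhtmZ_support (γ : StepSizes) (W : ℕ) {s : ℤ} (hs : ¬(1 ≤ s ∧ s ≤ (T.N : ℤ))) :
    T.rhtmZ γ W s = 0 :=
  (T.rhtmIter_support γ (fun _ => T.foss_support) _ hs).2.2.2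

lemma rhtmState_eq (hS : S.IsCanonical) (γ : StepSizes) (W t : ℕ) :
    T.rhtmState γ W t = S.stateOf (T.rhtmZ γ W) t := by
  induction t with
  | zero => exact (stateOf_zero fun s hs => T.rhtmZ_support γ W (by omega)).symm
  | succ t ih => rw [Nat.cast_succ, stateOf_succ hS, rhtmState, inputOf, ih]

lemma regret_le (hS : S.IsCanonical) (γ : StepSizes) (W : ℕ) {a : ℝ} (ha : ∀ z, a ≤ T.C z) :
    T.regret γ W ≤ T.C (T.toVec (T.rhtmZ γ W)) - a := by
  rw [regret, T.J_eq_seqCost (z := T.rhtmZ γ W) (fun t => T.rhtmState_eq hS γ W t)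
      (fun t => by rw [rhtmInput, T.rhtmState_eq hS, inputOf]),
    T.C_toVec fun s hs => T.rhtmZ_support γ W (by omega)]
  linarith [T.le_Jstar hS ha]

end Tracking

/-! ### Quadratic functions and their Hessians -/

/-- Functions of the form `½ b(z, z) + ℓ(z) + c` with a symmetric bilinear form `b` and a linear
form `ℓ`. -/
def IsQuadratic {E : Type*} [AddCommGroup E] [Module ℝ E] (f : E → ℝ) : Prop :=
  ∃ (b : LinearMap.BilinForm ℝ E) (ℓ : E →ₗ[ℝ] ℝ) (c : ℝ),
    (∀ x y, b x y = b y x) ∧ ∀ z, f z = 1 / 2 * b z z + ℓ z + c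

namespace IsQuadratic

variable {E : Type*} [AddCommGroup E] [Module ℝ E]

lemma add {f g : E → ℝ} (hf : IsQuadratic f) (hg : IsQuadratic g) :
    IsQuadratic fun z => f z + g z := by
  obtain ⟨b, ℓ, c, h1, h2⟩ := hf
  obtain ⟨b', ℓ', c', h1', h2'⟩ := hg
  refine ⟨b + b', ℓ + ℓ', c + c', fun x y => ?_, fun z => ?_⟩
  · simp [h1 x y, h1' x y]
  · simp only [h2, h2', LinearMap.add_apply]; ring

lemma sum {α : Type*} (s : Finset α) {f : α → E → ℝ} (hf : ∀ a ∈ s, IsQuadratic (f a)) :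
    IsQuadratic fun z => ∑ a ∈ s, f a z := by
  classical
  induction s using Finset.induction_on with
  | empty => exact ⟨0, 0, 0, by simp, by simp⟩
  | insert a s ha ih =>
    simp only [Finset.sum_insert ha]
    exact (hf a (Finset.mem_insert_self _ _)).add
      (ih fun a' h => hf a' (Finset.mem_insert_of_mem h))

lemma quadForm_sub {ι : Type*} [Fintype ι] {M : Matrix ι ι ℝ} (hM : M.IsSymm)
    (X : E →ₗ[ℝ] ι → ℝ) (θ : ι → ℝ) : IsQuadratic fun z => 1 / 2 * quadForm M (X z - θ) := by
  classical
  refine ⟨(Matrix.toBilin' M).comp X X, -((Matrix.toBilin' M θ).comp X), 1 / 2 * quadForm M θ,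
    fun x y => ?_, fun z => ?_⟩
  · simp only [LinearMap.BilinForm.comp_apply, Matrix.toBilin'_apply']
    exact dotProduct_mulVec_symm hM _ _
  · simp only [LinearMap.BilinForm.comp_apply, Matrix.toBilin'_apply', LinearMap.neg_apply,
      LinearMap.comp_apply]
    rw [LQT.quadForm_sub hM, dotProduct_mulVec_symm hM (X z) θ]
    simp only [quadForm]
    ring

end IsQuadratic

section Hessian

open scoped RealInnerProductSpace

variable {E : Type*} [NormedAddCommGroup E] [InnerProductSpace ℝ E] [FiniteDimensional ℝ E]

/-- A strongly convex quadratic function with Lipschitz gradient, in terms of its minimiser and its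
Hessian. -/
lemma exists_hessian [Nontrivial E] {C : E → ℝ} (hq : IsQuadratic C) {μ L : ℝ} (hμ : 0 < μ)
    (hsc : StrongConvexOn Set.univ μ C) (hd : Differentiable ℝ C)
    (hl : ∀ z z', ‖gradient C z - gradient C z'‖ ≤ L * ‖z - z'‖) :
    μ ≤ L ∧ ∃ (H : E →ₗ[ℝ] E) (zs : E), H.IsSymmetric ∧ (∀ x, μ * ‖x‖ ^ 2 ≤ ⟪H x, x⟫) ∧
      (∀ x, ⟪H x, x⟫ ≤ L * ‖x‖ ^ 2) ∧ (∀ z, gradient C z = H (z - zs)) ∧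
      ∀ z, C z = C zs + 1 / 2 * ⟪H (z - zs), z - zs⟫ := by
  obtain ⟨b, ℓ, c, hb, hC⟩ := hq
  have hgrad : ∀ z v, ⟪gradient C z, v⟫ = b z v + ℓ v := by
    intro z v
    have h1 : HasDerivAt (fun t : ℝ => C (z + t • v)) ⟪gradient C z, v⟫ 0 := by
      have hline : HasDerivAt (fun t : ℝ => z + t • v) v 0 := by
        simpa using ((hasDerivAt_id (0 : ℝ)).smul_const v).const_add z
      have hg : HasFDerivAt C (InnerProductSpace.toDual ℝ E (gradient C z)) (z + (0 : ℝ) • v) := by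
        rw [zero_smul, add_zero]
        exact (hd z).hasGradientAt.hasFDerivAt
      have h := hg.comp_hasDerivAt (0 : ℝ) hline
      rw [InnerProductSpace.toDual_apply_apply] at h
      exact h
    have h2 : HasDerivAt (fun t : ℝ => C z + t * (b z v + ℓ v) + t ^ 2 * (1 / 2 * b v v))
        (b z v + ℓ v) 0 := by
      have h3 := (((hasDerivAt_id (0 : ℝ)).mul_const (b z v + ℓ v)).const_add (C z)).add
        ((hasDerivAt_pow 2 (0 : ℝ)).mul_const (1 / 2 * b v v))
      exact h3.congr_deriv (by simp)
    refine h1.unique (h2.congr_of_eventuallyEq (Filter.Eventually.of_forall fun t => ?_))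
    simp only [hC, map_add, map_smul, LinearMap.add_apply, LinearMap.smul_apply, smul_eq_mul]
    rw [hb v z]; ring
  -- the gradient is affine, so that its linear part is the Hessian
  let H : E →ₗ[ℝ] E :=
    { toFun := fun v => gradient C v - gradient C 0
      map_add' := fun x y => ext_inner_right ℝ fun v => by
        simp only [inner_sub_left, inner_add_left, hgrad, map_add, map_zero, LinearMap.add_apply,
          LinearMap.zero_apply]
        ring
      map_smul' := fun a x => ext_inner_right ℝ fun v => by
        simp only [inner_sub_left, real_inner_smul_left, hgrad, map_smul, map_zero,
          LinearMap.smul_apply, LinearMap.zero_apply, smul_eq_mul, RingHom.id_apply]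
        ring }
  have hH : ∀ x v, ⟪H x, v⟫ = b x v := by
    intro x v
    change ⟪gradient C x - gradient C 0, v⟫ = _
    simp [inner_sub_left, hgrad]
  have hsymm : H.IsSymmetric := fun x y => by rw [hH, real_inner_comm, hH, hb]
  have hlow : ∀ x, μ * ‖x‖ ^ 2 ≤ ⟪H x, x⟫ := by
    intro x
    have h := hsc.2 (Set.mem_univ x) (Set.mem_univ (-x)) (show (0 : ℝ) ≤ 1 / 2 by norm_num)
      (show (0 : ℝ) ≤ 1 / 2 by norm_num) (by norm_num)
    have h0 : (1 / 2 : ℝ) • x + (1 / 2 : ℝ) • (-x) = 0 := by module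
    have hn : ‖x - -x‖ = 2 * ‖x‖ := by
      rw [sub_neg_eq_add, ← two_smul ℝ x, norm_smul]; norm_num
    rw [h0, hn] at h
    simp only [hC, map_neg, map_zero, LinearMap.neg_apply, smul_eq_mul] at h
    rw [hH]
    nlinarith
  have hup : ∀ x, ⟪H x, x⟫ ≤ L * ‖x‖ ^ 2 := by
    intro x
    have h1 : ‖H x‖ ≤ L * ‖x‖ := by
      have h := hl x 0
      rwa [sub_zero] at h
    calc ⟪H x, x⟫ ≤ ‖H x‖ * ‖x‖ := real_inner_le_norm _ _
      _ ≤ L * ‖x‖ * ‖x‖ := mul_le_mul_of_nonneg_right h1 (norm_nonneg _)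
      _ = _ := by ring
  have hinj : Function.Injective H := by
    refine (injective_iff_map_eq_zero H).2 fun x hx => ?_
    have h := hlow x
    rw [hx, inner_zero_left] at h
    have : ‖x‖ ^ 2 = 0 := le_antisymm (by nlinarith) (sq_nonneg _)
    simpa using this
  obtain ⟨zs, hzs⟩ := LinearMap.injective_iff_surjective.1 hinj (-gradient C 0)
  have hg : ∀ z, gradient C z = H (z - zs) := by
    intro z
    rw [map_sub, hzs]
    change _ = gradient C z - gradient C 0 - _
    abel
  refine ⟨?_, H, zs, hsymm, hlow, hup, hg, fun z => ?_⟩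
  · obtain ⟨x, hx⟩ := exists_ne (0 : E)
    have : 0 < ‖x‖ ^ 2 := by have := norm_pos_iff.2 hx; positivity
    exact le_of_mul_le_mul_right ((hlow x).trans (hup x)) this
  · have h0 : b zs (z - zs) + ℓ (z - zs) = 0 := by
      rw [← hgrad, hg]; simp
    rw [hH, hC, hC zs]
    simp only [map_sub, LinearMap.sub_apply] at h0 ⊢
    rw [hb z zs]
    linarith

end Hessian

/-! ### RHTM performs triple momentum steps on the total cost -/

namespace Tracking

open LTISystem

variable {m : ℕ} {S : LTISystem m} (T : Tracking S)

/-- The state at time `t` as a linear function of the variables. -/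
noncomputable def stateMap (t : ℤ) : EuclideanSpace ℝ (Fin T.N × Fin m) →ₗ[ℝ] S.Idx → ℝ where
  toFun z := S.stateOf (T.extend z) t
  map_add' z v := by rw [extend_add, stateOf_add]
  map_smul' a z := by rw [extend_smul, stateOf_smul, RingHom.id_apply]

/-- The input at time `t` as a linear function of the variables. -/
noncomputable def inputMap (t : ℤ) : EuclideanSpace ℝ (Fin T.N × Fin m) →ₗ[ℝ] Fin m → ℝ where
  toFun z := S.inputOf (T.extend z) t
  map_add' z v := by rw [extend_add, inputOf_add]
  map_smul' a z := by rw [extend_smul, inputOf_smul, RingHom.id_apply]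

lemma isQuadratic_C (hQ : ∀ t ≤ T.N, (T.Q t).IsSymm) (hR : ∀ t < T.N, (T.R t).IsSymm) :
    IsQuadratic T.C := by
  refine IsQuadratic.add
    (f := fun z => ∑ t ∈ Finset.range (T.N + 1), T.f t (S.stateOf (T.extend z) t))
    (g := fun z => ∑ t ∈ Finset.range T.N, T.g t (S.inputOf (T.extend z) t))
    (IsQuadratic.sum _ fun t ht => ?_) (IsQuadratic.sum _ fun t ht => ?_)
  · exact IsQuadratic.quadForm_sub (hQ t (by have := Finset.mem_range.1 ht; omega))
      (T.stateMap t) (T.θ t)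
  · have h := IsQuadratic.quadForm_sub (hR t (Finset.mem_range.1 ht)) (T.inputMap t) 0
    simp only [sub_zero] at h
    exact h

/-- Changing the entry `z_s` changes the total cost by the change of the local cost. -/
lemma exists_seqCost_update_eq (z : ℤ → Fin m → ℝ) {s : ℤ} (hs : 1 ≤ s) :
    ∃ c : ℝ, ∀ v : Fin m → ℝ, T.seqCost (Function.update z s v) =
      T.localCost s.toNat (Function.update
        (fun τ => if |τ - s| ≤ (S.ctrlIndex : ℤ) then z τ else 0) s v) + c := by
  set w : ℤ → Fin m → ℝ := fun τ => if |τ - s| ≤ (S.ctrlIndex : ℤ) then z τ else 0 with hw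
  have hnear : ∀ v τ, |τ - s| ≤ (S.ctrlIndex : ℤ) →
      Function.update z s v τ = Function.update w s v τ := by
    intro v τ hτ
    rcases eq_or_ne τ s with rfl | h
    · simp
    · simp [Function.update_of_ne h, hw, hτ]
  have hfar : ∀ v τ, τ ≠ s → Function.update z s v τ = z τ := fun v τ h =>
    Function.update_of_ne h _ _
  let If : ℕ → Prop := fun t => t ∈ Finset.Icc s.toNat (s.toNat + S.ctrlIndex - 1)
  let Ig : ℕ → Prop := fun t => t ∈ Finset.Icc (s.toNat - 1) (s.toNat + S.ctrlIndex - 1)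
  have hIf : ∀ t, If t ↔ s.toNat ≤ t ∧ t ≤ s.toNat + S.ctrlIndex - 1 := fun t => Finset.mem_Icc
  have hIg : ∀ t, Ig t ↔ s.toNat - 1 ≤ t ∧ t ≤ s.toNat + S.ctrlIndex - 1 :=
    fun t => Finset.mem_Icc
  classical
  refine ⟨∑ t ∈ (Finset.range (T.N + 1)).filter (fun t => ¬If t), T.f t (S.stateOf z t) +
    ∑ t ∈ (Finset.range T.N).filter (fun t => ¬Ig t), T.g t (S.inputOf z t), fun v => ?_⟩
  have hf1 : (Finset.range (T.N + 1)).filter If =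
      (Finset.Icc s.toNat (s.toNat + S.ctrlIndex - 1)).filter (· ≤ T.N) := by
    ext t
    simp only [Finset.mem_filter, Finset.mem_range, hIf, Finset.mem_Icc]
    omega
  have hg1 : (Finset.range T.N).filter Ig =
      (Finset.Icc (s.toNat - 1) (s.toNat + S.ctrlIndex - 1)).filter (· < T.N) := by
    ext t
    simp only [Finset.mem_filter, Finset.mem_range, hIg, Finset.mem_Icc]
    omega
  have hf2 : ∑ t ∈ (Finset.range (T.N + 1)).filter If,
      T.f t (S.stateOf (Function.update z s v) t) =
      ∑ t ∈ (Finset.range (T.N + 1)).filter If, T.f t (S.stateOf (Function.update w s v) t) := by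
    refine Finset.sum_congr rfl fun t ht => ?_
    have := (hIf t).1 (Finset.mem_filter.1 ht).2
    rw [stateOf_congr fun τ h1 h2 => hnear v τ (by rw [abs_le]; omega)]
  have hg2 : ∑ t ∈ (Finset.range T.N).filter Ig,
      T.g t (S.inputOf (Function.update z s v) t) =
      ∑ t ∈ (Finset.range T.N).filter Ig, T.g t (S.inputOf (Function.update w s v) t) := by
    refine Finset.sum_congr rfl fun t ht => ?_
    have := (hIg t).1 (Finset.mem_filter.1 ht).2
    rw [inputOf_congr fun τ h1 h2 => hnear v τ (by rw [abs_le]; omega)]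
  have hf3 : ∑ t ∈ (Finset.range (T.N + 1)).filter (fun t => ¬If t),
      T.f t (S.stateOf (Function.update z s v) t) =
      ∑ t ∈ (Finset.range (T.N + 1)).filter (fun t => ¬If t), T.f t (S.stateOf z t) := by
    refine Finset.sum_congr rfl fun t ht => ?_
    have := mt (hIf t).2 (Finset.mem_filter.1 ht).2
    rw [stateOf_congr fun τ h1 h2 => hfar v τ (by omega)]
  have hg3 : ∑ t ∈ (Finset.range T.N).filter (fun t => ¬Ig t),
      T.g t (S.inputOf (Function.update z s v) t) =
      ∑ t ∈ (Finset.range T.N).filter (fun t => ¬Ig t), T.g t (S.inputOf z t) := by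
    refine Finset.sum_congr rfl fun t ht => ?_
    have := mt (hIg t).2 (Finset.mem_filter.1 ht).2
    rw [inputOf_congr fun τ h1 h2 => hfar v τ (by omega)]
  rw [seqCost, ← Finset.sum_filter_add_sum_filter_not (Finset.range (T.N + 1)) If,
    ← Finset.sum_filter_add_sum_filter_not (Finset.range T.N) Ig, hf2, hf3, hg2, hg3, hf1, hg1,
    localCost]
  ring

/-- The locally computed partial gradient is the partial gradient of the total cost. -/
lemma partialC_extend (hd : Differentiable ℝ T.C) (z : EuclideanSpace ℝ (Fin T.N × Fin m))
    (k : Fin T.N × Fin m) :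
    T.partialC ((k.1 : ℕ) + 1) (T.extend z) k.2 = gradient T.C z k := by
  classical
  set s : ℤ := ((k.1 : ℕ) : ℤ) + 1 with hs
  set e : EuclideanSpace ℝ (Fin T.N × Fin m) := EuclideanSpace.single k 1 with he
  have hzk : T.extend z s k.2 = z k := by
    have h1 : 1 ≤ s ∧ s ≤ T.N := by have := k.1.2; omega
    have hk : (⟨(s - 1).toNat, by omega⟩ : Fin T.N) = k.1 := by ext; simp only; omega
    simp only [extend, h1, and_self, dite_true, hk]
  have hupd : ∀ r : ℝ, T.extend (z + (r - z k) • e) =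
      Function.update (T.extend z) s (Function.update (T.extend z s) k.2 r) := by
    intro r
    ext τ i
    rw [extend_add, extend_smul]
    simp only [Pi.add_apply, Pi.smul_apply, smul_eq_mul]
    rcases eq_or_ne τ s with rfl | hτ
    · rw [Function.update_self]
      have h1 : 1 ≤ s ∧ s ≤ T.N := by have := k.1.2; omega
      have hk : (⟨(s - 1).toNat, by omega⟩ : Fin T.N) = k.1 := by ext; simp only; omega
      rcases eq_or_ne i k.2 with rfl | hi
      · rw [Function.update_self, hzk]
        simp only [extend, h1, and_self, dite_true, hk]
        simp [he]
      · rw [Function.update_of_ne hi]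
        simp only [extend, h1, and_self, dite_true, hk]
        have : (k.1, i) ≠ k := fun h => hi (congrArg Prod.snd h)
        simp [he, this]
    · rw [Function.update_of_ne hτ]
      have : T.extend e τ i = 0 := by
        simp only [extend]
        split_ifs with h
        · have : ((⟨(τ - 1).toNat, by omega⟩ : Fin T.N), i) ≠ k := by
            intro hk
            have := congrArg (fun q => (q.1 : ℕ)) hk
            simp only at this
            omega
          rw [he, PiLp.single_apply, if_neg this]
        · rfl
      rw [this]; ring
  obtain ⟨c, hc⟩ := T.exists_seqCost_update_eq (T.extend z) (s := s) (by omega)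
  have hpart : HasDerivAt (fun r : ℝ => T.C (z + (r - z k) • e)) (gradient T.C z k) (z k) := by
    have hline : HasDerivAt (fun r : ℝ => z + (r - z k) • e) e (z k) := by
      simpa using (((hasDerivAt_id (z k)).sub_const (z k)).smul_const e).const_add z
    have hg : HasFDerivAt T.C (InnerProductSpace.toDual ℝ _ (gradient T.C z))
        (z + (z k - z k) • e) := by
      rw [sub_self, zero_smul, add_zero]
      exact (hd z).hasGradientAt.hasFDerivAt
    have h1 := hg.comp_hasDerivAt (z k) hline
    have h2 : (InnerProductSpace.toDual ℝ _ (gradient T.C z)) e = gradient T.C z k := by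
      rw [InnerProductSpace.toDual_apply_apply, he, EuclideanSpace.inner_single_right]
      simp
    rwa [h2] at h1
  have hw : |s - s| ≤ (S.ctrlIndex : ℤ) := by simp
  simp only [partialC]
  rw [if_pos hw, hzk]
  refine HasDerivAt.deriv ?_
  refine (hpart.sub_const c).congr_of_eventuallyEq (Filter.Eventually.of_forall fun r => ?_)
  simp only [C_eq_seqCost, hupd, hc]
  ring

lemma toVec_combination (a b : ℝ) (z v : ℤ → Fin m → ℝ) :
    T.toVec (fun s => a • z s - b • v s) = a • T.toVec z - b • T.toVec v := by
  ext k
  simp [toVec_apply]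

/-- The regret of RHTM in terms of the cost of its initialization. -/
lemma exists_minimizer_regret_le (hS : S.IsCanonical) (hm : 1 ≤ m) (hN : 1 ≤ T.N)
    (hQ : ∀ t ≤ T.N, (T.Q t).IsSymm) (hR : ∀ t < T.N, (T.R t).IsSymm) {μ L : ℝ} (hμ : 0 < μ)
    (hmod : T.HasModuli μ L) :
    ∃ zs, (∀ z, T.C zs ≤ T.C z) ∧ ∀ W, T.regret (tmSteps μ L) W ≤
      3 / 2 * ((L / μ) ^ 2 * (1 - 1 / Real.sqrt (L / μ)) ^ (2 * S.iterations W)) *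
        (T.C (T.toVec T.foss) - T.C zs) := by
  have : Nonempty (Fin T.N × Fin m) := ⟨⟨⟨0, hN⟩, ⟨0, hm⟩⟩⟩
  obtain ⟨hsc, hd, hl⟩ := hmod
  obtain ⟨hμL, H, zs, hH, h1, h2, hgrad, hval⟩ :=
    exists_hessian (T.isQuadratic_C hQ hR) hμ hsc hd hl
  have hL : 0 < L := hμ.trans_le hμL
  have hmin : ∀ z, T.C zs ≤ T.C z := by
    intro z
    rw [hval z]
    have := h1 (z - zs)
    have : 0 ≤ μ * ‖z - zs‖ ^ 2 := by positivity
    linarith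
  refine ⟨zs, hmin, fun W => ?_⟩
  set γ := tmSteps μ L with hγ
  set K := S.iterations W with hK
  let it : ℕ → TMIterate m := T.rhtmIter γ T.foss
  -- `w j` holds the iterate `ω(j - 1)`
  let w : ℕ → EuclideanSpace ℝ (Fin T.N × Fin m) := fun j =>
    Nat.casesOn j (T.toVec T.foss) fun j => T.toVec (it j).ω
  have hprev : ∀ j, T.toVec (it j).ωprev = w j := fun j => by cases j <;> rfl
  have hcur : ∀ j, T.toVec (it j).ω = w (j + 1) := fun j => rfl
  have hy : ∀ j, T.toVec (it j).y = (1 + γ.γy) • w (j + 1) - γ.γy • w j := by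
    intro j
    cases j with
    | zero =>
      change T.toVec T.foss = (1 + γ.γy) • T.toVec T.foss - γ.γy • T.toVec T.foss
      module
    | succ j => exact T.toVec_combination _ _ _ _
  have hz : ∀ j, T.toVec (it j).z = (1 + γ.γz) • w (j + 1) - γ.γz • w j := by
    intro j
    cases j with
    | zero =>
      change T.toVec T.foss = (1 + γ.γz) • T.toVec T.foss - γ.γz • T.toVec T.foss
      module
    | succ j => exact T.toVec_combination _ _ _ _
  have hrec : ∀ j, w (j + 2) = (1 + γ.γω) • w (j + 1) - γ.γω • w j -
      γ.γc • gradient T.C ((1 + γ.γy) • w (j + 1) - γ.γy • w j) := by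
    intro j
    rw [← hy, ← hcur, ← hcur, ← hprev]
    ext k
    have hk : (1 : ℤ) ≤ ((k.1 : ℕ) : ℤ) + 1 ∧ ((k.1 : ℕ) : ℤ) + 1 ≤ (T.N : ℤ) := by
      have := k.1.2; omega
    have hp := T.partialC_extend hd (T.toVec (it j).y) k
    rw [T.extend_toVec_of_support fun s hs =>
      (T.rhtmIter_support γ (fun _ => T.foss_support) j hs).2.2.1] at hp
    rw [toVec_apply]
    simp only [PiLp.sub_apply, PiLp.smul_apply, toVec_apply, smul_eq_mul]
    rw [← hp]
    simp only [it, rhtmIter, hk, and_self, if_true, Pi.sub_apply, Pi.smul_apply, smul_eq_mul]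
  have hb := TripleMomentum.norm_sq_output_le hH h1 h2 hμ hμL (fun j => w j - zs) rfl
    (fun j => by
      have e1 : (1 + γ.γy) • (w (j + 1) - zs) - γ.γy • (w j - zs) =
          ((1 + γ.γy) • w (j + 1) - γ.γy • w j) - zs := by module
      simp only [← hγ, e1, ← hgrad, hrec]
      module) K
  have e2 : (1 + γ.γz) • (w (K + 1) - zs) - γ.γz • (w K - zs) = T.toVec (it K).z - zs := by
    rw [hz]; module
  rw [← hγ, e2] at hb
  refine (T.regret_le hS γ W hmin).trans ?_
  change T.C (T.toVec (it K).z) - _ ≤ _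
  set φ := 1 - 1 / Real.sqrt (L / μ) with hφ
  have hφ0 : 0 ≤ φ := by have := (TripleMomentum.rate_spec hμ hμL).2.1; linarith
  have hup := h2 (T.toVec (it K).z - zs)
  have hlo := h1 (T.toVec T.foss - zs)
  have hw0 : w 0 = T.toVec T.foss := rfl
  rw [hw0] at hb
  have hv1 := hval (T.toVec (it K).z)
  have hv2 := hval (T.toVec T.foss)
  have hn0 : ‖T.toVec T.foss - zs‖ ^ 2 ≤ 2 / μ * (T.C (T.toVec T.foss) - T.C zs) := by
    rw [div_mul_eq_mul_div, le_div_iff₀ hμ]; linarith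
  calc T.C (T.toVec (it K).z) - T.C zs ≤ L / 2 * ‖T.toVec (it K).z - zs‖ ^ 2 := by linarith
    _ ≤ L / 2 * (3 / 2 * (L / μ) * φ ^ (2 * K) * ‖T.toVec T.foss - zs‖ ^ 2) :=
      mul_le_mul_of_nonneg_left hb (by positivity)
    _ ≤ L / 2 * (3 / 2 * (L / μ) * φ ^ (2 * K) *
          (2 / μ * (T.C (T.toVec T.foss) - T.C zs))) := by
      gcongr
    _ = _ := by field_simp

end Tracking

/-! ### Uniform boundedness of the optimal trajectory -/

/-- Summable weights that peak at a prescribed time and vary slowly. -/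
lemma exists_weight {ε : ℝ} (hε : 0 < ε) (q : ℕ) :
    ∃ W : ℝ, ∀ t₀ : ℤ, ∃ w : ℤ → ℝ, (∀ t, 0 < w t) ∧ w t₀ = 1 ∧
      (∀ s t, |s - t| ≤ (q : ℤ) → |w s - w t| ≤ ε * w t) ∧
      ∀ n : ℕ, ∑ t ∈ Finset.range n, w t ≤ W := by
  -- the weights are `ρ ^ |t - t₀|` with `ρ = 1 - δ`; by Bernoulli's inequality `(1 + ε) ρ ^ q ≥ 1`
  set δ : ℝ := ε / ((q + 1) * (1 + ε)) with hδ
  have hδ0 : 0 < δ := by positivity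
  have hδq : (q + 1) * δ = ε / (1 + ε) := by rw [hδ]; field_simp
  have hε1 : ε / (1 + ε) < 1 := by rw [div_lt_one (by positivity)]; linarith
  have hδ1 : δ < 1 := by
    have : 0 ≤ (q : ℝ) * δ := by positivity
    linarith
  set ρ : ℝ := 1 - δ with hρ
  have hρ0 : 0 < ρ := by linarith
  have hρ1 : ρ < 1 := by linarith
  have hpow : 1 ≤ (1 + ε) * ρ ^ q := by
    have h1 := one_add_mul_le_pow (a := -δ) (by linarith) q
    have h2 : 1 + -δ = ρ := by rw [hρ]; ring
    rw [h2] at h1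
    have h3 : 1 - ε / (1 + ε) ≤ ρ ^ q := by linarith
    have h4 : (1 + ε) * (1 - ε / (1 + ε)) = 1 := by field_simp; ring
    exact h4.symm.le.trans (mul_le_mul_of_nonneg_left h3 (by positivity))
  refine ⟨(1 - ρ)⁻¹ + (1 - ρ)⁻¹, fun t₀ => ⟨fun t => ρ ^ (t - t₀).natAbs, fun t => by positivity,
    by simp, ?_, fun n => ?_⟩⟩
  · have hle : ∀ s t : ℤ, |s - t| ≤ (q : ℤ) →
        ρ ^ (t - t₀).natAbs ≤ (1 + ε) * ρ ^ (s - t₀).natAbs := by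
      intro s t hst
      have h1 : ρ ^ ((t - t₀).natAbs + q) ≤ ρ ^ (s - t₀).natAbs :=
        pow_le_pow_of_le_one hρ0.le hρ1.le (by rw [abs_le] at hst; omega)
      rw [pow_add] at h1
      have h2 : 0 < ρ ^ (t - t₀).natAbs := by positivity
      calc ρ ^ (t - t₀).natAbs = ρ ^ (t - t₀).natAbs * 1 := by ring
        _ ≤ ρ ^ (t - t₀).natAbs * ((1 + ε) * ρ ^ q) := by gcongr
        _ = (1 + ε) * (ρ ^ (t - t₀).natAbs * ρ ^ q) := by ring
        _ ≤ _ := by gcongr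
    intro s t hst
    have h1 := hle s t hst
    have h2 := hle t s (by rwa [abs_sub_comm])
    have hs : 0 < ρ ^ (s - t₀).natAbs := by positivity
    have ht : 0 < ρ ^ (t - t₀).natAbs := by positivity
    rw [abs_le]
    constructor
    · nlinarith
    · linarith
  · have hgeom : ∀ A : Finset ℕ, Set.InjOn (fun t : ℕ => ((t : ℤ) - t₀).natAbs) A →
        ∑ t ∈ A, ρ ^ ((t : ℤ) - t₀).natAbs ≤ (1 - ρ)⁻¹ := by
      intro A hA
      rw [← Finset.sum_image (f := fun k => ρ ^ k) hA,
        ← tsum_geometric_of_lt_one hρ0.le hρ1]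
      exact (summable_geometric_of_lt_one hρ0.le hρ1).sum_le_tsum _ fun _ _ => by positivity
    rw [← Finset.sum_filter_add_sum_filter_not (Finset.range n) (fun t : ℕ => t₀ ≤ (t : ℤ))]
    refine add_le_add (hgeom _ ?_) (hgeom _ ?_)
    · intro a ha b hb hab
      simp only [Finset.coe_filter, Set.mem_ofPred_eq] at ha hb hab
      omega
    · intro a ha b hb hab
      simp only [Finset.coe_filter, Set.mem_ofPred_eq] at ha hb hab
      omega

/-- A quadratic polynomial without constant term that is nonnegative has no linear term. -/
lemma eq_zero_of_forall_nonneg {d e : ℝ} (h : ∀ r : ℝ, 0 ≤ r * d + r ^ 2 * e) : d = 0 := by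
  have h2 : ∀ r : ℝ, 0 ≤ e * (r * r) + d * r + 0 := fun r => by linarith [h r]
  have := discrim_le_zero h2
  rw [discrim] at this
  have : d ^ 2 = 0 := le_antisymm (by linarith) (sq_nonneg _)
  simpa using this

namespace Tracking

open LTISystem

variable {m : ℕ} {S : LTISystem m}

/-- The bounds on the data of a tracking problem on which the constants of the regret bound depend:
all weights lie between `a` and `b`, and the references are bounded by `θbar`. -/
structure IsBounded (T : Tracking S) (a b θbar : ℝ) : Prop where
  symmQ : ∀ t ≤ T.N, (T.Q t).IsSymm
  lowQ : ∀ t ≤ T.N, ∀ x, a * vnorm x ^ 2 ≤ quadForm (T.Q t) x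
  normQ : ∀ t ≤ T.N, ‖T.Q t‖ ≤ b
  symmR : ∀ t < T.N, (T.R t).IsSymm
  lowR : ∀ t < T.N, ∀ u, a * vnorm u ^ 2 ≤ quadForm (T.R t) u
  normR : ∀ t < T.N, ‖T.R t‖ ≤ b
  normθ : ∀ t ≤ T.N, vnorm (T.θ t) ≤ θbar

/-- The directional derivative of the total cost vanishes at a minimiser. -/
lemma stationarity (T : Tracking S) (hQ : ∀ t ≤ T.N, (T.Q t).IsSymm)
    (hR : ∀ t < T.N, (T.R t).IsSymm) {zs : EuclideanSpace ℝ (Fin T.N × Fin m)}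
    (hmin : ∀ z, T.C zs ≤ T.C z) {v : ℤ → Fin m → ℝ}
    (hv : ∀ s, ¬(1 ≤ s ∧ s ≤ (T.N : ℤ)) → v s = 0) :
    ∑ t ∈ Finset.range (T.N + 1),
        (S.stateOf (T.extend zs) t - T.θ t) ⬝ᵥ T.Q t *ᵥ S.stateOf v t +
      ∑ t ∈ Finset.range T.N, S.inputOf (T.extend zs) t ⬝ᵥ T.R t *ᵥ S.inputOf v t = 0 := by
  refine eq_zero_of_forall_nonneg (e := ∑ t ∈ Finset.range (T.N + 1),
    1 / 2 * quadForm (T.Q t) (S.stateOf v t) +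
      ∑ t ∈ Finset.range T.N, 1 / 2 * quadForm (T.R t) (S.inputOf v t)) fun r => ?_
  have h := hmin (zs + r • T.toVec v)
  rw [C_eq_seqCost, C_eq_seqCost, extend_add, extend_smul, T.extend_toVec_of_support hv] at h
  have hf : ∑ t ∈ Finset.range (T.N + 1), T.f t (S.stateOf (T.extend zs + r • v) t) =
      ∑ t ∈ Finset.range (T.N + 1), T.f t (S.stateOf (T.extend zs) t) +
      r * ∑ t ∈ Finset.range (T.N + 1),
        (S.stateOf (T.extend zs) t - T.θ t) ⬝ᵥ T.Q t *ᵥ S.stateOf v t +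
      r ^ 2 * ∑ t ∈ Finset.range (T.N + 1), 1 / 2 * quadForm (T.Q t) (S.stateOf v t) := by
    rw [Finset.mul_sum, Finset.mul_sum, ← Finset.sum_add_distrib, ← Finset.sum_add_distrib]
    refine Finset.sum_congr rfl fun t ht => ?_
    have hs := hQ t (by have := Finset.mem_range.1 ht; omega)
    rw [f, f, stateOf_add, stateOf_smul, add_sub_right_comm, quadForm_add hs, quadForm_smul,
      Matrix.mulVec_smul, dotProduct_smul, smul_eq_mul]
    ring
  have hg : ∑ t ∈ Finset.range T.N, T.g t (S.inputOf (T.extend zs + r • v) t) =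
      ∑ t ∈ Finset.range T.N, T.g t (S.inputOf (T.extend zs) t) +
      r * ∑ t ∈ Finset.range T.N, S.inputOf (T.extend zs) t ⬝ᵥ T.R t *ᵥ S.inputOf v t +
      r ^ 2 * ∑ t ∈ Finset.range T.N, 1 / 2 * quadForm (T.R t) (S.inputOf v t) := by
    rw [Finset.mul_sum, Finset.mul_sum, ← Finset.sum_add_distrib, ← Finset.sum_add_distrib]
    refine Finset.sum_congr rfl fun t ht => ?_
    have hs := hR t (Finset.mem_range.1 ht)
    rw [g, g, inputOf_add, inputOf_smul, quadForm_add hs, quadForm_smul,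
      Matrix.mulVec_smul, dotProduct_smul, smul_eq_mul]
    ring
  rw [seqCost, seqCost, hf, hg] at h
  linarith

/-- Multiplying a sequence by a slowly varying weight multiplies its states by the weight, up to a
small relative error. -/
lemma vnorm_stateOf_weight_le {w : ℤ → ℝ} {ε : ℝ} (hε : 0 ≤ ε) (hw : ∀ t, 0 < w t)
    (hslow : ∀ s t, |s - t| ≤ ((S.ctrlIndex + 1 : ℕ) : ℤ) → |w s - w t| ≤ ε * w t)
    (z : ℤ → Fin m → ℝ) (t : ℤ) :
    vnorm (S.stateOf (fun s => w s • z s) t - w t • S.stateOf z t) ≤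
      ε * w t * vnorm (S.stateOf z t) := by
  refine vnorm_le_of_abs_le (mul_nonneg hε (hw t).le) fun ⟨i, l⟩ => ?_
  have h1 := p_le_ctrlIndex (S := S) i
  have h2 := l.2
  simp only [stateOf, Pi.sub_apply, Pi.smul_apply, smul_eq_mul]
  rw [← sub_mul, abs_mul]
  exact mul_le_mul_of_nonneg_right (hslow _ _ (by rw [abs_le]; omega)) (abs_nonneg _)

lemma vnorm_inputOf_weight_le {w : ℤ → ℝ} {ε : ℝ} (hε : 0 ≤ ε) (hw : ∀ t, 0 < w t)
    (hslow : ∀ s t, |s - t| ≤ ((S.ctrlIndex + 1 : ℕ) : ℤ) → |w s - w t| ≤ ε * w t)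
    (z : ℤ → Fin m → ℝ) (t : ℤ) :
    vnorm (S.inputOf (fun s => w s • z s) t - w t • S.inputOf z t) ≤
      ε * w t * (vnorm (S.inputOf z t) + 2 * ‖S.AImat‖ * vnorm (S.stateOf z t)) := by
  set e := S.stateOf (fun s => w s • z s) t - w t • S.stateOf z t with he
  have hz : z (t + 1) = S.inputOf z t + S.AImat *ᵥ S.stateOf z t := by
    rw [inputOf, AI_eq_mulVec, sub_add_cancel]
  have hd : S.inputOf (fun s => w s • z s) t - w t • S.inputOf z t =
      (w (t + 1) - w t) • z (t + 1) - S.AImat *ᵥ e := by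
    rw [he, inputOf, inputOf, AI_eq_mulVec, AI_eq_mulVec, Matrix.mulVec_sub, Matrix.mulVec_smul]
    module
  have h1 : vnorm e ≤ _ := vnorm_stateOf_weight_le hε hw hslow z t
  have h2 : |w (t + 1) - w t| ≤ ε * w t := hslow _ _ (by simp)
  have h3 : vnorm (z (t + 1)) ≤ vnorm (S.inputOf z t) + ‖S.AImat‖ * vnorm (S.stateOf z t) := by
    rw [hz]
    exact (vnorm_add_le _ _).trans (add_le_add le_rfl (vnorm_mulVec_le _ _))
  rw [hd]
  calc _ ≤ |w (t + 1) - w t| * vnorm (z (t + 1)) + ‖S.AImat‖ * vnorm e := by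
        rw [← vnorm_smul]
        exact (vnorm_sub_le _ _).trans (add_le_add le_rfl (vnorm_mulVec_le _ _))
    _ ≤ ε * w t * (vnorm (S.inputOf z t) + ‖S.AImat‖ * vnorm (S.stateOf z t)) +
          ‖S.AImat‖ * (ε * w t * vnorm (S.stateOf z t)) := by
        have := vnorm_nonneg (z (t + 1))
        have := mul_nonneg hε (hw t).le
        gcongr
    _ = _ := by ring

variable (S) in
/-- The states of an optimal trajectory are bounded, uniformly in the horizon. The stationarity
condition is tested with the optimal sequence times a weight that decays exponentially, and slowly,
away from the time of interest. -/
lemma exists_optimal_state_bound {a b θbar : ℝ} (ha : 0 < a) (hb : 0 < b) (hθ : 0 ≤ θbar) :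
    ∃ c : ℝ, ∀ T : Tracking S, T.IsBounded a b θbar →
      ∀ zs : EuclideanSpace ℝ (Fin T.N × Fin m), (∀ z, T.C zs ≤ T.C z) →
        ∀ t ≤ T.N, vnorm (S.stateOf (T.extend zs) (t : ℕ)) ≤ c := by
  set α := ‖S.AImat‖ with hα
  have hα0 : 0 ≤ α := norm_nonneg _
  -- `ε` is small enough for the errors below to be absorbed by half of the lower bound `a`
  set ε : ℝ := min 1 (a / (2 * b * (1 + α))) with hεdef
  have hε : 0 < ε := lt_min one_pos (by positivity)
  have hε1 : ε ≤ 1 := min_le_left _ _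
  have hε2 : ε * b * (1 + α) ≤ a / 2 := by
    have h : ε ≤ a / (2 * b * (1 + α)) := min_le_right _ _
    rw [le_div_iff₀ (by positivity)] at h
    linarith
  obtain ⟨W, hW⟩ := exists_weight hε (S.ctrlIndex + 1)
  refine ⟨Real.sqrt (16 * b ^ 2 * θbar ^ 2 / a ^ 2 * W), fun T hT zs hmin t₀ ht₀ => ?_⟩
  obtain ⟨w, hw, hw1, hslow, hsum⟩ := hW (t₀ : ℤ)
  refine Real.le_sqrt_of_sq_le ?_
  set z := T.extend zs with hz
  set v : ℤ → Fin m → ℝ := fun s => w s • z s with hv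
  have hstat := T.stationarity hT.symmQ hT.symmR hmin (v := v) fun s hs => by
    rw [hv]; simp only; rw [hz, T.extend_eq_zero zs hs, smul_zero]
  rw [← hz] at hstat
  set X : ℕ → ℝ := fun t => vnorm (S.stateOf z t) with hX
  have hX0 : ∀ t, 0 ≤ X t := fun t => vnorm_nonneg _
  have hf : ∀ t ∈ Finset.range (T.N + 1),
      w t * ((a - ε * b) * X t ^ 2 - 2 * b * θbar * X t) ≤
        (S.stateOf z t - T.θ t) ⬝ᵥ T.Q t *ᵥ S.stateOf v t := by
    intro t ht
    have htN : t ≤ T.N := by have := Finset.mem_range.1 ht; omega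
    set x := S.stateOf z t with hx
    set e := S.stateOf v t - w t • x with he
    have hen : vnorm e ≤ ε * w t * X t := vnorm_stateOf_weight_le hε.le hw hslow z t
    have hve : S.stateOf v t = w t • x + e := by rw [he]; abel
    have hwt := hw t
    have h1 := hT.lowQ t htN x
    have h2 : |T.θ t ⬝ᵥ T.Q t *ᵥ x| ≤ b * θbar * X t :=
      (abs_dotProduct_mulVec_le _ _ _).trans (by
        have := hT.normQ t htN; have := hT.normθ t htN; have := vnorm_nonneg x
        have := vnorm_nonneg (T.θ t)
        gcongr)
    have h3 : |(x - T.θ t) ⬝ᵥ T.Q t *ᵥ e| ≤ b * (X t + θbar) * (ε * w t * X t) :=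
      (abs_dotProduct_mulVec_le _ _ _).trans (by
        have := hT.normQ t htN
        have := vnorm_nonneg (x - T.θ t)
        have : vnorm (x - T.θ t) ≤ X t + θbar :=
          (vnorm_sub_le _ _).trans (add_le_add le_rfl (hT.normθ t htN))
        have := hX0 t
        have := vnorm_nonneg e
        gcongr)
    have h4 : (x - T.θ t) ⬝ᵥ T.Q t *ᵥ S.stateOf v t = w t * quadForm (T.Q t) x -
        w t * (T.θ t ⬝ᵥ T.Q t *ᵥ x) + (x - T.θ t) ⬝ᵥ T.Q t *ᵥ e := by
      rw [hve, Matrix.mulVec_add, dotProduct_add, Matrix.mulVec_smul, dotProduct_smul,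
        sub_dotProduct, quadForm, smul_eq_mul]
      ring
    rw [h4]
    have h5 := mul_le_mul_of_nonneg_left h1 hwt.le
    have h6 := mul_le_mul_of_nonneg_left ((le_abs_self _).trans h2) hwt.le
    have h7 := (neg_abs_le _).trans' (neg_le_neg h3)
    have h8 : ε * (w t * (b * θbar * X t)) ≤ 1 * (w t * (b * θbar * X t)) := by
      have := hX0 t
      gcongr
    have hXx : vnorm x = X t := rfl
    rw [hXx] at h5
    linarith
  have hg : ∀ t ∈ Finset.range T.N, -(w t * (ε * b * α * X t ^ 2)) ≤
      S.inputOf z t ⬝ᵥ T.R t *ᵥ S.inputOf v t := by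
    intro t ht
    have htN : t < T.N := Finset.mem_range.1 ht
    set u := S.inputOf z t with hu
    set d := S.inputOf v t - w t • u with hd
    have hdn : vnorm d ≤ ε * w t * (vnorm u + 2 * α * X t) :=
      vnorm_inputOf_weight_le hε.le hw hslow z t
    have hve : S.inputOf v t = w t • u + d := by rw [hd]; abel
    have hwt := hw t
    have hun := vnorm_nonneg u
    have h1 := mul_le_mul_of_nonneg_left (hT.lowR t htN u) hwt.le
    have h3 : |u ⬝ᵥ T.R t *ᵥ d| ≤ b * vnorm u * (ε * w t * (vnorm u + 2 * α * X t)) :=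
      (abs_dotProduct_mulVec_le _ _ _).trans (by
        have := hT.normR t htN
        have := vnorm_nonneg d
        gcongr)
    have h4 : u ⬝ᵥ T.R t *ᵥ S.inputOf v t = w t * quadForm (T.R t) u + u ⬝ᵥ T.R t *ᵥ d := by
      rw [hve, Matrix.mulVec_add, dotProduct_add, Matrix.mulVec_smul, dotProduct_smul, quadForm,
        smul_eq_mul]
    rw [h4]
    have h7 := (neg_abs_le _).trans' (neg_le_neg h3)
    have h8 : 0 ≤ w t * (ε * b * α) * (vnorm u - X t) ^ 2 := by positivity
    have h9 : 0 ≤ w t * ((a - ε * b * (1 + α)) * vnorm u ^ 2) :=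
      mul_nonneg hwt.le (mul_nonneg (by linarith) (sq_nonneg _))
    linarith
  have hsum1 := Finset.sum_le_sum hf
  have hsum2 := Finset.sum_le_sum hg
  have hsum3 : ∑ t ∈ Finset.range (T.N + 1), -(w t * (ε * b * α * X t ^ 2)) ≤
      ∑ t ∈ Finset.range T.N, -(w t * (ε * b * α * X t ^ 2)) := by
    rw [Finset.sum_range_succ]
    have := hw T.N
    have : 0 ≤ w T.N * (ε * b * α * X T.N ^ 2) := by positivity
    linarith
  have hsum4 : ∑ t ∈ Finset.range (T.N + 1),
      w t * (a / 4 * X t ^ 2 - 4 * b ^ 2 * θbar ^ 2 / a) ≤ 0 := by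
    refine le_trans ?_ (by linarith : ∑ t ∈ Finset.range (T.N + 1),
      w t * ((a - ε * b) * X t ^ 2 - 2 * b * θbar * X t) +
        ∑ t ∈ Finset.range (T.N + 1), -(w t * (ε * b * α * X t ^ 2)) ≤ 0)
    rw [← Finset.sum_add_distrib]
    refine Finset.sum_le_sum fun t _ => ?_
    rw [← sub_eq_add_neg, ← mul_sub]
    refine mul_le_mul_of_nonneg_left ?_ (hw t).le
    have h1 : 0 ≤ (a / 2 - ε * b * (1 + α)) * X t ^ 2 :=
      mul_nonneg (by linarith) (sq_nonneg _)
    have h2 : a / 4 * X t ^ 2 - 2 * b * θbar * X t + 4 * b ^ 2 * θbar ^ 2 / a =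
        a / 4 * (X t - 4 * b * θbar / a) ^ 2 := by
      field_simp
      ring
    have h3 : 0 ≤ a / 4 * (X t - 4 * b * θbar / a) ^ 2 := by positivity
    linarith
  simp only [mul_sub] at hsum4
  rw [Finset.sum_sub_distrib, ← Finset.sum_mul] at hsum4
  have hpeak : a / 4 * X t₀ ^ 2 ≤ ∑ t ∈ Finset.range (T.N + 1), w t * (a / 4 * X t ^ 2) := by
    have h := Finset.single_le_sum (f := fun t : ℕ => w t * (a / 4 * X t ^ 2))
      (fun t _ => mul_nonneg (hw t).le (by positivity))
      (Finset.mem_range.2 (Nat.lt_succ_of_le ht₀))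
    simpa only [hw1, one_mul] using h
  have hWs := mul_le_mul_of_nonneg_right (hsum (T.N + 1))
    (show 0 ≤ 4 * b ^ 2 * θbar ^ 2 / a by positivity)
  have hfin : a / 4 * X t₀ ^ 2 ≤ W * (4 * b ^ 2 * θbar ^ 2 / a) := by linarith
  have : 16 * b ^ 2 * θbar ^ 2 / a ^ 2 * W = (W * (4 * b ^ 2 * θbar ^ 2 / a)) / (a / 4) := by
    field_simp
    ring
  rw [this, le_div_iff₀ (by positivity)]
  linarith

end Tracking

/-! ### The cost of the steady-state initialization -/

/-- Delaying a nonnegative signal that starts at time `0` does not increase its partial sums. -/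
lemma sum_shift_le {d : ℤ → ℝ} (hd : ∀ t, 0 ≤ d t) (hneg : ∀ t < 0, d t = 0) (n k : ℕ) :
    ∑ t ∈ Finset.range n, d ((t : ℤ) - k) ≤ ∑ t ∈ Finset.range n, d t := by
  induction k with
  | zero => simp
  | succ k ih =>
    refine le_trans ?_ ih
    rcases n with _ | n
    · simp
    · rw [Finset.sum_range_succ', Finset.sum_range_succ]
      rw [hneg _ (by push_cast; omega), add_zero]
      refine le_trans (le_of_eq (Finset.sum_congr rfl fun t _ => ?_))
        (le_add_of_nonneg_right (hd _))
      congr 1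
      push_cast
      ring

lemma quadForm_sub_quadForm {ι : Type*} [Fintype ι] {M : Matrix ι ι ℝ} (hM : M.IsSymm)
    (v w : ι → ℝ) : quadForm M v - quadForm M w = (v - w) ⬝ᵥ M *ᵥ (v + w) := by
  simp only [quadForm, Matrix.mulVec_add, dotProduct_add, sub_dotProduct]
  rw [dotProduct_mulVec_symm hM w v]
  ring

namespace LTISystem

variable {m : ℕ} {S : LTISystem m}

/-- The coordinates of a steady state agree within each block. -/
lemma steadyState_apply (hS : S.IsCanonical) {x : S.Idx → ℝ} {u : Fin m → ℝ}
    (hx : x = S.A *ᵥ x + S.B *ᵥ u) (i : Fin m) (l : Fin (S.p i : ℕ)) :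
    x ⟨i, l⟩ = x (S.last i) := by
  have h : ∀ (k : ℕ) (l : Fin (S.p i : ℕ)), (l : ℕ) + k + 1 = S.p i →
      x ⟨i, l⟩ = x (S.last i) := by
    intro k
    induction k with
    | zero =>
      intro l hl
      have : (⟨i, l⟩ : S.Idx) = S.last i := by
        simp only [last]
        congr 1
        ext
        simp only
        omega
      rw [this]
    | succ k ih =>
      intro l hl
      have h1 := step_apply hS x u i l
      rw [← hx, dif_pos (by omega)] at h1
      rw [h1]
      exact ih _ (by simp only; omega)
  exact h (S.p i - 1 - l) l (by have := l.2; omega)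

lemma steadyState_input (hS : S.IsCanonical) {x : S.Idx → ℝ} {u : Fin m → ℝ}
    (hx : x = S.A *ᵥ x + S.B *ᵥ u) : u = (fun i => x (S.last i)) - S.AImat *ᵥ x := by
  ext i
  have h1 := step_apply hS x u i ⟨(S.p i : ℕ) - 1, Nat.sub_lt (S.p i).pos Nat.one_pos⟩
  have := (S.p i).pos
  rw [← hx, dif_neg (by simp only; omega)] at h1
  simp only [Pi.sub_apply, last]
  rw [h1, AI_eq_mulVec]
  ring

end LTISystem

namespace Tracking

open LTISystem

variable {m : ℕ} {S : LTISystem m} (T : Tracking S)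

/-- The cost of the optimal steady state at time `t`. -/
noncomputable def steadyCost (t : ℕ) : ℝ :=
  S.stageCost (T.Q t) (T.R t) (T.θ t) (S.optSteadyState (T.Q t) (T.R t) (T.θ t)).1
    (S.optSteadyState (T.Q t) (T.R t) (T.θ t)).2

/-- The optimal steady states, extended by `0` to negative times. -/
noncomputable def xeExt (τ : ℤ) : S.Idx → ℝ := if 0 ≤ τ then T.xe τ.toNat else 0

lemma xeExt_natCast (t : ℕ) : T.xeExt t = T.xe t := by simp [xeExt]

/-- The variation of the optimal steady states at time `t`. -/
noncomputable def steadyVar (t : ℤ) : ℝ := vnorm (T.xeExt (t - 1) - T.xeExt t)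

lemma steadyVar_nonneg (t : ℤ) : 0 ≤ T.steadyVar t := vnorm_nonneg _

lemma steadyVar_natCast (t : ℕ) : T.steadyVar t = vnorm (T.xePrev t - T.xe t) := by
  rw [steadyVar, xeExt_natCast]
  rcases t with _ | t
  · simp [xeExt, xePrev]
  · rw [Nat.cast_succ, add_sub_cancel_right, xeExt_natCast, xePrev, if_neg (Nat.succ_ne_zero t),
      Nat.add_sub_cancel]

lemma vnorm_xeExt_sub_le (t : ℤ) (j : ℕ) :
    vnorm (T.xeExt (t - j) - T.xeExt t) ≤ ∑ k ∈ Finset.range j, T.steadyVar (t - k) := by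
  induction j with
  | zero => simp [vnorm_zero]
  | succ j ih =>
    rw [Finset.sum_range_succ]
    have h : T.xeExt (t - (j + 1 : ℕ)) - T.xeExt t =
        (T.xeExt (t - j) - T.xeExt t) + (T.xeExt (t - j - 1) - T.xeExt (t - j)) := by
      rw [show t - ((j + 1 : ℕ) : ℤ) = t - j - 1 by push_cast; ring]
      abel
    rw [h]
    exact (vnorm_add_le _ _).trans (add_le_add ih le_rfl)

section Foss

variable {T} {μf lf μg lg : ℝ}

lemma isOptSteadyState_xe (hS : S.IsCanonical) (hμf : 0 < μf) (hμg : 0 < μg)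
    (hQ : ∀ t < T.N, T.Q t ∈ S.Qset μf lf) (hR : ∀ t < T.N, T.R t ∈ S.Rset μg lg) {t : ℕ}
    (ht : t < T.N) : S.IsOptSteadyState (T.Q t) (T.R t) (T.θ t)
      (S.optSteadyState (T.Q t) (T.R t) (T.θ t)) :=
  isOptSteadyState_optSteadyState hS hμf hμg (hQ t ht) (hR t ht) _

/-- The states of the initialization are past optimal steady states, block by block. -/
lemma stateOf_foss (hS : S.IsCanonical) (hμf : 0 < μf) (hμg : 0 < μg)
    (hQ : ∀ t < T.N, T.Q t ∈ S.Qset μf lf) (hR : ∀ t < T.N, T.R t ∈ S.Rset μg lg) {t : ℕ}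
    (ht : t ≤ T.N) (k : S.Idx) :
    S.stateOf T.foss t k = T.xeExt ((t : ℤ) - ((S.p k.1 : ℕ) - (k.2 : ℕ) : ℕ)) k := by
  obtain ⟨i, l⟩ := k
  have hl := l.2
  simp only [stateOf, foss, xeExt]
  have hidx : (t : ℤ) - ((S.p i : ℕ) : ℤ) + 1 + (l : ℕ) - 1 =
      (t : ℤ) - (((S.p i : ℕ) - (l : ℕ) : ℕ) : ℤ) := by omega
  by_cases h : 0 ≤ (t : ℤ) - (((S.p i : ℕ) - (l : ℕ) : ℕ) : ℤ)
  · rw [if_pos h, if_pos (by omega), hidx]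
    have hlt : ((t : ℤ) - (((S.p i : ℕ) - (l : ℕ) : ℕ) : ℤ)).toNat < T.N := by omega
    have hst := (isOptSteadyState_xe hS hμf hμg hQ hR hlt).1
    rw [xe, if_pos hlt]
    exact (steadyState_apply hS hst i l).symm
  · rw [if_neg h, if_neg (by omega), Pi.zero_apply]

lemma vnorm_stateOf_foss_sub_le (hS : S.IsCanonical) (hμf : 0 < μf) (hμg : 0 < μg)
    (hQ : ∀ t < T.N, T.Q t ∈ S.Qset μf lf) (hR : ∀ t < T.N, T.R t ∈ S.Rset μg lg) {t : ℕ}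
    (ht : t ≤ T.N) : vnorm (S.stateOf T.foss t - T.xe t) ≤
      Fintype.card S.Idx * ∑ k ∈ Finset.range S.ctrlIndex, T.steadyVar ((t : ℤ) - k) := by
  refine (vnorm_le_sum_abs _).trans ?_
  rw [← nsmul_eq_mul]
  refine Finset.sum_le_card_nsmul _ _ _ fun k _ => ?_
  rw [Pi.sub_apply, stateOf_foss hS hμf hμg hQ hR ht, ← xeExt_natCast, ← Pi.sub_apply]
  refine (abs_apply_le_vnorm _ k).trans ((T.vnorm_xeExt_sub_le _ _).trans ?_)
  refine Finset.sum_le_sum_of_subset_of_nonneg (Finset.range_subset_range.2 ?_)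
    fun _ _ _ => T.steadyVar_nonneg _
  have := p_le_ctrlIndex (S := S) k.1
  omega

lemma sum_vnorm_stateOf_foss_sub_le (hS : S.IsCanonical) (hμf : 0 < μf) (hμg : 0 < μg)
    (hQ : ∀ t < T.N, T.Q t ∈ S.Qset μf lf) (hR : ∀ t < T.N, T.R t ∈ S.Rset μg lg) :
    ∑ t ∈ Finset.range (T.N + 1), vnorm (S.stateOf T.foss (t : ℕ) - T.xe t) ≤
      Fintype.card S.Idx * S.ctrlIndex *
        ∑ t ∈ Finset.range (T.N + 1), vnorm (T.xePrev t - T.xe t) := by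
  calc _ ≤ ∑ t ∈ Finset.range (T.N + 1), Fintype.card S.Idx *
        ∑ k ∈ Finset.range S.ctrlIndex, T.steadyVar ((t : ℤ) - k) :=
        Finset.sum_le_sum fun t ht => vnorm_stateOf_foss_sub_le hS hμf hμg hQ hR
          (by have := Finset.mem_range.1 ht; omega)
    _ = Fintype.card S.Idx * ∑ k ∈ Finset.range S.ctrlIndex,
          ∑ t ∈ Finset.range (T.N + 1), T.steadyVar ((t : ℤ) - k) := by
        rw [← Finset.mul_sum, Finset.sum_comm]
    _ ≤ Fintype.card S.Idx * (S.ctrlIndex *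
          ∑ t ∈ Finset.range (T.N + 1), T.steadyVar t) := by
        refine mul_le_mul_of_nonneg_left ?_ (Nat.cast_nonneg _)
        refine (Finset.sum_le_card_nsmul _ _ (∑ t ∈ Finset.range (T.N + 1), T.steadyVar t)
          fun k _ => sum_shift_le T.steadyVar_nonneg (fun t ht => ?_) _ _).trans ?_
        · rw [steadyVar, xeExt, xeExt, if_neg (by omega), if_neg (by omega), sub_zero, vnorm_zero]
        · rw [nsmul_eq_mul, Finset.card_range]
    _ = _ := by simp only [steadyVar_natCast, mul_assoc]

variable {a b θbar : ℝ}

/-- The optimal steady state costs at most as much as the origin, hence is bounded. -/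
lemma vnorm_optSteadyState_le (hS : S.IsCanonical) (hμf : 0 < μf) (hμg : 0 < μg)
    (hQ : ∀ t < T.N, T.Q t ∈ S.Qset μf lf) (hR : ∀ t < T.N, T.R t ∈ S.Rset μg lg)
    (ha : 0 < a) (hT : T.IsBounded a b θbar) {t : ℕ} (ht : t < T.N) :
    vnorm ((S.optSteadyState (T.Q t) (T.R t) (T.θ t)).1 - T.θ t) ≤ Real.sqrt (b / a) * θbar ∧
      vnorm (S.optSteadyState (T.Q t) (T.R t) (T.θ t)).2 ≤ Real.sqrt (b / a) * θbar := by
  have h := (isOptSteadyState_xe hS hμf hμg hQ hR ht).2 0 0 (by simp)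
  simp only [stageCost, zero_sub, quadForm_zero, mul_zero, add_zero] at h
  have h1 := hT.lowQ t ht.le ((S.optSteadyState (T.Q t) (T.R t) (T.θ t)).1 - T.θ t)
  have h2 := hT.lowR t ht (S.optSteadyState (T.Q t) (T.R t) (T.θ t)).2
  have hb : 0 ≤ b := (norm_nonneg _).trans (hT.normQ t ht.le)
  have hθ : 0 ≤ θbar := (vnorm_nonneg _).trans (hT.normθ t ht.le)
  have h3 : quadForm (T.Q t) (-T.θ t) ≤ b * θbar ^ 2 := by
    refine (le_abs_self _).trans ((abs_quadForm_le _ _).trans ?_)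
    rw [vnorm_neg]
    have := hT.normQ t ht.le
    have := hT.normθ t ht.le
    have := vnorm_nonneg (T.θ t)
    gcongr
  have hsq : (Real.sqrt (b / a) * θbar) ^ 2 = b * θbar ^ 2 / a := by
    rw [mul_pow, Real.sq_sqrt (by positivity)]; ring
  have h4 : 0 ≤ a * vnorm ((S.optSteadyState (T.Q t) (T.R t) (T.θ t)).1 - T.θ t) ^ 2 := by
    positivity
  have h5 : 0 ≤ a * vnorm (S.optSteadyState (T.Q t) (T.R t) (T.θ t)).2 ^ 2 := by positivity
  constructor
  · refine (abs_le_of_sq_le_sq' ?_ (by positivity)).2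
    rw [hsq, le_div_iff₀ ha]
    linarith
  · refine (abs_le_of_sq_le_sq' ?_ (by positivity)).2
    rw [hsq, le_div_iff₀ ha]
    linarith

lemma vnorm_xe_le (hS : S.IsCanonical) (hμf : 0 < μf) (hμg : 0 < μg)
    (hQ : ∀ t < T.N, T.Q t ∈ S.Qset μf lf) (hR : ∀ t < T.N, T.R t ∈ S.Rset μg lg)
    (ha : 0 < a) (hT : T.IsBounded a b θbar) {t : ℕ} (ht : t ≤ T.N) :
    vnorm (T.xe t) ≤ (Real.sqrt (b / a) + 1) * θbar := by
  have hθ : 0 ≤ θbar := (vnorm_nonneg _).trans (hT.normθ t ht)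
  have hs : 0 ≤ Real.sqrt (b / a) * θbar := by positivity
  rw [xe]
  split_ifs with h
  · have h1 := (vnorm_optSteadyState_le hS hμf hμg hQ hR ha hT h).1
    have h2 := hT.normθ t ht
    have h3 := vnorm_add_le ((S.optSteadyState (T.Q t) (T.R t) (T.θ t)).1 - T.θ t) (T.θ t)
    rw [sub_add_cancel] at h3
    linarith
  · have := hT.normθ T.N le_rfl
    linarith

lemma vnorm_stateOf_foss_le (hS : S.IsCanonical) (hμf : 0 < μf) (hμg : 0 < μg)
    (hQ : ∀ t < T.N, T.Q t ∈ S.Qset μf lf) (hR : ∀ t < T.N, T.R t ∈ S.Rset μg lg)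
    (ha : 0 < a) (hT : T.IsBounded a b θbar) {t : ℕ} (ht : t ≤ T.N) :
    vnorm (S.stateOf T.foss t) ≤ Fintype.card S.Idx * ((Real.sqrt (b / a) + 1) * θbar) := by
  refine (vnorm_le_sum_abs _).trans ?_
  rw [← nsmul_eq_mul]
  refine Finset.sum_le_card_nsmul _ _ _ fun k _ => ?_
  have hθ : 0 ≤ θbar := (vnorm_nonneg _).trans (hT.normθ t ht)
  rw [stateOf_foss hS hμf hμg hQ hR ht, xeExt]
  split_ifs with h
  · exact (abs_apply_le_vnorm _ k).trans (vnorm_xe_le hS hμf hμg hQ hR ha hT (by omega))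
  · rw [Pi.zero_apply, abs_zero]
    positivity

variable (S) in
/-- The cost of the initialization exceeds the optimal steady costs by at most a multiple of the
variation of the optimal steady states. -/
lemma exists_foss_cost_le (hS : S.IsCanonical) (hμf : 0 < μf) (hμg : 0 < μg)
    (ha : 0 < a) (hb : 0 < b) (hθ : 0 ≤ θbar) :
    ∃ c : ℝ, 0 ≤ c ∧ ∀ T : Tracking S, (∀ t < T.N, T.Q t ∈ S.Qset μf lf) →
      (∀ t < T.N, T.R t ∈ S.Rset μg lg) → T.IsBounded a b θbar →
      T.C (T.toVec T.foss) ≤ ∑ t ∈ Finset.range T.N, T.steadyCost t +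
        c * ∑ t ∈ Finset.range (T.N + 1), vnorm (T.xePrev t - T.xe t) := by
  set ce : ℝ := (Real.sqrt (b / a) + 1) * θbar with hce
  set n : ℝ := (Fintype.card S.Idx : ℝ) with hn
  set α := ‖S.AImat‖ with hα
  have hn0 : 0 ≤ n := Nat.cast_nonneg _
  have hα0 : 0 ≤ α := norm_nonneg _
  have hce0 : 0 ≤ ce := by positivity
  set cf : ℝ := 1 / 2 * (b * (n * ce + ce + 2 * θbar)) with hcf
  set cg : ℝ := 1 / 2 * (b * α * (α * (n * ce + ce) + 2 * ce)) with hcg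
  have hcf0 : 0 ≤ cf := by positivity
  have hcg0 : 0 ≤ cg := by positivity
  refine ⟨(cf + cg) * (n * S.ctrlIndex), by positivity, fun T hQ hR hT => ?_⟩
  set x : ℕ → S.Idx → ℝ := fun t => S.stateOf T.foss t with hx
  have hxn : ∀ t ≤ T.N, vnorm (x t) ≤ n * ce := fun t ht =>
    vnorm_stateOf_foss_le hS hμf hμg hQ hR ha hT ht
  have hen : ∀ t ≤ T.N, vnorm (T.xe t) ≤ ce := fun t ht =>
    vnorm_xe_le hS hμf hμg hQ hR ha hT ht
  have hf : ∀ t ≤ T.N, T.f t (x t) ≤ T.f t (T.xe t) + cf * vnorm (x t - T.xe t) := by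
    intro t ht
    have h1 := quadForm_sub_quadForm (hT.symmQ t ht) (x t - T.θ t) (T.xe t - T.θ t)
    rw [show x t - T.θ t - (T.xe t - T.θ t) = x t - T.xe t by abel] at h1
    have h2 : vnorm (x t - T.θ t + (T.xe t - T.θ t)) ≤ n * ce + ce + 2 * θbar := by
      have := vnorm_add_le (x t - T.θ t) (T.xe t - T.θ t)
      have := vnorm_sub_le (x t) (T.θ t)
      have := vnorm_sub_le (T.xe t) (T.θ t)
      linarith [hxn t ht, hen t ht, hT.normθ t ht]
    have h3 := (le_abs_self _).trans
      (abs_dotProduct_mulVec_le (T.Q t) (x t - T.xe t) (x t - T.θ t + (T.xe t - T.θ t)))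
    have h4 : ‖T.Q t‖ * vnorm (x t - T.xe t) * vnorm (x t - T.θ t + (T.xe t - T.θ t)) ≤
        b * vnorm (x t - T.xe t) * (n * ce + ce + 2 * θbar) := by
      have := hT.normQ t ht
      have := vnorm_nonneg (x t - T.xe t)
      have := vnorm_nonneg (x t - T.θ t + (T.xe t - T.θ t))
      gcongr
    rw [f, f, hcf]
    linarith
  have hg : ∀ t < T.N, T.g t (S.inputOf T.foss t) ≤
      T.g t (S.optSteadyState (T.Q t) (T.R t) (T.θ t)).2 + cg * vnorm (x t - T.xe t) := by
    intro t ht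
    set ue := (S.optSteadyState (T.Q t) (T.R t) (T.θ t)).2 with hue
    set u := S.inputOf T.foss t with hu
    have hxe : T.xe t = (S.optSteadyState (T.Q t) (T.R t) (T.θ t)).1 := by rw [xe, if_pos ht]
    have hst := (isOptSteadyState_xe hS hμf hμg hQ hR ht).1
    have huu : u - ue = -(S.AImat *ᵥ (x t - T.xe t)) := by
      have h1 : ue = (fun i => T.xe t (S.last i)) - S.AImat *ᵥ T.xe t := by
        rw [hxe]; exact steadyState_input hS hst
      have h2 : u = (fun i => T.xe t (S.last i)) - S.AImat *ᵥ x t := by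
        rw [hu, inputOf, AI_eq_mulVec]
        congr 1
        ext i
        rw [foss, if_pos (by omega)]
        congr 1
        simp
      rw [h1, h2, Matrix.mulVec_sub]
      abel
    have hd : vnorm (u - ue) ≤ α * vnorm (x t - T.xe t) := by
      rw [huu, vnorm_neg]; exact vnorm_mulVec_le _ _
    have hun : vnorm ue ≤ ce := by
      have h1 := (vnorm_optSteadyState_le hS hμf hμg hQ hR ha hT ht).2
      refine h1.trans ?_
      rw [hce]; linarith
    have hs : vnorm (u + ue) ≤ α * (n * ce + ce) + 2 * ce := by
      have h1 : u + ue = (u - ue) + (ue + ue) := by abel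
      rw [h1]
      have h2 := vnorm_add_le (u - ue) (ue + ue)
      have h3 := vnorm_add_le ue ue
      have h4 := vnorm_sub_le (x t) (T.xe t)
      have h5 : α * vnorm (x t - T.xe t) ≤ α * (n * ce + ce) :=
        mul_le_mul_of_nonneg_left (by linarith [hxn t ht.le, hen t ht.le]) hα0
      linarith
    have h1 := quadForm_sub_quadForm (hT.symmR t ht) u ue
    have h3 := (le_abs_self _).trans (abs_dotProduct_mulVec_le (T.R t) (u - ue) (u + ue))
    have h4 : ‖T.R t‖ * vnorm (u - ue) * vnorm (u + ue) ≤
        b * (α * vnorm (x t - T.xe t)) * (α * (n * ce + ce) + 2 * ce) := by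
      have := hT.normR t ht
      have := vnorm_nonneg (x t - T.xe t)
      have := vnorm_nonneg (u - ue)
      have := vnorm_nonneg (u + ue)
      gcongr
    rw [g, g, hcg]
    linarith
  have hcost : T.C (T.toVec T.foss) ≤ ∑ t ∈ Finset.range T.N, T.steadyCost t +
      (cf + cg) * ∑ t ∈ Finset.range (T.N + 1), vnorm (x t - T.xe t) := by
    rw [T.C_toVec (z := T.foss) fun s hs => T.foss_support (by omega), seqCost]
    have h1 : ∑ t ∈ Finset.range (T.N + 1), T.f t (S.stateOf T.foss t) ≤
        ∑ t ∈ Finset.range (T.N + 1), (T.f t (T.xe t) + cf * vnorm (x t - T.xe t)) :=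
      Finset.sum_le_sum fun t ht => hf t (by have := Finset.mem_range.1 ht; omega)
    have h2 : ∑ t ∈ Finset.range T.N, T.g t (S.inputOf T.foss t) ≤
        ∑ t ∈ Finset.range T.N, (T.g t (S.optSteadyState (T.Q t) (T.R t) (T.θ t)).2 +
          cg * vnorm (x t - T.xe t)) :=
      Finset.sum_le_sum fun t ht => hg t (Finset.mem_range.1 ht)
    have h3 : T.f T.N (T.xe T.N) = 0 := by
      rw [xe, if_neg (lt_irrefl _), f, sub_self, quadForm_zero, mul_zero]
    have h4 : ∑ t ∈ Finset.range T.N, T.steadyCost t = ∑ t ∈ Finset.range T.N, T.f t (T.xe t) +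
        ∑ t ∈ Finset.range T.N, T.g t (S.optSteadyState (T.Q t) (T.R t) (T.θ t)).2 := by
      rw [← Finset.sum_add_distrib]
      refine Finset.sum_congr rfl fun t ht => ?_
      rw [xe, if_pos (Finset.mem_range.1 ht)]
      rfl
    rw [Finset.sum_add_distrib, Finset.sum_range_succ (fun t => T.f t (T.xe t)) T.N, h3,
      ← Finset.mul_sum] at h1
    rw [Finset.sum_add_distrib, ← Finset.mul_sum] at h2
    have h5 : cg * ∑ t ∈ Finset.range T.N, vnorm (x t - T.xe t) ≤
        cg * ∑ t ∈ Finset.range (T.N + 1), vnorm (x t - T.xe t) := by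
      refine mul_le_mul_of_nonneg_left ?_ hcg0
      rw [Finset.sum_range_succ]
      linarith [vnorm_nonneg (x T.N - T.xe T.N)]
    linarith
  have hsum := mul_le_mul_of_nonneg_left
    (sum_vnorm_stateOf_foss_sub_le hS hμf hμg hQ hR) (add_nonneg hcf0 hcg0)
  refine hcost.trans (add_le_add le_rfl (hsum.trans (le_of_eq ?_)))
  ring

end Foss

end Tracking

/-! ### A lower bound for the optimal cost -/

/-- Summation by parts along a trajectory for a time-varying function. -/
lemma sum_sub_succ_add_eq {α : Type*} (h : ℕ → α → ℝ) (x : ℕ → α) (n : ℕ) :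
    ∑ t ∈ Finset.range n, (h t (x t) - h t (x (t + 1))) + h n (x n) =
      h 0 (x 0) + ∑ t ∈ Finset.Icc 1 n, (h t (x t) - h (t - 1) (x t)) := by
  induction n with
  | zero => simp
  | succ n ih =>
    rw [Finset.sum_range_succ, Finset.sum_Icc_succ_top (by omega), Nat.add_sub_cancel]
    linarith

/-- The difference of the quadratic functions `½ (x - β)ᵀ P (x - β)` in terms of their data. -/
lemma abs_half_quadForm_sub_le {ι : Type*} [Fintype ι] [DecidableEq ι] {P P' : Matrix ι ι ℝ}
    (hP' : P'.IsSymm) {b r : ℝ} (hb : ‖P'‖ ≤ b) {x β β' : ι → ℝ} (h1 : vnorm (x - β) ≤ r)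
    (h2 : vnorm (x - β') ≤ r) :
    |1 / 2 * quadForm P (x - β) - 1 / 2 * quadForm P' (x - β')| ≤
      (r ^ 2 + b * r) * (‖P - P'‖ + vnorm (β - β')) := by
  have hr : 0 ≤ r := (vnorm_nonneg _).trans h1
  have hb0 : 0 ≤ b := (norm_nonneg _).trans hb
  have e1 : quadForm P (x - β) - quadForm P' (x - β') =
      quadForm (P - P') (x - β) + (β' - β) ⬝ᵥ P' *ᵥ ((x - β) + (x - β')) := by
    have h := quadForm_sub_quadForm hP' (x - β) (x - β')
    rw [show x - β - (x - β') = β' - β by abel] at h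
    rw [← h]
    simp only [quadForm, Matrix.sub_mulVec, dotProduct_sub]
    ring
  have e2 : |quadForm (P - P') (x - β)| ≤ ‖P - P'‖ * r ^ 2 := by
    refine (abs_quadForm_le _ _).trans ?_
    have := vnorm_nonneg (x - β)
    gcongr
  have e3 : |(β' - β) ⬝ᵥ P' *ᵥ ((x - β) + (x - β'))| ≤ b * vnorm (β - β') * (r + r) := by
    refine (abs_dotProduct_mulVec_le _ _ _).trans ?_
    rw [vnorm_sub_comm β' β]
    have h3 : vnorm ((x - β) + (x - β')) ≤ r + r :=
      (vnorm_add_le _ _).trans (add_le_add h1 h2)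
    have := vnorm_nonneg (β - β')
    have := vnorm_nonneg ((x - β) + (x - β'))
    gcongr
  rw [← mul_sub, e1, abs_mul, abs_of_pos (by norm_num : (0 : ℝ) < 1 / 2)]
  have e4 := abs_add_le (quadForm (P - P') (x - β))
    ((β' - β) ⬝ᵥ P' *ᵥ ((x - β) + (x - β')))
  have e5 : 0 ≤ ‖P - P'‖ * r ^ 2 := by positivity
  have e6 : 0 ≤ ‖P - P'‖ * (b * r) := by positivity
  have e7 : 0 ≤ r ^ 2 * vnorm (β - β') := mul_nonneg (by positivity) (vnorm_nonneg _)
  linarith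

namespace Tracking

open LTISystem

variable {m : ℕ} {S : LTISystem m} {μf lf μg lg : ℝ}

lemma smul_one_mem_Qset {q : ℝ} : q • (1 : Matrix S.Idx S.Idx ℝ) ∈ S.Qset q q :=
  ⟨le_rfl, le_rfl⟩

lemma smul_one_mem_Rset {r : ℝ} : r • (1 : Matrix (Fin m) (Fin m) ℝ) ∈ S.Rset r r :=
  ⟨le_rfl, le_rfl⟩

/-- The terminal weights in `𝒫` satisfy the same bounds as the solutions of the Riccati
equation. -/
lemma mem_Pset_bounds (hS : S.IsCanonical) (hμf : 0 < μf) (hμg : 0 < μg) (hlf : 0 < lf)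
    (hlg : 0 < lg) {P : Matrix S.Idx S.Idx ℝ} (hP : P ∈ S.Pset μf lf μg lg) :
    P.IsSymm ∧ (∀ x, μf * vnorm x ^ 2 ≤ quadForm P x) ∧ ‖P‖ ≤ S.riccatiBound lf lg := by
  have hs : P.IsSymm := isSymm_of_le
    (isSymm_Pe hS hμf hμg smul_one_mem_Qset smul_one_mem_Rset) hP.1
  have hlow : ∀ x, μf * vnorm x ^ 2 ≤ quadForm P x := fun x =>
    (mul_vnorm_sq_le_quadForm_Pe hS hμf hμg smul_one_mem_Qset smul_one_mem_Rset x).trans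
      (quadForm_le_of_le hP.1 x)
  refine ⟨hs, hlow, opNorm_le_of_quadForm_le hs (fun x => le_trans (by positivity) (hlow x))
    (riccatiBound_nonneg hlf.le hlg.le) fun x => (quadForm_le_of_le hP.2 x).trans ?_⟩
  exact quadForm_Pe_le hS hlf hlg hlf hlg smul_one_mem_Qset smul_one_mem_Rset x

lemma isBounded_of_mem (hS : S.IsCanonical) (hμf : 0 < μf) (hμg : 0 < μg) (hlf : 0 < lf)
    (hlg : 0 < lg) {T : Tracking S} (hQ : ∀ t < T.N, T.Q t ∈ S.Qset μf lf)
    (hR : ∀ t < T.N, T.R t ∈ S.Rset μg lg) (hQN : T.Q T.N ∈ S.Pset μf lf μg lg) {θbar : ℝ}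
    (hθ : ∀ t ≤ T.N, vnorm (T.θ t) ≤ θbar) :
    T.IsBounded (min μf μg) (max (max lf lg) (S.riccatiBound lf lg)) θbar := by
  obtain ⟨hN1, hN2, hN3⟩ := mem_Pset_bounds hS hμf hμg hlf hlg hQN
  have hcase : ∀ t ≤ T.N, t < T.N ∨ t = T.N := fun t ht => ht.lt_or_eq
  refine ⟨fun t ht => ?_, fun t ht x => ?_, fun t ht => ?_,
    fun t ht => isSymm_of_smul_one_le (hR t ht).1, fun t ht u => ?_, fun t ht => ?_, hθ⟩
  · rcases hcase t ht with h | rfl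
    · exact isSymm_of_smul_one_le (hQ t h).1
    · exact hN1
  · refine (mul_le_mul_of_nonneg_right (min_le_left μf μg) (sq_nonneg _)).trans ?_
    rcases hcase t ht with h | rfl
    · exact mul_vnorm_sq_le_quadForm (hQ t h).1 x
    · exact hN2 x
  · rcases hcase t ht with h | rfl
    · refine le_trans ?_ ((le_max_left lf lg).trans (le_max_left _ _))
      exact opNorm_le_of_quadForm_le (isSymm_of_smul_one_le (hQ t h).1)
        (fun x => le_trans (by positivity) (mul_vnorm_sq_le_quadForm (hQ t h).1 x)) hlf.le
        (quadForm_le_mul_vnorm_sq (hQ t h).2)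
    · exact hN3.trans (le_max_right _ _)
  · exact (mul_le_mul_of_nonneg_right (min_le_right μf μg) (sq_nonneg _)).trans
      (mul_vnorm_sq_le_quadForm (hR t ht).1 u)
  · refine le_trans ?_ ((le_max_right lf lg).trans (le_max_left _ _))
    exact opNorm_le_of_quadForm_le (isSymm_of_smul_one_le (hR t ht).1)
      (fun x => le_trans (by positivity) (mul_vnorm_sq_le_quadForm (hR t ht).1 x)) hlg.le
      (quadForm_le_mul_vnorm_sq (hR t ht).2)

/-- The function `½ (x - βᵉ)ᵀ Pᵉ (x - βᵉ)` at time `t`; for `t = N` it is the terminal cost. -/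
noncomputable def bias (T : Tracking S) (t : ℕ) (x : S.Idx → ℝ) : ℝ :=
  1 / 2 * quadForm (T.Pe t) (x - T.βe t)

variable (S) in
/-- The optimal cost is at least the sum of the optimal steady costs, up to a multiple of the
variation of the data of the Bellman equations. -/
lemma exists_steadyCost_le (hS : S.IsCanonical) (hμf : 0 < μf) (hμg : 0 < μg) (hlf : 0 < lf)
    (hlg : 0 < lg) {θbar : ℝ} (hθ : 0 ≤ θbar) :
    ∃ c : ℝ, 0 ≤ c ∧ ∀ T : Tracking S, (∀ t < T.N, T.Q t ∈ S.Qset μf lf) →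
      (∀ t < T.N, T.R t ∈ S.Rset μg lg) → T.Q T.N ∈ S.Pset μf lf μg lg →
      (∀ t ≤ T.N, vnorm (T.θ t) ≤ θbar) →
      ∀ zs : EuclideanSpace ℝ (Fin T.N × Fin m), (∀ z, T.C zs ≤ T.C z) →
        ∑ t ∈ Finset.range T.N, T.steadyCost t ≤ T.C zs +
          c * ∑ t ∈ Finset.Icc 1 T.N,
            (‖T.Pe t - T.Pe (t - 1)‖ + vnorm (T.βe t - T.βe (t - 1))) := by
  set a := min μf μg with ha
  set b := max (max lf lg) (S.riccatiBound lf lg) with hb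
  have ha0 : 0 < a := lt_min hμf hμg
  have hb0 : 0 < b := lt_max_of_lt_left (lt_max_of_lt_left hlf)
  obtain ⟨cx, hcx⟩ := exists_optimal_state_bound S ha0 hb0 hθ
  have hrb := riccatiBound_nonneg (S := S) hlf.le hlg.le
  set cβ : ℝ := (1 / μf * (2 * S.riccatiBound lf lg / μf) * lf + 1) * θbar with hcβ
  set r : ℝ := max cx 0 + cβ with hr
  have hcβ0 : 0 ≤ cβ := by positivity
  have hr0 : 0 ≤ r := add_nonneg (le_max_right _ _) hcβ0
  refine ⟨r ^ 2 + b * r, by positivity, fun T hQ hR hQN hθT zs hmin => ?_⟩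
  have hT : T.IsBounded a b θbar := isBounded_of_mem hS hμf hμg hlf hlg hQ hR hQN hθT
  set z := T.extend zs with hz
  set x : ℕ → S.Idx → ℝ := fun t => S.stateOf z t with hx
  have hxn : ∀ t ≤ T.N, vnorm (x t) ≤ cx := fun t ht => hcx T hT zs hmin t ht
  have hPs : ∀ t ≤ T.N, (T.Pe t).IsSymm := by
    intro t ht
    rw [Pe]
    split_ifs with h
    · exact isSymm_Pe hS hμf hμg (hQ t h) (hR t h)
    · exact hT.symmQ T.N le_rfl
  have hPn : ∀ t ≤ T.N, ‖T.Pe t‖ ≤ b := by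
    intro t ht
    rw [Pe]
    split_ifs with h
    · exact (norm_Pe_le hS hμf hμg hlf hlg (hQ t h) (hR t h)).trans (le_max_right _ _)
    · exact hT.normQ T.N le_rfl
  have hβn : ∀ t ≤ T.N, vnorm (T.βe t) ≤ cβ := by
    intro t ht
    have h0 : 0 ≤ 1 / μf * (2 * S.riccatiBound lf lg / μf) * lf := by positivity
    rw [βe]
    split_ifs with h
    · refine (vnorm_F_mulVec_le hS hμf hμg hlf hlg (hQ t h) (hR t h) _).trans ?_
      have := mul_le_mul_of_nonneg_left (hθT t ht) h0
      rw [hcβ]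
      linarith
    · have := hθT T.N le_rfl
      have := mul_nonneg h0 hθ
      rw [hcβ]
      linarith
  have hxβ : ∀ s ≤ T.N, ∀ t ≤ T.N, vnorm (x s - T.βe t) ≤ r := by
    intro s hs t ht
    exact (vnorm_sub_le _ _).trans
      (add_le_add ((hxn s hs).trans (le_max_left _ _)) (hβn t ht))
  have hbell : ∀ t ∈ Finset.range T.N, T.steadyCost t + (T.bias t (x t) - T.bias t (x (t + 1))) ≤
      T.f t (x t) + T.g t (S.inputOf z t) := by
    intro t ht
    have htN := Finset.mem_range.1 ht
    have h := bellman_le hS hμf hμg (hQ t htN) (hR t htN) (T.θ t) (x t) (S.inputOf z t)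
    have hnext : S.A *ᵥ x t + S.B *ᵥ S.inputOf z t = x (t + 1) := by
      simp only [hx, Nat.cast_succ]
      exact (stateOf_succ hS z t).symm
    rw [hnext] at h
    simp only [bias, Pe, βe, if_pos htN]
    change T.steadyCost t + _ ≤ T.f t (x t) + T.g t (S.inputOf z t) + _ at h
    linarith
  have hsum := Finset.sum_le_sum hbell
  rw [Finset.sum_add_distrib] at hsum
  have hterm : T.f T.N (x T.N) = T.bias T.N (x T.N) := by
    simp only [bias, Pe, βe, if_neg (lt_irrefl T.N), f]
  have hC : T.C zs = ∑ t ∈ Finset.range T.N, (T.f t (x t) + T.g t (S.inputOf z t)) +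
      T.bias T.N (x T.N) := by
    rw [C_eq_seqCost, seqCost, Finset.sum_range_succ, Finset.sum_add_distrib, ← hz, ← hterm]
    ring
  have hparts := sum_sub_succ_add_eq T.bias x T.N
  have h0 : 0 ≤ T.bias 0 (x 0) := by
    have hpos : 0 ≤ quadForm (T.Pe 0) (x 0 - T.βe 0) := by
      rw [Pe]
      split_ifs with h
      · exact quadForm_Pe_nonneg hS hμf hμg (hQ 0 h) (hR 0 h) _
      · exact le_trans (by positivity) (hT.lowQ T.N le_rfl _)
    rw [bias]
    linarith
  have hvar : -((r ^ 2 + b * r) * ∑ t ∈ Finset.Icc 1 T.N,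
      (‖T.Pe t - T.Pe (t - 1)‖ + vnorm (T.βe t - T.βe (t - 1)))) ≤
      ∑ t ∈ Finset.Icc 1 T.N, (T.bias t (x t) - T.bias (t - 1) (x t)) := by
    rw [Finset.mul_sum, ← Finset.sum_neg_distrib]
    refine Finset.sum_le_sum fun t ht => ?_
    have ht2 := (Finset.mem_Icc.1 ht).2
    exact (abs_le.1 (abs_half_quadForm_sub_le (hPs (t - 1) (by omega)) (hPn (t - 1) (by omega))
      (hxβ t ht2 t ht2) (hxβ t ht2 (t - 1) (by omega)))).1
  linarith

end Tracking

end LQT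

theorem mainTheorem5 {m : ℕ} (hm : 1 ≤ m) (S : LQT.LTISystem m) (hS : S.IsCanonical)
    (μf lf μg lg θbar : ℝ) (hμf : 0 < μf) (hlf : 0 < lf) (hμg : 0 < μg) (hlg : 0 < lg) :
    ∃ c : ℝ, 0 < c ∧ ∀ T : LQT.Tracking S, 1 ≤ T.N →
      (∀ t < T.N, T.Q t ∈ S.Qset μf lf) →
      (∀ t < T.N, T.R t ∈ S.Rset μg lg) →
      T.Q T.N ∈ S.Pset μf lf μg lg →
      (∀ t ≤ T.N, LQT.vnorm (T.θ t) ≤ θbar) →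
      ∀ μc lc : ℝ, 0 < μc → 0 < lc → T.HasModuli μc lc →
      ∀ W : ℕ, 1 ≤ W →
        T.regret (LQT.tmSteps μc lc) W ≤
          c * ((lc / μc) ^ 2 *
            ((Real.sqrt (lc / μc) - 1) / Real.sqrt (lc / μc)) ^ (2 * S.iterations W) *
            (∑ t ∈ Finset.Icc 1 T.N,
                (‖T.Pe t - T.Pe (t - 1)‖ + LQT.vnorm (T.βe t - T.βe (t - 1))) +
              ∑ t ∈ Finset.range (T.N + 1), LQT.vnorm (T.xePrev t - T.xe t))) := by
  -- `θbar` may be negative, in which case no problem satisfies the hypotheses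
  have hθ : 0 ≤ max θbar 0 := le_max_right _ _
  have hb : 0 < max (max lf lg) (S.riccatiBound lf lg) :=
    lt_max_of_lt_left (lt_max_of_lt_left hlf)
  obtain ⟨c₁, hc₁, h₁⟩ := LQT.Tracking.exists_steadyCost_le S hS hμf hμg hlf hlg hθ
  obtain ⟨c₂, hc₂, h₂⟩ := LQT.Tracking.exists_foss_cost_le S (lf := lf) (lg := lg) hS hμf hμg
    (lt_min hμf hμg) hb hθ
  refine ⟨3 / 2 * (c₁ + c₂) + 1, by positivity,
    fun T hN hQ hR hQN hθT μc lc hμc hlc hmod W _ => ?_⟩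
  have hθT' : ∀ t ≤ T.N, LQT.vnorm (T.θ t) ≤ max θbar 0 := fun t ht =>
    (hθT t ht).trans (le_max_left _ _)
  have hT := LQT.Tracking.isBounded_of_mem hS hμf hμg hlf hlg hQ hR hQN hθT'
  obtain ⟨zs, hmin, hreg⟩ :=
    T.exists_minimizer_regret_le hS hm hN hT.symmQ hT.symmR hμc hmod
  have hlow := h₁ T hQ hR hQN hθT' zs hmin
  have hupp := h₂ T hQ hR hT
  set D := ∑ t ∈ Finset.Icc 1 T.N,
    (‖T.Pe t - T.Pe (t - 1)‖ + LQT.vnorm (T.βe t - T.βe (t - 1))) with hD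
  set X := ∑ t ∈ Finset.range (T.N + 1), LQT.vnorm (T.xePrev t - T.xe t) with hX
  have hD0 : 0 ≤ D :=
    Finset.sum_nonneg fun t _ => add_nonneg (norm_nonneg _) (LQT.vnorm_nonneg _)
  have hX0 : 0 ≤ X := Finset.sum_nonneg fun t _ => LQT.vnorm_nonneg _
  have hs : 0 < Real.sqrt (lc / μc) := Real.sqrt_pos.2 (div_pos hlc hμc)
  have hφ : (Real.sqrt (lc / μc) - 1) / Real.sqrt (lc / μc) = 1 - 1 / Real.sqrt (lc / μc) := by
    rw [sub_div, div_self hs.ne']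
  rw [hφ]
  refine (hreg W).trans ?_
  set E := (lc / μc) ^ 2 * (1 - 1 / Real.sqrt (lc / μc)) ^ (2 * S.iterations W) with hE
  have hE0 : 0 ≤ E := by
    rw [hE, pow_mul]
    positivity
  have hgap : T.C (T.toVec T.foss) - T.C zs ≤ (c₁ + c₂) * (D + X) := by
    have := mul_nonneg hc₁ hX0
    have := mul_nonneg hc₂ hD0
    linarith
  calc 3 / 2 * E * (T.C (T.toVec T.foss) - T.C zs)
      ≤ 3 / 2 * E * ((c₁ + c₂) * (D + X)) := mul_le_mul_of_nonneg_left hgap (by positivity)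
    _ ≤ 3 / 2 * E * ((c₁ + c₂) * (D + X)) + E * (D + X) :=
      le_add_of_nonneg_right (mul_nonneg hE0 (add_nonneg hD0 hX0))
    _ = (3 / 2 * (c₁ + c₂) + 1) * (E * (D + X)) := by ring
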